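/- Let $0<q<1$ and let $s,t\in\mathbb R$ with $|s|,|t|\ge 1$. Write $(a;p)_k=\prod_{0\le i<k}(1-ap^i)$ for $k\in\{0,1,2,\dots\}\cup\{\infty\}$, $(a_1,\dots,a_r;p)_k=\prod_j(a_j;p)_k$ and $\mu(z)=\tfrac12(z+z^{-1})$. Put $$\psi(z)=\frac{(1-qstz)(1-qsz/t)(1-qtz/s)(1-qz/st)}{(1-z^2)(1-q^2z^2)},\qquad L=\psi(z)(T_{q^2}-1)+\psi(z^{-1})(T_{q^{-2}}-1),\qquad (T_p\Phi)(z)=\Phi(pz).$$ **The measure.** For real nonzero $a,b,c,d$ and $0<p<1$ let $$h_0=\frac{(abcd;p)_\infty}{(p,ab,ac,ad,bc,bd,cd;p)_\infty},\qquad w(z;a,b,c,d|p)=\frac{(z^2,z^{-2};p)_\infty}{(az,a/z,bz,b/z,cz,c/z,dz,d/z;p)_\infty},$$ $$w_k(a;b,c,d|p)=\frac{(a^{-2};p)_\infty}{(p,ab,b/a,ac,c/a,ad,d/a;p)_\infty}\,\frac{1-a^2p^{2k}}{1-a^2}\,\frac{(a^2,ab,ac,ad;p)_k}{(p,ap/b,ap/c,ap/d;p)_k}\Bigl(\frac{p}{abcd}\Bigr)^k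 ,$$ and $$\int_{\mathbb R} f\,dm(\cdot;a,b,c,d|p)=\frac1{2\pi h_0}\int_0^\pi f(\cos\theta)\,w(e^{i\theta};a,b,c,d|p)\,d\theta+\frac1{h_0}\sum_{e}\sum_{k\ge0,\ |ep^k|>1}f(\mu(ep^k))\,w_k(e),$$ where $e$ runs over $a,b,c,d$ and $w_k(e)$ is $w_k(e;\cdot,\cdot,\cdot|p)$ with the other three parameters in the remaining places. Further let $$\int_{\mathbb R} f\,d\nu(\cdot;a,b;d|p)=h_0(a,b,p/d,d|p)\int_{\mathbb R} f\,dm(\cdot;a,b,p/d,d|p)+\sum_{k=1}^\infty f(\mu(dp^{-k}))\,\frac{-d^{2(k-1)}p^{-k(k-1)}(1-d^2p^{-2k})}{(p,p,adp^{-k},bdp^{-k},ap^k/d,bp^k/d;p)_\infty}.$$ (For generic parameters $w_k(a;b,c,d|p)$ is the residue of $z\mapsto w(z;a,b,c,d|p)/z$ at $z=ap^k$, and the coefficient of $f(\mu(dp^{-k}))$ in the last sum is the residue of $z\mapsto w(z;a,b,p/d,d|p)/z$ at $z=dp^{-k}$.) Set $\nu=\nu(\cdot;qs/t,qt/s;-qst|q^2)$,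 a positive measure on $\mathbb R$. **Claim.** Let $f,g:\mathbb R\to\mathbb C$ be continuous and compactly supported, such that the functions $F(z)=f(\mu(z))$ and $G(z)=g(\mu(z))$ (defined for those $z\neq0$ with $\mu(z)\in\mathbb R$) have an analytic continuation to a neighbourhood of $\{z\in\mathbb C: q^2\le|z|\le q^{-2}\}$. For $x=\mu(z)\in\mathbb R$ let $(Lf)(x)=(LF)(z)$ and $(Lg)(x)=(LG)(z)$, where the analytic continuation is used in the annulus; at the removable singularities $x=\pm1$ and $x=\pm\mu(q)$ the value is defined by continuity. Then $(Lf)\,\bar g$ and $f\,\overline{Lg}$ are $\nu$-integrable and $$\int_{\mathbb R}(Lf)(x)\,\overline{g(x)}\,d\nu(x;qs/t,qt/s;-qst|q^2)=\int_{\mathbb R}f(x)\,\overline{(Lg)(x)}\,d\nu(x;qs/t,qt/s;-qst|q^2).$$ -/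

import Mathlib

open MeasureTheory Filter Topology
open scoped ComplexConjugate

noncomputable section

namespace AskeyWilson

/-- The finite `q`-shifted factorial `(a₁, …, aᵣ; q)_k = ∏ⱼ ∏_{i < k} (1 - aⱼ qⁱ)`. -/
def qPoch {R : Type*} [CommRing R] (l : List R) (q : R) (k : ℕ) : R :=
  (l.map fun a => ∏ i ∈ Finset.range k, (1 - a * q ^ i)).prod

/-- The infinite `q`-shifted factorial `(a₁, …, aᵣ; q)_∞ = ∏ⱼ ∏_{i ≥ 0} (1 - aⱼ qⁱ)`. -/
def qPochInf {R : Type*} [CommRing R] [TopologicalSpace R] (l : List R) (q : R) : R :=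
  (l.map fun a => ∏' i : ℕ, (1 - a * q ^ i)).prod

/-- `μ(z) = (z + z⁻¹) / 2`. -/
def mu {K : Type*} [Field K] (z : K) : K := (z + z⁻¹) / 2

/-- `h₀(a, b, c, d | q)`. -/
def h0 (a b c d q : ℝ) : ℝ :=
  qPochInf [a * b * c * d] q / qPochInf [q, a * b, a * c, a * d, b * c, b * d, c * d] q

/-- The Askey-Wilson weight function `w(z; a, b, c, d | q)`. -/
def weight (a b c d q : ℝ) (z : ℂ) : ℂ :=
  qPochInf [z ^ 2, (z ^ 2)⁻¹] (q : ℂ) /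
    qPochInf [a * z, a / z, b * z, b / z, c * z, c / z, d * z, d / z] (q : ℂ)

/-- The mass `w_k(a; b, c, d | q)` at the point `μ(a q^k)`. For generic parameters it is the
residue at `z = a q^k` of `w(z; a, b, c, d | q) / z`. -/
def awMass (a b c d q : ℝ) (k : ℕ) : ℝ :=
  qPochInf [(a ^ 2)⁻¹] q / qPochInf [q, a * b, b / a, a * c, c / a, a * d, d / a] q *
    ((1 - a ^ 2 * q ^ (2 * k)) / (1 - a ^ 2)) *
    (qPoch [a ^ 2, a * b, a * c, a * d] q k /
      qPoch [q, a * q / b, a * q / c, a * q / d] q k) *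
    (q / (a * b * c * d)) ^ k

/-- The masses at the points `μ(a q^k)`, `k ≥ 0`, with `|a q^k| > 1`
(for `0 < q < 1` there are none unless `|a| > 1`). -/
def awPointPart (a b c d q : ℝ) : Measure ℝ :=
  Measure.sum fun k : ℕ =>
    if 1 < |a * q ^ k| then ENNReal.ofReal (awMass a b c d q k) • Measure.dirac (mu (a * q ^ k))
    else 0

/-- The absolutely continuous part on `[-1, 1]`: the functional
`p ↦ (1 / 2π) ∫_0^π p(cos θ) w(e^{iθ}) dθ`. The weight is real and nonnegative there. -/
def awContinuousPart (a b c d q : ℝ) : Measure ℝ :=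
  ENNReal.ofReal (1 / (2 * Real.pi)) •
    ((volume.restrict (Set.Icc 0 Real.pi)).withDensity fun θ =>
      ENNReal.ofReal (weight a b c d q (Complex.exp (θ * Complex.I))).re).map Real.cos

/-- The normalised Askey-Wilson measure `dm(·; a, b, c, d | q)`. -/
def awMeasure (a b c d q : ℝ) : Measure ℝ :=
  ENNReal.ofReal (1 / h0 a b c d q) •
    (awContinuousPart a b c d q +
      (awPointPart a b c d q + awPointPart b a c d q +
        awPointPart c a b d q + awPointPart d a b c q))

/-- The mass of the additional point `μ(d q^{-k})`, `k ≥ 1`. For generic parameters it is the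
residue at `z = d q^{-k}` of `w(z; a, b, q/d, d | q) / z`. -/
def nuMass (a b d q : ℝ) (k : ℕ) : ℝ :=
  -(d ^ (2 * ((k : ℤ) - 1)) * q ^ (-((k : ℤ) * ((k : ℤ) - 1))) *
      (1 - d ^ 2 * q ^ (-(2 * (k : ℤ))))) /
    qPochInf [q, q, a * d * q ^ (-(k : ℤ)), b * d * q ^ (-(k : ℤ)),
      a * q ^ k / d, b * q ^ k / d] q

/-- The measure `dν(·; a, b; d | q)`: the measure `h₀(a, b, q/d, d | q) dm(·; a, b, q/d, d | q)`
together with the additional point masses at `μ(d q^{-k})`, `k = 1, 2, 3, …`. -/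
def nu (a b d q : ℝ) : Measure ℝ :=
  ENNReal.ofReal (h0 a b (q / d) d q) • awMeasure a b (q / d) d q +
    Measure.sum fun j : ℕ =>
      ENNReal.ofReal (nuMass a b d q (j + 1)) • Measure.dirac (mu (d * q ^ (-((j : ℤ) + 1))))

/-- The coefficient `ψ(z)` of the second order `q`-difference operator. -/
def psi (q s t : ℝ) (z : ℂ) : ℂ :=
  (1 - q * s * t * z) * (1 - q * s * z / t) * (1 - q * t * z / s) * (1 - q * z / (s * t)) /
    ((1 - z ^ 2) * (1 - q ^ 2 * z ^ 2))

/-- The `q`-difference operator `L = ψ(z) (T_{q²} - 1) + ψ(z⁻¹) (T_{q⁻²} - 1)`, where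
`(T_p Φ)(z) = Φ(p z)`. -/
def qDiffOp (q s t : ℝ) (Φ : ℂ → ℂ) (z : ℂ) : ℂ :=
  psi q s t z * (Φ (q ^ 2 * z) - Φ z) + psi q s t z⁻¹ * (Φ (((q : ℂ) ^ 2)⁻¹ * z) - Φ z)

/-- The closed annulus `q² ≤ |z| ≤ q⁻²`. -/
def annulus (q : ℝ) : Set ℂ := {z | q ^ 2 ≤ ‖z‖ ∧ ‖z‖ ≤ (q ^ 2)⁻¹}

/-- `F` is an analytic continuation of `z ↦ f(μ(z))` (defined for those `z ≠ 0` for which `μ(z)`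
is real) to an open neighbourhood of the annulus `q² ≤ |z| ≤ q⁻²`. -/
def IsAnalyticContinuation (q : ℝ) (f : ℝ → ℂ) (F : ℂ → ℂ) : Prop :=
  ∃ U : Set ℂ, IsOpen U ∧ annulus q ⊆ U ∧ AnalyticOnNhd ℂ F U ∧
    ∀ z ∈ U, z ≠ 0 → ∀ x : ℝ, mu z = (x : ℂ) → F z = f x

open Classical in
/-- The function `z ↦ f(μ(z))`, read through its analytic continuation `F` on the annulus. -/
def pullback (q : ℝ) (f : ℝ → ℂ) (F : ℂ → ℂ) (z : ℂ) : ℂ :=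
  if z ∈ annulus q then F z else f (mu z).re

/-- A point `z` with `μ(z) = x` and `|z| ≥ 1`: on the upper unit half circle if `|x| ≤ 1`,
and real otherwise. -/
def muInv (x : ℝ) : ℂ :=
  if |x| ≤ 1 then x + √(1 - x ^ 2) * Complex.I
  else if 0 < x then ((x + √(x ^ 2 - 1) : ℝ) : ℂ) else ((x - √(x ^ 2 - 1) : ℝ) : ℂ)

/-- The function `Lf` on the real line, `(Lf)(μ(z)) = (L(f ∘ μ))(z)`. The coefficients of `L`
are singular at `z = ±1` and at `z = ±q, ±q⁻¹`, that is at `x = ±1` and `x = ±μ(q)`; these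
singularities of `Lf` are removable, and the value of `Lf` there is the one given by continuity. -/
def radialCasimir (q s t : ℝ) (f : ℝ → ℂ) (F : ℂ → ℂ) (x : ℝ) : ℂ :=
  if |x| = 1 ∨ |x| = mu q then
    limUnder (𝓝[≠] x) fun y : ℝ => qDiffOp q s t (pullback q f F) (muInv y)
  else qDiffOp q s t (pullback q f F) (muInv x)

end AskeyWilson

end

namespace AskeyWilson

/-! Put p = q², a = qs/t, d = -qst. The four parameters are then a, p/a, p/d, d, and the denominator
of the Askey-Wilson weight pairs up into theta functions: the weight is (z - z⁻¹) E(z)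
(`weight_eq`), where E = `ellWeight p a d` satisfies E(pz) = E(z) and E(z⁻¹) = -E(z). Each mass at
μ(z), with z on the chain of a or of d, is (z - z⁻¹) times a constant of that chain (`awMass_eq`,
`nuMass_eq`).

The operator fits this structure: (z - z⁻¹)(Lf)(μ(z)) = X(z) - X(z/p) with X(z) = (z -
z⁻¹)ψ(z)(F(pz) - F(z)) (`sub_inv_mul_qDiffOp`). Conjugation reduces the claim to a bilinear one
(`RadialData.conj`). If Z is the analogue of X for G, the Casoratian J = XG - FZ satisfies (z -
z⁻¹)(Lf·g - f·Lg) = J(z) - J(z/p) and J(1/(pz)) = J(z).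

Hence the mass sums telescope. For the chain of a one end is J(a/p) = 0, because a factor of the
coefficient vanishes there (`RadialData.casoratian_start`); the chain of d runs out to infinity,
where f and g vanish. There remains r J(v) + r' J(w), where v and w are the representatives of the
two chains in 1 < |z| ≤ p⁻¹ and r, r' the chain constants.

The continuous part is half the circle average of E(z)(J(z) - J(z/p)). Since E is p-elliptic, this
average is the difference of the averages of EJ over |z| = 1 and |z| = p⁻¹, that is, minus the
residues in the annulus. These sit at v, w and at their reflections under z ↦ 1/(pz), in equal
pairs, so the average is -2(r J(v) + r' J(w)) (`circleAverage_ellWeight`) and everything cancels.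

The delicate point is that parameters need not be generic: poles may collide (v² = p⁻¹) or lie on
the contours (|v| = p⁻¹). Therefore E is compared with an explicit `poleKernel` having the same
polar part in all cases (`tendsto_theta_sq_div`), for which the average of K(z) - K(z/p) is always
-2 (`circleAverage_poleKernel_sub`). The assumption |t| ≤ |s|, harmless by symmetry (`nu_swap`),
ensures that p/a carries no masses. -/

/-- The infinite `q`-shifted factorial `(x; p)_∞` of one complex argument. -/
noncomputable def shiftedFactorial (p : ℝ) (x : ℂ) : ℂ := ∏' i : ℕ, (1 - x * (p : ℂ) ^ i)

/-! ### Shifted factorials and the theta function -/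

section
variable {p : ℝ}

lemma summable_norm_mul_pow (hp0 : 0 < p) (hp1 : p < 1) (x : ℂ) :
    Summable fun i : ℕ => ‖-(x * (p : ℂ) ^ i)‖ := by
  simpa [abs_of_pos hp0] using (summable_geometric_of_lt_one hp0.le hp1).mul_left ‖x‖

lemma multipliable_one_sub_mul_pow (hp0 : 0 < p) (hp1 : p < 1) (x : ℂ) :
    Multipliable fun i : ℕ => 1 - x * (p : ℂ) ^ i := by
  simpa [sub_eq_add_neg] using multipliable_one_add_of_summable (summable_norm_mul_pow hp0 hp1 x)

lemma shiftedFactorial_eq_mul (hp0 : 0 < p) (hp1 : p < 1) (x : ℂ) :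
    shiftedFactorial p x = (1 - x) * shiftedFactorial p (p * x) := by
  have hx : ∀ i : ℕ, 1 - p * x * (p : ℂ) ^ i = 1 - x * (p : ℂ) ^ (i + 1) := fun i => by ring
  have h := multipliable_one_sub_mul_pow hp0 hp1 (p * x)
  simp only [hx] at h
  have key := tprod_eq_zero_mul' (f := fun i : ℕ => 1 - x * (p : ℂ) ^ i) h
  simp only [shiftedFactorial, hx]
  rw [key, pow_zero, mul_one]

lemma shiftedFactorial_ne_zero (hp0 : 0 < p) (hp1 : p < 1) {x : ℂ}
    (hx : ∀ i : ℕ, x * (p : ℂ) ^ i ≠ 1) : shiftedFactorial p x ≠ 0 := by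
  have := tprod_one_add_ne_zero_of_summable (f := fun i : ℕ => -(x * (p : ℂ) ^ i))
    (fun i => by
      rw [← sub_eq_add_neg, sub_ne_zero]
      exact (hx i).symm) (summable_norm_mul_pow hp0 hp1 x)
  simpa [shiftedFactorial, sub_eq_add_neg] using this

lemma shiftedFactorial_ne_zero_of_norm_lt (hp0 : 0 < p) (hp1 : p < 1) {x : ℂ} (hx : ‖x‖ < 1) :
    shiftedFactorial p x ≠ 0 := by
  refine shiftedFactorial_ne_zero hp0 hp1 fun i h => ?_
  have h1 := congrArg norm h
  rw [norm_mul, norm_pow, Complex.norm_real, Real.norm_of_nonneg hp0.le, norm_one] at h1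
  have : p ^ i ≤ 1 := pow_le_one₀ hp0.le hp1.le
  nlinarith [norm_nonneg x, pow_pos hp0 i]

/-- On a compact set bounded by C the factors differ from 1 by at most C pⁿ, so the product
converges uniformly there. -/
lemma differentiable_shiftedFactorial (hp0 : 0 < p) (hp1 : p < 1) :
    Differentiable ℂ (shiftedFactorial p) := by
  have key : HasProdLocallyUniformlyOn (fun (n : ℕ) (x : ℂ) ↦ 1 + -(x * (p : ℂ) ^ n))
      (fun x => ∏' n : ℕ, (1 + -(x * (p : ℂ) ^ n))) Set.univ := by
    apply hasProdLocallyUniformlyOn_of_forall_compact isOpen_univ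
    intro K hK hcK
    obtain ⟨C, hC⟩ := hcK.isBounded.exists_norm_le
    refine ((summable_geometric_of_lt_one hp0.le hp1).mul_left C).hasProdUniformlyOn_nat_one_add
      hcK (.of_forall fun n x hx ↦ ?_) (fun _ ↦ by fun_prop)
    rw [norm_neg, norm_mul, norm_pow, Complex.norm_real, Real.norm_of_nonneg hp0.le]
    exact mul_le_mul_of_nonneg_right (hC x hx) (by positivity)
  have := key.differentiableOn
    (.of_forall fun _ ↦ by simpa [Finset.prod_fn] using
      DifferentiableOn.finsetProd (fun _ _ ↦ by fun_prop)) isOpen_univ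
  rw [← differentiableOn_univ]
  refine this.congr fun x _ => ?_
  simp [shiftedFactorial, sub_eq_add_neg]

lemma conj_shiftedFactorial (hp0 : 0 < p) (hp1 : p < 1) (x : ℂ) :
    conj (shiftedFactorial p x) = shiftedFactorial p (conj x) := by
  have := Multipliable.map_tprod (multipliable_one_sub_mul_pow hp0 hp1 x) (starRingEnd ℂ)
    Complex.continuous_conj
  rw [shiftedFactorial, shiftedFactorial, this]
  simp

lemma multipliable_one_sub_mul_pow_real (hp0 : 0 < p) (hp1 : p < 1) (x : ℝ) :
    Multipliable fun i : ℕ => 1 - x * p ^ i := by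
  have h : Summable fun i : ℕ => ‖-(x * p ^ i)‖ := by
    simpa [abs_of_pos hp0] using (summable_geometric_of_lt_one hp0.le hp1).mul_left ‖x‖
  simpa [sub_eq_add_neg] using multipliable_one_add_of_summable h

lemma ofReal_tprod (hp0 : 0 < p) (hp1 : p < 1) (x : ℝ) :
    ((∏' i : ℕ, (1 - x * p ^ i) : ℝ) : ℂ) = shiftedFactorial p x := by
  have := Multipliable.map_tprod (multipliable_one_sub_mul_pow_real hp0 hp1 x) Complex.ofRealHom
    Complex.continuous_ofReal
  rw [shiftedFactorial]
  simpa using this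

lemma tprod_one_sub_mul_pow_pos (hp0 : 0 < p) (hp1 : p < 1) {x : ℝ} (hx : x < 1) :
    0 < ∏' i : ℕ, (1 - x * p ^ i) := by
  have hlt : ∀ i : ℕ, x * p ^ i < 1 := fun i => by
    have h1 : p ^ i ≤ 1 := pow_le_one₀ hp0.le hp1.le
    have h2 : 0 < p ^ i := pow_pos hp0 i
    rcases le_or_gt x 0 with h | h
    · nlinarith
    · nlinarith
  refine lt_of_le_of_ne (tprod_nonneg fun i => by linarith [hlt i]) fun h => ?_
  have h' := ofReal_tprod hp0 hp1 x
  rw [← h] at h'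
  refine shiftedFactorial_ne_zero hp0 hp1 (x := x) (fun i hi => ?_) (by simpa using h'.symm)
  exact (hlt i).ne (by exact_mod_cast hi)

/-- The theta function `θ(x; p) = (x, p / x; p)_∞`. -/
noncomputable def theta (p : ℝ) (x : ℂ) : ℂ := shiftedFactorial p x * shiftedFactorial p (p / x)

lemma theta_div (hp0 : 0 < p) {x : ℂ} : theta p (p / x) = theta p x := by
  have : (p : ℂ) ≠ 0 := by exact_mod_cast hp0.ne'
  rw [theta, theta, div_div_cancel₀ this, mul_comm]

/-- Passing from x to px removes the factor 1 - x from one product and adds 1 - x⁻¹ to the other.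
All periodicity below comes from this. -/
lemma theta_mul (hp0 : 0 < p) (hp1 : p < 1) {x : ℂ} (hx : x ≠ 0) :
    theta p (p * x) = -x⁻¹ * theta p x := by
  have hp : (p : ℂ) ≠ 0 := by exact_mod_cast hp0.ne'
  rw [theta, theta, shiftedFactorial_eq_mul hp0 hp1 x, div_mul_cancel_left₀ hp,
    shiftedFactorial_eq_mul hp0 hp1 x⁻¹, ← div_eq_mul_inv (p : ℂ) x]
  field_simp
  ring

lemma theta_eq (hp0 : 0 < p) (hp1 : p < 1) {x : ℂ} (hx : x ≠ 0) :
    theta p x = -x * theta p (p * x) := by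
  rw [theta_mul hp0 hp1 hx]
  field_simp

lemma theta_inv (hp0 : 0 < p) (hp1 : p < 1) {x : ℂ} (hx : x ≠ 0) :
    theta p x⁻¹ = -x⁻¹ * theta p x := by
  rw [← theta_mul hp0 hp1 hx, ← theta_div hp0 (x := p * x),
    div_mul_cancel_left₀ (by exact_mod_cast hp0.ne')]

lemma theta_eq_one_sub_mul (hp0 : 0 < p) (hp1 : p < 1) (x : ℂ) :
    theta p x = (1 - x) * (shiftedFactorial p (p * x) * shiftedFactorial p (p / x)) := by
  rw [theta, shiftedFactorial_eq_mul hp0 hp1 x, mul_assoc]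

lemma differentiableAt_theta (hp0 : 0 < p) (hp1 : p < 1) {x : ℂ} (hx : x ≠ 0) :
    DifferentiableAt ℂ (theta p) x :=
  (differentiable_shiftedFactorial hp0 hp1 x).mul
    ((differentiable_shiftedFactorial hp0 hp1 _).comp x
      ((differentiableAt_const _).div differentiableAt_id hx))

lemma analyticAt_theta (hp0 : 0 < p) (hp1 : p < 1) {x : ℂ} (hx : x ≠ 0) :
    AnalyticAt ℂ (theta p) x := by
  rw [Complex.analyticAt_iff_eventually_differentiableAt]
  filter_upwards [isOpen_ne.mem_nhds hx] with y hy
  exact differentiableAt_theta hp0 hp1 hy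

lemma theta_ne_zero (hp0 : 0 < p) (hp1 : p < 1) {x : ℂ} (hx0 : x ≠ 0)
    (hx : ∀ n : ℤ, x ≠ (p : ℂ) ^ n) : theta p x ≠ 0 := by
  have hp : (p : ℂ) ≠ 0 := by exact_mod_cast hp0.ne'
  refine mul_ne_zero (shiftedFactorial_ne_zero hp0 hp1 fun i h => hx (-i) ?_)
    (shiftedFactorial_ne_zero hp0 hp1 fun i h => hx (i + 1) ?_)
  · rw [zpow_neg, zpow_natCast]
    exact eq_inv_of_mul_eq_one_left h
  · rw [zpow_add₀ hp, zpow_natCast, zpow_one]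
    field_simp at h
    rw [← h]
    ring

lemma hasDerivAt_theta_one (hp0 : 0 < p) (hp1 : p < 1) :
    ∃ c ≠ 0, HasDerivAt (theta p) c 1 ∧ theta p 1 = 0 := by
  have hpn : ‖(p : ℂ)‖ < 1 := by simpa [abs_of_pos hp0] using hp1
  set S : ℂ → ℂ := fun x => shiftedFactorial p (p * x) * shiftedFactorial p (p / x) with hS
  have hSd : DifferentiableAt ℂ S 1 :=
    ((differentiable_shiftedFactorial hp0 hp1 _).comp 1 (by fun_prop)).mul
    ((differentiable_shiftedFactorial hp0 hp1 _).comp 1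
      ((differentiableAt_const _).div differentiableAt_id one_ne_zero))
  have h : HasDerivAt (fun x => (1 - x) * S x) ((0 - 1) * S 1 + (1 - 1) * deriv S 1) 1 :=
    ((hasDerivAt_const _ _).sub (hasDerivAt_id _)).mul hSd.hasDerivAt
  refine ⟨(0 - 1) * S 1 + (1 - 1) * deriv S 1, ?_, ?_, ?_⟩
  · simpa [hS] using shiftedFactorial_ne_zero_of_norm_lt hp0 hp1 hpn
  · rwa [show theta p = fun x => (1 - x) * S x from funext (theta_eq_one_sub_mul hp0 hp1)]
  · rw [theta_eq_one_sub_mul hp0 hp1]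
    simp

/-- The relation θ(x) = -x θ(px) transports a simple zero from px to x; starting from the zero at 1
it reaches p⁻¹ and p⁻², the values needed where poles of the weight collide. -/
lemma hasDerivAt_theta_of_mul (hp0 : 0 < p) (hp1 : p < 1) {x : ℂ} (hx : x ≠ 0)
    (h : ∃ c ≠ 0, HasDerivAt (theta p) c (p * x) ∧ theta p (p * x) = 0) :
    ∃ c ≠ 0, HasDerivAt (theta p) c x ∧ theta p x = 0 := by
  have hp : (p : ℂ) ≠ 0 := by exact_mod_cast hp0.ne'
  obtain ⟨c, hc, hd, h0⟩ := h
  have h1 : HasDerivAt (fun y : ℂ => (p : ℂ) * y) ((p : ℂ) * 1) x :=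
    (hasDerivAt_id x).const_mul (p : ℂ)
  have h2 : HasDerivAt (fun y => -y * theta p (p * y))
      (-1 * theta p (p * x) + -x * (c * (p * 1))) x :=
    (hasDerivAt_id x).neg.mul (HasDerivAt.comp x hd h1)
  refine ⟨-1 * theta p (p * x) + -x * (c * (p * 1)), ?_, ?_, ?_⟩
  · simp [h0, hx, hc, hp]
  · refine h2.congr_of_eventuallyEq ?_
    filter_upwards [isOpen_ne.mem_nhds hx] with y hy
    exact theta_eq hp0 hp1 hy
  · rw [theta_eq hp0 hp1 hx, h0, mul_zero]

/-- The zeros of the theta function at `p⁻¹` and `p⁻²` are simple. -/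
lemma hasDerivAt_theta_inv (hp0 : 0 < p) (hp1 : p < 1) {x : ℂ}
    (hx : x = (p : ℂ)⁻¹ ∨ x = ((p : ℂ) ^ 2)⁻¹) :
    ∃ c ≠ 0, HasDerivAt (theta p) c x ∧ theta p x = 0 := by
  have hp : (p : ℂ) ≠ 0 := by exact_mod_cast hp0.ne'
  have h1 : ∃ c ≠ 0, HasDerivAt (theta p) c (p : ℂ)⁻¹ ∧ theta p (p : ℂ)⁻¹ = 0 := by
    apply hasDerivAt_theta_of_mul hp0 hp1 (inv_ne_zero hp)
    rw [mul_inv_cancel₀ hp]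
    exact hasDerivAt_theta_one hp0 hp1
  rcases hx with rfl | rfl
  · exact h1
  · apply hasDerivAt_theta_of_mul hp0 hp1 (inv_ne_zero (pow_ne_zero _ hp))
    rwa [show (p : ℂ) * ((p : ℂ) ^ 2)⁻¹ = (p : ℂ)⁻¹ by field_simp]

end

/-! ### The elliptic weight and its pole kernel -/

/-- The `p`-elliptic function with simple poles at `a^{±1} p^ℤ`, `d^{±1} p^ℤ` such that
`(z - z⁻¹) * ellWeight p a d z` is the Askey-Wilson weight with parameters `a, p/a, p/d, d`. -/
noncomputable def ellWeight (p : ℝ) (a d z : ℂ) : ℂ :=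
  theta p (z ^ 2) /
    (z * ((theta p (a * z) * theta p (a / z)) * (theta p (d * z) * theta p (d / z))))

/-- The residue of `ellWeight p a d z / z` at `z = a` for generic `a`. -/
noncomputable def ellResidue (p : ℝ) (a d : ℂ) : ℂ :=
  1 / (a * shiftedFactorial p p ^ 2 * (theta p (a * d) * theta p (d / a)))

section
variable {p : ℝ}

lemma ellWeight_comm (a d z : ℂ) : ellWeight p a d z = ellWeight p d a z := by
  simp only [ellWeight]
  rw [mul_comm (theta p (a * z) * theta p (a / z))]

lemma theta_pair_mul (hp0 : 0 < p) (hp1 : p < 1) {a z : ℂ} (ha : a ≠ 0) (hz : z ≠ 0) :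
    theta p (p * a * z) * theta p (p * a / z) =
      (a ^ 2)⁻¹ * (theta p (a * z) * theta p (a / z)) := by
  rw [mul_assoc, mul_div_assoc, theta_mul hp0 hp1 (mul_ne_zero ha hz),
    theta_mul hp0 hp1 (div_ne_zero ha hz)]
  field_simp

lemma theta_pair_inv (a z : ℂ) :
    theta p (a * z⁻¹) * theta p (a / z⁻¹) = theta p (a * z) * theta p (a / z) := by
  rw [div_inv_eq_mul, ← div_eq_mul_inv, mul_comm]

/-- Moving a along its chain costs only a constant. `ellResidue_mul_left` and `ellResidue_mul_right`
show the same constant for both residues, so the residue formula does not depend on the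
representative. -/
lemma ellWeight_mul_left (hp0 : 0 < p) (hp1 : p < 1) {a d z : ℂ} (ha : a ≠ 0) (hz : z ≠ 0) :
    ellWeight p (p * a) d z = a ^ 2 * ellWeight p a d z := by
  rw [ellWeight, ellWeight, theta_pair_mul hp0 hp1 ha hz]
  field_simp

lemma ellWeight_inv (hp0 : 0 < p) (hp1 : p < 1) {a d z : ℂ} (hz : z ≠ 0) :
    ellWeight p a d z⁻¹ = -ellWeight p a d z := by
  rw [ellWeight, ellWeight, theta_pair_inv, theta_pair_inv, inv_pow,
    theta_inv hp0 hp1 (pow_ne_zero 2 hz)]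
  field_simp

/-- The multipliers balance: (pz⁴)⁻¹ from θ(z²) above, and p from the factor z together with (pz²)⁻¹
from each of the two theta pairs below. -/
lemma ellWeight_mul (hp0 : 0 < p) (hp1 : p < 1) {a d z : ℂ} (ha : a ≠ 0) (hd : d ≠ 0)
    (hz : z ≠ 0) : ellWeight p a d (p * z) = ellWeight p a d z := by
  have hp : (p : ℂ) ≠ 0 := by exact_mod_cast hp0.ne'
  have h : ∀ a : ℂ, a ≠ 0 → theta p (a * (p * z)) * theta p (a / (p * z)) =
      (p * z ^ 2)⁻¹ * (theta p (a * z) * theta p (a / z)) := fun a ha => by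
    have h1 := theta_mul hp0 hp1 (x := a / (p * z)) (by positivity)
    rw [show (p : ℂ) * (a / (p * z)) = a / z by field_simp] at h1
    rw [show a * (p * z) = p * (a * z) by ring, theta_mul hp0 hp1 (mul_ne_zero ha hz), h1]
    field_simp
  have h2 : theta p ((p * z) ^ 2) = (p * z ^ 4)⁻¹ * theta p (z ^ 2) := by
    rw [show ((p : ℂ) * z) ^ 2 = p * (p * z ^ 2) by ring,
      theta_mul hp0 hp1 (by positivity), theta_mul hp0 hp1 (by positivity)]
    field_simp
  rw [ellWeight, ellWeight, h a ha, h d hd, h2]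
  field_simp

lemma ellWeight_div (hp0 : 0 < p) (hp1 : p < 1) {a d z : ℂ} (ha : a ≠ 0) (hd : d ≠ 0)
    (hz : z ≠ 0) : ellWeight p a d (z / p) = ellWeight p a d z := by
  have hp : (p : ℂ) ≠ 0 := by exact_mod_cast hp0.ne'
  rw [← ellWeight_mul hp0 hp1 ha hd (div_ne_zero hz hp), mul_div_cancel₀ _ hp]

lemma ellResidue_mul_left (hp0 : 0 < p) (hp1 : p < 1) {a d : ℂ} (ha : a ≠ 0) (hd : d ≠ 0) :
    ellResidue p (p * a) d = a ^ 2 * ellResidue p a d := by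
  have hp : (p : ℂ) ≠ 0 := by exact_mod_cast hp0.ne'
  have h1 := theta_mul hp0 hp1 (x := d / (p * a)) (by positivity)
  rw [show (p : ℂ) * (d / (p * a)) = d / a by field_simp] at h1
  rw [ellResidue, ellResidue, h1, show (p : ℂ) * a * d = p * (a * d) by ring,
    theta_mul hp0 hp1 (mul_ne_zero ha hd)]
  field_simp

lemma ellResidue_mul_right (hp0 : 0 < p) (hp1 : p < 1) {a d : ℂ} (ha : a ≠ 0) (hd : d ≠ 0) :
    ellResidue p a (p * d) = d ^ 2 * ellResidue p a d := by
  rw [ellResidue, ellResidue, show a * (p * d) = p * d * a by ring, theta_pair_mul hp0 hp1 hd ha,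
    mul_comm d a]
  field_simp

lemma meromorphicAt_ellWeight (hp0 : 0 < p) (hp1 : p < 1) {a d z : ℂ} (ha : a ≠ 0) (hd : d ≠ 0)
    (hz : z ≠ 0) : MeromorphicAt (ellWeight p a d) z := by
  have h1 : ∀ a : ℂ, a ≠ 0 → AnalyticAt ℂ (fun z => theta p (a * z)) z := fun a ha =>
    (analyticAt_theta hp0 hp1 (mul_ne_zero ha hz)).fun_comp (by fun_prop)
  have h2 : ∀ a : ℂ, a ≠ 0 → AnalyticAt ℂ (fun z => theta p (a / z)) z := fun a ha =>
    (analyticAt_theta hp0 hp1 (div_ne_zero ha hz)).fun_comp (analyticAt_const.div analyticAt_id hz)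
  have h3 : AnalyticAt ℂ (fun z => theta p (z ^ 2)) z :=
    AnalyticAt.fun_comp (f := fun z => z ^ 2) (analyticAt_theta hp0 hp1 (pow_ne_zero 2 hz))
      (by fun_prop)
  exact h3.meromorphicAt.div
    (analyticAt_id.mul (((h1 a ha).mul (h2 a ha)).mul ((h1 d hd).mul (h2 d hd)))).meromorphicAt

lemma analyticAt_ellWeight (hp0 : 0 < p) (hp1 : p < 1) {a d z : ℂ} (ha : a ≠ 0) (hd : d ≠ 0)
    (hz : z ≠ 0) (h1 : theta p (a * z) ≠ 0) (h2 : theta p (a / z) ≠ 0)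
    (h3 : theta p (d * z) ≠ 0) (h4 : theta p (d / z) ≠ 0) : AnalyticAt ℂ (ellWeight p a d) z := by
  have h1' : ∀ a : ℂ, a ≠ 0 → AnalyticAt ℂ (fun z => theta p (a * z)) z := fun a ha =>
    (analyticAt_theta hp0 hp1 (mul_ne_zero ha hz)).fun_comp (by fun_prop)
  have h2' : ∀ a : ℂ, a ≠ 0 → AnalyticAt ℂ (fun z => theta p (a / z)) z := fun a ha =>
    (analyticAt_theta hp0 hp1 (div_ne_zero ha hz)).fun_comp (analyticAt_const.div analyticAt_id hz)
  have h3' : AnalyticAt ℂ (fun z => theta p (z ^ 2)) z :=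
    AnalyticAt.fun_comp (f := fun z => z ^ 2) (analyticAt_theta hp0 hp1 (pow_ne_zero 2 hz))
      (by fun_prop)
  exact h3'.div (analyticAt_id.mul (((h1' a ha).mul (h2' a ha)).mul ((h1' d hd).mul (h2' d hd))))
    (mul_ne_zero hz (mul_ne_zero (mul_ne_zero h1 h2) (mul_ne_zero h3 h4)))

/-- The rational function with simple poles at the poles of `ellWeight` in the chain of `v` that
lie in the closed annulus `1 ≤ |z| ≤ p⁻¹`, when `1 < |v| ≤ p⁻¹`. -/
noncomputable def poleKernel (p : ℝ) (v z : ℂ) : ℂ :=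
  z / (z - v) + z / (z - p * v) + z / (z - (p * v)⁻¹) + z / (z - (p ^ 2 * v)⁻¹) - 2

/-- The reflection z ↦ (pz)⁻¹ exchanges v with (pv)⁻¹ and pv with (p²v)⁻¹, and turns z/(z - l) into
1 - z/(z - m), where m is the reflection of l; the constant -2 makes the sum odd, as `ellWeight` is.
The poles pv and (p²v)⁻¹ touch the annulus only if |v| = p⁻¹, where they merge with the other two;
keeping them makes the boundary case uniform. -/
lemma poleKernel_reflect (hp0 : 0 < p) {v z : ℂ} (hv : v ≠ 0) (hz : z ≠ 0)
    (h1 : z ≠ v) (h2 : z ≠ p * v) (h3 : z ≠ (p * v)⁻¹) (h4 : z ≠ (p ^ 2 * v)⁻¹) :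
    poleKernel p v (p * z)⁻¹ = -poleKernel p v z := by
  have hp : (p : ℂ) ≠ 0 := by exact_mod_cast hp0.ne'
  have key : ∀ l m : ℂ, l ≠ 0 → m = (p * l)⁻¹ → z ≠ m →
      (p * z)⁻¹ / ((p * z)⁻¹ - l) = 1 - z / (z - m) := fun l m hl hm h => by
    have hm0 : m ≠ 0 := by rw [hm]; positivity
    obtain rfl : l = (p * m)⁻¹ := by rw [hm]; field_simp
    have h' : z - m ≠ 0 := sub_ne_zero.2 h
    have h'' : (p * z)⁻¹ - (p * m)⁻¹ = -(z - m) / (p * z * m) := by field_simp; ring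
    rw [h'']
    field_simp
    ring
  rw [poleKernel, poleKernel, key v _ hv rfl h3,
    key (p * v) (p ^ 2 * v)⁻¹ (by positivity) (by field_simp) h4,
    key (p * v)⁻¹ v (by positivity) (by field_simp) h1,
    key (p ^ 2 * v)⁻¹ (p * v) (by positivity) (by field_simp) h2]
  ring

lemma tendsto_sub_mul_div_self {v : ℂ} :
    Tendsto (fun z => (z - v) * (z / (z - v))) (𝓝[≠] v) (𝓝 v) := by
  refine (tendsto_id.mono_left nhdsWithin_le_nhds).congr' ?_
  filter_upwards [self_mem_nhdsWithin] with z hz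
  have : z - v ≠ 0 := sub_ne_zero.2 hz
  simp only [id]
  field_simp

lemma tendsto_sub_mul_div_of_ne {s v : ℂ} (h : s ≠ v) :
    Tendsto (fun z => (z - s) * (z / (z - v))) (𝓝[≠] s) (𝓝 0) := by
  have : ContinuousAt (fun z => (z - s) * (z / (z - v))) s := by
    have := sub_ne_zero.2 h
    fun_prop (disch := assumption)
  simpa using this.tendsto.mono_left nhdsWithin_le_nhds

lemma exists_tendsto_sub_mul_poleKernel (v s : ℂ) :
    ∃ c, Tendsto (fun z => (z - s) * poleKernel p v z) (𝓝[≠] s) (𝓝 c) := by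
  have key : ∀ l, ∃ c, Tendsto (fun z => (z - s) * (z / (z - l))) (𝓝[≠] s) (𝓝 c) := fun l => by
    rcases eq_or_ne s l with rfl | h
    · exact ⟨_, tendsto_sub_mul_div_self⟩
    · exact ⟨_, tendsto_sub_mul_div_of_ne h⟩
  obtain ⟨c1, h1⟩ := key v
  obtain ⟨c2, h2⟩ := key (p * v)
  obtain ⟨c3, h3⟩ := key (p * v)⁻¹
  obtain ⟨c4, h4⟩ := key (p ^ 2 * v)⁻¹
  have h5 : Tendsto (fun z : ℂ => (z - s) * 2) (𝓝[≠] s) (𝓝 ((s - s) * 2)) :=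
    (Continuous.tendsto (by fun_prop) s).mono_left nhdsWithin_le_nhds
  refine ⟨_, ((((h1.add h2).add h3).add h4).sub h5).congr fun z => ?_⟩
  simp only [poleKernel]
  ring

lemma tendsto_sub_mul_poleKernel_of_ne {v s : ℂ} (h1 : s ≠ v) (h2 : s ≠ p * v)
    (h3 : s ≠ (p * v)⁻¹) (h4 : s ≠ (p ^ 2 * v)⁻¹) :
    Tendsto (fun z => (z - s) * poleKernel p v z) (𝓝[≠] s) (𝓝 0) := by
  have h5 : Tendsto (fun z : ℂ => (z - s) * 2) (𝓝[≠] s) (𝓝 ((s - s) * 2)) :=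
    (Continuous.tendsto (by fun_prop) s).mono_left nhdsWithin_le_nhds
  have := ((((tendsto_sub_mul_div_of_ne h1).add (tendsto_sub_mul_div_of_ne h2)).add
    (tendsto_sub_mul_div_of_ne h3)).add (tendsto_sub_mul_div_of_ne h4)).sub h5
  simp only [add_zero, sub_self, zero_mul] at this
  refine this.congr fun z => ?_
  simp only [poleKernel]
  ring

lemma analyticAt_poleKernel {v s : ℂ} (h1 : s ≠ v) (h2 : s ≠ p * v)
    (h3 : s ≠ (p * v)⁻¹) (h4 : s ≠ (p ^ 2 * v)⁻¹) : AnalyticAt ℂ (poleKernel p v) s := by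
  have key : ∀ l, s ≠ l → AnalyticAt ℂ (fun z => z / (z - l)) s := fun l hl =>
    analyticAt_id.div (analyticAt_id.sub analyticAt_const) (sub_ne_zero.2 hl)
  exact ((((key _ h1).add (key _ h2)).add (key _ h3)).add (key _ h4)).sub analyticAt_const

lemma meromorphicAt_poleKernel (v s : ℂ) : MeromorphicAt (poleKernel p v) s := by
  have key : ∀ l, MeromorphicAt (fun z => z / (z - l)) s := fun l =>
    analyticAt_id.meromorphicAt.div (analyticAt_id.sub analyticAt_const).meromorphicAt
  exact ((((key _).add (key _)).add (key _)).add (key _)).sub (MeromorphicAt.const 2 s)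

end

/-! ### Poles of the elliptic weight in the closed annulus -/

/-- The closed annulus `1 ≤ |z| ≤ p⁻¹`. -/
def outerAnnulus (p : ℝ) : Set ℂ := {z | 1 ≤ ‖z‖ ∧ ‖z‖ ≤ p⁻¹}

section
variable {p : ℝ}

lemma theta_ofReal_ne_zero_of_neg (hp0 : 0 < p) (hp1 : p < 1) {x : ℝ} (hx : x < 0) :
    theta p x ≠ 0 := by
  refine theta_ne_zero hp0 hp1 (by exact_mod_cast hx.ne) fun n h => ?_
  have : x = p ^ n := by exact_mod_cast h
  linarith [zpow_pos hp0 n]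

lemma ne_zero_of_mem_outerAnnulus {z : ℂ} (hz : z ∈ outerAnnulus p) : z ≠ 0 :=
  norm_pos_iff.1 (zero_lt_one.trans_le hz.1)

lemma zpow_lt_zpow_iff_of_lt_one (hp0 : 0 < p) (hp1 : p < 1) {m n : ℤ} :
    p ^ m < p ^ n ↔ n < m := zpow_lt_zpow_iff_right_of_lt_one₀ hp0 hp1

lemma zpow_le_zpow_iff_of_lt_one (hp0 : 0 < p) (hp1 : p < 1) {m n : ℤ} :
    p ^ m ≤ p ^ n ↔ n ≤ m := zpow_le_zpow_iff_right_of_lt_one₀ hp0 hp1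

lemma sq_eq_of_abs_eq_inv {v : ℝ} (hv : |v| = p⁻¹) : v ^ 2 = (p ^ 2)⁻¹ := by
  rw [← sq_abs, hv, inv_pow]

/-- At a zero vz = pⁿ, and the sizes of v and z leave n = -1, which is the excluded point (pv)⁻¹, or
n = -2. The latter forces |v| = p⁻¹, so v² = p⁻² as v is real, and z = v. -/
lemma theta_mul_ne_zero_of_mem (hp0 : 0 < p) (hp1 : p < 1) {v : ℝ} (hv1 : 1 < |v|)
    (hv2 : |v| ≤ p⁻¹) {z : ℂ} (hz : z ∈ outerAnnulus p) (h1 : z ≠ v) (h2 : z ≠ ((p : ℂ) * v)⁻¹) :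
    theta p (v * z) ≠ 0 := by
  have hz0 := ne_zero_of_mem_outerAnnulus hz
  have hp : (p : ℂ) ≠ 0 := by exact_mod_cast hp0.ne'
  have hvr : v ≠ 0 := abs_pos.1 (zero_lt_one.trans hv1)
  have hv0 : (v : ℂ) ≠ 0 := by exact_mod_cast hvr
  refine theta_ne_zero hp0 hp1 (mul_ne_zero hv0 hz0) fun n h => ?_
  have hn := congrArg norm h
  rw [norm_mul, norm_zpow, Complex.norm_real, Complex.norm_real, Real.norm_of_nonneg hp0.le,
    Real.norm_eq_abs] at hn
  have hn1 : n < 0 := by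
    rw [← zpow_lt_zpow_iff_of_lt_one hp0 hp1, zpow_zero, ← hn]
    nlinarith [hz.1]
  have hi : 0 < p⁻¹ := inv_pos.2 hp0
  have hn2 : -2 ≤ n := by
    rw [← zpow_le_zpow_iff_of_lt_one hp0 hp1, ← hn,
      show p ^ (-2 : ℤ) = p⁻¹ * p⁻¹ by rw [zpow_neg]; field_simp]
    exact mul_le_mul hv2 hz.2 (norm_nonneg _) hi.le
  obtain rfl | rfl : n = -1 ∨ n = -2 := by omega
  · apply h2
    rw [zpow_neg_one] at h
    rw [mul_inv, ← h]
    field_simp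
  · rw [show p ^ (-2 : ℤ) = p⁻¹ * p⁻¹ by rw [zpow_neg]; field_simp] at hn
    have hve : |v| = p⁻¹ := le_antisymm hv2 (by nlinarith [hz.2, hz.1])
    have := sq_eq_of_abs_eq_inv hve
    apply h1
    have h' : (v : ℂ) * z = v * v := by
      rw [h, ← pow_two, zpow_neg]
      exact_mod_cast this.symm
    exact mul_left_cancel₀ hv0 h'

lemma theta_div_ne_zero_of_mem (hp0 : 0 < p) (hp1 : p < 1) {v : ℝ} (hv1 : 1 < |v|)
    (hv2 : |v| ≤ p⁻¹) {z : ℂ} (hz : z ∈ outerAnnulus p) (h1 : z ≠ v) (h2 : z ≠ ((p : ℂ) * v)⁻¹) :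
    theta p (v / z) ≠ 0 := by
  have hz0 := ne_zero_of_mem_outerAnnulus hz
  have hzn : 0 < ‖z‖ := norm_pos_iff.2 hz0
  have hp : (p : ℂ) ≠ 0 := by exact_mod_cast hp0.ne'
  have hvr : v ≠ 0 := abs_pos.1 (zero_lt_one.trans hv1)
  have hv0 : (v : ℂ) ≠ 0 := by exact_mod_cast hvr
  refine theta_ne_zero hp0 hp1 (div_ne_zero hv0 hz0) fun n h => ?_
  have hn := congrArg norm h
  rw [norm_div, norm_zpow, Complex.norm_real, Complex.norm_real, Real.norm_of_nonneg hp0.le,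
    Real.norm_eq_abs, div_eq_iff hzn.ne'] at hn
  have hn1 : n < 1 := by
    rw [← zpow_lt_zpow_iff_of_lt_one hp0 hp1, zpow_one]
    by_contra! hc
    have : p ^ n * ‖z‖ ≤ p * p⁻¹ := mul_le_mul hc hz.2 hzn.le hp0.le
    rw [mul_inv_cancel₀ hp0.ne'] at this
    linarith
  have hn2 : -1 ≤ n := by
    rw [← zpow_le_zpow_iff_of_lt_one hp0 hp1, zpow_neg_one]
    refine le_trans ?_ hv2
    rw [hn]
    exact le_mul_of_one_le_right (zpow_pos hp0 n).le hz.1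
  obtain rfl | rfl : n = 0 ∨ n = -1 := by omega
  · apply h1
    rw [zpow_zero, div_eq_one_iff_eq hz0] at h
    exact h.symm
  · rw [zpow_neg_one] at hn h
    have hve : |v| = p⁻¹ := le_antisymm hv2
      (by rw [hn]; exact le_mul_of_one_le_right (inv_pos.2 hp0).le hz.1)
    have h3 : v ^ 2 = (p ^ 2)⁻¹ := sq_eq_of_abs_eq_inv hve
    apply h2
    have h4 : (v : ℂ) ^ 2 = ((p : ℂ) ^ 2)⁻¹ := by exact_mod_cast h3
    rw [div_eq_iff hz0] at h
    have h5 : z = p * v := by rw [h]; field_simp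
    rw [h5, ← mul_eq_one_iff_eq_inv₀ (by positivity),
      show (p : ℂ) * v * (p * v) = p ^ 2 * v ^ 2 by ring, h4]
    field_simp

/-- The points pv and (p²v)⁻¹ lie in the annulus only if |v| = p⁻¹, and then (pv)² = 1 identifies
them with (pv)⁻¹ and v. -/
lemma ne_poleKernel_poles (hp0 : 0 < p) {v : ℝ} (hv1 : 1 < |v|)
    (hv2 : |v| ≤ p⁻¹) {z : ℂ} (hz : z ∈ outerAnnulus p) (h1 : z ≠ v) (h2 : z ≠ ((p : ℂ) * v)⁻¹) :
    z ≠ p * v ∧ z ≠ ((p : ℂ) ^ 2 * v)⁻¹ := by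
  have hp : (p : ℂ) ≠ 0 := by exact_mod_cast hp0.ne'
  have hvr : v ≠ 0 := abs_pos.1 (zero_lt_one.trans hv1)
  have hv0 : (v : ℂ) ≠ 0 := by exact_mod_cast hvr
  have hle : p * |v| ≤ 1 := by
    have := mul_le_mul_of_nonneg_left hv2 hp0.le
    rwa [mul_inv_cancel₀ hp0.ne'] at this
  have key : |v| = p⁻¹ → (p : ℂ) * v * (p * v) = 1 := fun h => by
    have h4 : (v : ℂ) ^ 2 = ((p : ℂ) ^ 2)⁻¹ := by exact_mod_cast sq_eq_of_abs_eq_inv h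
    rw [show (p : ℂ) * v * (p * v) = p ^ 2 * v ^ 2 by ring, h4]
    field_simp
  constructor
  · intro h
    have hn := congrArg norm h
    rw [norm_mul, Complex.norm_real, Complex.norm_real, Real.norm_of_nonneg hp0.le,
      Real.norm_eq_abs] at hn
    have hve : |v| = p⁻¹ := by
      rw [← mul_eq_one_iff_eq_inv₀ hp0.ne']
      linarith [hz.1]
    exact h2 (by rw [h, ← mul_eq_one_iff_eq_inv₀ (by positivity)]; exact key hve)
  · intro h
    have hn := congrArg norm h
    rw [norm_inv, norm_mul, norm_pow, Complex.norm_real, Complex.norm_real,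
      Real.norm_of_nonneg hp0.le, Real.norm_eq_abs] at hn
    have hve : |v| = p⁻¹ := by
      rw [← mul_eq_one_iff_eq_inv₀ hp0.ne']
      refine le_antisymm (by linarith) ?_
      have h3 := hz.2
      rw [hn, inv_le_inv₀ (by positivity) hp0] at h3
      nlinarith
    have hk := key hve
    apply h1
    rw [h, inv_eq_iff_eq_inv, ← mul_eq_one_iff_eq_inv₀ hv0]
    linear_combination hk

lemma tendsto_sub_div_theta (hp0 : 0 < p) (hp1 : p < 1) {v : ℂ} (hv : v ≠ 0) :
    Tendsto (fun z => (z - v) / theta p (v / z)) (𝓝[≠] v)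
      (𝓝 (v / shiftedFactorial p p ^ 2)) := by
  have hpn : ‖(p : ℂ)‖ < 1 := by simpa [abs_of_pos hp0] using hp1
  set S : ℂ → ℂ := fun z => shiftedFactorial p (p * (v / z)) * shiftedFactorial p (p / (v / z))
  have hSv : S v = shiftedFactorial p p ^ 2 := by
    simp only [S]
    rw [div_self hv, mul_one, div_one, pow_two]
  have hSc : ContinuousAt S v := by
    have hc := (differentiable_shiftedFactorial hp0 hp1).continuous
    have hv' : v / v ≠ 0 := by rw [div_self hv]; exact one_ne_zero
    have h1 : ContinuousAt (fun z => v / z) v := continuousAt_const.div continuousAt_id hv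
    exact (ContinuousAt.comp hc.continuousAt (continuousAt_const.mul h1)).mul
      (ContinuousAt.comp hc.continuousAt (continuousAt_const.div h1 hv'))
  have hS0 : S v ≠ 0 := by
    rw [hSv]
    exact pow_ne_zero 2 (shiftedFactorial_ne_zero_of_norm_lt hp0 hp1 hpn)
  have hlim : Tendsto (fun z => z / S z) (𝓝[≠] v) (𝓝 (v / S v)) :=
    (continuousAt_id.div hSc hS0).tendsto.mono_left nhdsWithin_le_nhds
  rw [hSv] at hlim
  refine hlim.congr' ?_
  filter_upwards [self_mem_nhdsWithin, nhdsWithin_le_nhds (isOpen_ne.mem_nhds hv)] with z hz hz0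
  have h1 : z - v ≠ 0 := sub_ne_zero.2 hz
  have h0 : z ≠ 0 := hz0
  rw [theta_eq_one_sub_mul hp0 hp1, show 1 - v / z = (z - v) / z by field_simp]
  change z / S z = (z - v) / ((z - v) / z * S z)
  rw [div_mul_eq_mul_div, div_div_eq_mul_div, mul_div_mul_left _ _ h1]

/-- The common number n is the multiplicity of v among the poles of the kernel. Generically n = 1.
If v² = p⁻¹ then v = (pv)⁻¹, and if v² = p⁻² then v = (p²v)⁻¹, so two terms of the kernel add up; at
the same time θ(z²) and θ(vz) both vanish at v, and their quotient tends to the ratio 2 of the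
derivatives. Thus the residue of the weight doubles exactly when that of the kernel does. -/
lemma tendsto_theta_sq_div (hp0 : 0 < p) (hp1 : p < 1) {v : ℝ} (hv1 : 1 < |v|)
    (hv2 : |v| ≤ p⁻¹) :
    ∃ n : ℂ, Tendsto (fun z => theta p (z ^ 2) / theta p (v * z)) (𝓝[≠] (v : ℂ)) (𝓝 n) ∧
      Tendsto (fun z => (z - v) * poleKernel p v z) (𝓝[≠] (v : ℂ)) (𝓝 (n * v)) := by
  have hp : (p : ℂ) ≠ 0 := by exact_mod_cast hp0.ne'
  have hvr : v ≠ 0 := abs_pos.1 (zero_lt_one.trans hv1)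
  have hv0 : (v : ℂ) ≠ 0 := by exact_mod_cast hvr
  have h5 : Tendsto (fun z : ℂ => (z - v) * 2) (𝓝[≠] (v : ℂ)) (𝓝 (((v : ℂ) - v) * 2)) :=
    (Continuous.tendsto (by fun_prop) _).mono_left nhdsWithin_le_nhds
  rw [sub_self, zero_mul] at h5
  have hk : (fun z : ℂ => (z - v) * poleKernel p v z) = fun z : ℂ => (z - v) * (z / (z - v)) +
      (z - v) * (z / (z - p * v)) + (z - v) * (z / (z - ((p : ℂ) * v)⁻¹)) +
      (z - v) * (z / (z - ((p : ℂ) ^ 2 * v)⁻¹)) - (z - v) * 2 := by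
    ext z
    simp only [poleKernel]
    ring
  have hpv : (v : ℂ) ≠ p * v := fun h => by
    have : (1 : ℂ) = p := mul_right_cancel₀ hv0 (by rw [one_mul]; exact h)
    exact hp1.ne (by exact_mod_cast this.symm)
  have e1 : (v : ℂ) = ((p : ℂ) * v)⁻¹ ↔ (v : ℂ) * v = (p : ℂ)⁻¹ := by
    rw [← mul_eq_one_iff_eq_inv₀ (by positivity), ← mul_eq_one_iff_eq_inv₀ hp]
    constructor <;> intro h <;> linear_combination h
  have e2 : (v : ℂ) = ((p : ℂ) ^ 2 * v)⁻¹ ↔ (v : ℂ) * v = ((p : ℂ) ^ 2)⁻¹ := by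
    rw [← mul_eq_one_iff_eq_inv₀ (by positivity), ← mul_eq_one_iff_eq_inv₀ (pow_ne_zero 2 hp)]
    constructor <;> intro h <;> linear_combination h
  have hpp : (p : ℂ)⁻¹ ≠ ((p : ℂ) ^ 2)⁻¹ := fun h => by
    rw [inv_inj] at h
    have : p = p ^ 2 := by exact_mod_cast h
    nlinarith
  have hbase := ((tendsto_sub_mul_div_self (v := (v : ℂ))).add
    (tendsto_sub_mul_div_of_ne hpv))
  by_cases hcase : (v : ℂ) * v = (p : ℂ)⁻¹ ∨ (v : ℂ) * v = ((p : ℂ) ^ 2)⁻¹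
  · refine ⟨2, ?_, ?_⟩
    · obtain ⟨c, hc, hd, h0⟩ := hasDerivAt_theta_inv hp0 hp1 hcase
      have d1 : HasDerivAt (fun z : ℂ => theta p (z ^ 2)) (c * (2 * v)) v := by
        have : HasDerivAt (fun z : ℂ => z ^ 2) (2 * (v : ℂ)) v := by
          simpa using hasDerivAt_pow 2 (v : ℂ)
        exact HasDerivAt.comp (v : ℂ) (by rwa [pow_two]) this
      have d2 : HasDerivAt (fun z : ℂ => theta p (v * z)) (c * (v * 1)) v :=
        HasDerivAt.comp (v : ℂ) hd ((hasDerivAt_id (v : ℂ)).const_mul (v : ℂ))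
      rw [hasDerivAt_iff_tendsto_slope] at d1 d2
      have := d1.div d2 (by simp [hc, hv0])
      rw [show c * (2 * (v : ℂ)) / (c * (v * 1)) = 2 by field_simp] at this
      refine this.congr' ?_
      filter_upwards [self_mem_nhdsWithin] with z hz
      have hz' : z - v ≠ 0 := sub_ne_zero.2 hz
      simp only [Pi.div_apply, slope_def_field]
      rw [pow_two (v : ℂ), h0, sub_zero, sub_zero, div_div_div_cancel_right₀ hz']
    · rw [hk]
      rcases hcase with h | h
      · have h3 := e1.2 h
        have h4 : (v : ℂ) ≠ ((p : ℂ) ^ 2 * v)⁻¹ := fun h' => hpp (by rw [← h, e2.1 h'])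
        have t3 := tendsto_sub_mul_div_self (v := (v : ℂ))
        nth_rewrite 2 [h3] at t3
        have := ((hbase.add t3).add (tendsto_sub_mul_div_of_ne h4)).sub h5
        rwa [show (v : ℂ) + 0 + v + 0 - 0 = 2 * v by ring] at this
      · have h3 := e2.2 h
        have h4 : (v : ℂ) ≠ ((p : ℂ) * v)⁻¹ := fun h' => hpp (by rw [← h, e1.1 h'])
        have t3 := tendsto_sub_mul_div_self (v := (v : ℂ))
        nth_rewrite 2 [h3] at t3
        have := ((hbase.add (tendsto_sub_mul_div_of_ne h4)).add t3).sub h5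
        rwa [show (v : ℂ) + 0 + 0 + v - 0 = 2 * v by ring] at this
  · push Not at hcase
    refine ⟨1, ?_, ?_⟩
    · have hvv : (v : ℂ) ^ 2 ≠ 0 := pow_ne_zero 2 hv0
      have hne : theta p ((v : ℂ) ^ 2) ≠ 0 := by
        refine theta_ne_zero hp0 hp1 hvv fun n h => ?_
        have hn : |v| ^ 2 = p ^ n := by
          rw [sq_abs]
          exact_mod_cast h
        have hn1 : n < 0 := by
          rw [← zpow_lt_zpow_iff_of_lt_one hp0 hp1, zpow_zero, ← hn]
          nlinarith
        have hn2 : -2 ≤ n := by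
          rw [← zpow_le_zpow_iff_of_lt_one hp0 hp1, ← hn,
            show p ^ (-2 : ℤ) = p⁻¹ ^ 2 by rw [zpow_neg, inv_pow]; norm_cast]
          exact pow_le_pow_left₀ (abs_nonneg v) hv2 2
        obtain rfl | rfl : n = -1 ∨ n = -2 := by omega
        · exact hcase.1 (by rw [← pow_two, h, zpow_neg_one])
        · exact hcase.2 (by rw [← pow_two, h, zpow_neg]; norm_cast)
      have c1 : ContinuousAt (fun z : ℂ => theta p (z ^ 2)) v :=
        ContinuousAt.comp (g := theta p) (differentiableAt_theta hp0 hp1 hvv).continuousAt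
          (by fun_prop)
      have c2 : ContinuousAt (fun z : ℂ => theta p (v * z)) v :=
        ContinuousAt.comp (g := theta p)
          (differentiableAt_theta hp0 hp1 (mul_ne_zero hv0 hv0)).continuousAt (by fun_prop)
      have := (c1.div c2 (by rwa [← pow_two])).tendsto.mono_left
        (nhdsWithin_le_nhds (s := {(v : ℂ)}ᶜ))
      simp only [Pi.div_apply, ← pow_two, div_self hne] at this
      exact this
    · rw [hk]
      have := ((hbase.add (tendsto_sub_mul_div_of_ne fun h => hcase.1 (e1.1 h))).add
        (tendsto_sub_mul_div_of_ne fun h => hcase.2 (e2.1 h))).sub h5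
      rwa [show (v : ℂ) + 0 + 0 + 0 - 0 = 1 * v by ring] at this

/-- The pole of `ellWeight p v w` at `v` is the one of `ellResidue p v w * poleKernel p v`. -/
lemma tendsto_sub_mul_ellWeight_sub (hp0 : 0 < p) (hp1 : p < 1) {v w : ℝ} (hv1 : 1 < |v|)
    (hv2 : |v| ≤ p⁻¹) (hvw : v * w < 0) :
    Tendsto (fun z => (z - v) * (ellWeight p v w z - ellResidue p v w * poleKernel p v z))
      (𝓝[≠] (v : ℂ)) (𝓝 0) := by
  have hvr : v ≠ 0 := abs_pos.1 (zero_lt_one.trans hv1)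
  have hv0 : (v : ℂ) ≠ 0 := by exact_mod_cast hvr
  have hwr : w ≠ 0 := fun h => by simp [h] at hvw
  have hw0 : (w : ℂ) ≠ 0 := by exact_mod_cast hwr
  have hpn : ‖(p : ℂ)‖ < 1 := by simpa [abs_of_pos hp0] using hp1
  have hS := shiftedFactorial_ne_zero_of_norm_lt hp0 hp1 hpn
  obtain ⟨n, h1, h2⟩ := tendsto_theta_sq_div hp0 hp1 hv1 hv2
  have n1 : theta p (w * v) ≠ 0 := by
    have := theta_ofReal_ne_zero_of_neg hp0 hp1 (x := w * v) (by linarith)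
    exact_mod_cast this
  have n2 : theta p (w / v) ≠ 0 := by
    have := theta_ofReal_ne_zero_of_neg hp0 hp1 (x := w / v) (by
      rw [show w / v = v * w / v ^ 2 by field_simp]
      exact div_neg_of_neg_of_pos hvw (by positivity))
    exact_mod_cast this
  have h3 := tendsto_sub_div_theta hp0 hp1 hv0
  have h4 : Tendsto (fun z : ℂ => 1 / (z * (theta p (w * z) * theta p (w / z)))) (𝓝[≠] (v : ℂ))
      (𝓝 (1 / (v * (theta p (w * v) * theta p (w / v))))) := by
    have c1 : ContinuousAt (fun z : ℂ => theta p (w * z)) v :=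
      ContinuousAt.comp (g := theta p)
        (differentiableAt_theta hp0 hp1 (mul_ne_zero hw0 hv0)).continuousAt (by fun_prop)
    have c2 : ContinuousAt (fun z : ℂ => theta p (w / z)) v :=
      ContinuousAt.comp (g := theta p)
        (differentiableAt_theta hp0 hp1 (div_ne_zero hw0 hv0)).continuousAt
        (continuousAt_const.div continuousAt_id hv0)
    exact (continuousAt_const.div (continuousAt_id.mul (c1.mul c2))
      (mul_ne_zero hv0 (mul_ne_zero n1 n2))).tendsto.mono_left nhdsWithin_le_nhds
  have h5 := ((h1.mul h3).mul h4).sub (h2.const_mul (ellResidue p v w))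
  -- The multiplicity n occurs in both terms, so `ellResidue` is the right constant in the
  -- degenerate cases too.
  have hl : n * (v / shiftedFactorial p p ^ 2) *
      (1 / (v * (theta p (w * v) * theta p (w / v)))) - ellResidue p v w * (n * v) = 0 := by
    rw [ellResidue, mul_comm (w : ℂ) v]
    rw [mul_comm (w : ℂ) v] at n1
    field_simp
    ring
  rw [hl] at h5
  refine h5.congr fun z => ?_
  simp only [ellWeight, div_eq_mul_inv, mul_inv]
  ring

end

/-! ### Removable singularities and averages over the unit circle -/

/-- Removal of finitely many singularities. -/
lemma exists_analyticOnNhd_eq {Q : ℂ → ℂ} {K S : Set ℂ} (hS : S.Finite)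
    (h1 : ∀ z ∈ K, z ∉ S → AnalyticAt ℂ Q z)
    (h2 : ∀ s ∈ S, s ∈ K → MeromorphicAt Q s ∧
      Tendsto (fun z => (z - s) * Q z) (𝓝[≠] s) (𝓝 0)) :
    ∃ R : ℂ → ℂ, AnalyticOnNhd ℂ R K ∧ ∀ z ∉ S, R z = Q z := by
  classical
  refine ⟨fun z => if z ∈ S then limUnder (𝓝[≠] z) Q else Q z, fun z hz => ?_,
    fun z hz => if_neg hz⟩
  by_cases hzS : z ∈ S
  · obtain ⟨hm, ht⟩ := h2 z hzS hz
    have hd : ∀ᶠ y in 𝓝[≠] z, DifferentiableAt ℂ Q y :=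
      hm.eventually_analyticAt.mono fun y hy => hy.differentiableAt
    -- The value Q z at the singular point is arbitrary but harmless: (y - z) Q z still tends to 0.
    have ho : (fun y => Q y - Q z) =o[𝓝[≠] z] fun y => (y - z)⁻¹ := by
      rw [Asymptotics.isLittleO_iff_tendsto']
      · have h3 : Tendsto (fun y : ℂ => (y - z) * Q z) (𝓝[≠] z) (𝓝 ((z - z) * Q z)) :=
          (Continuous.tendsto (by fun_prop) z).mono_left nhdsWithin_le_nhds
        have := ht.sub h3
        simp only [sub_self, zero_mul] at this
        refine this.congr fun y => ?_
        rw [div_inv_eq_mul]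
        ring
      · filter_upwards [self_mem_nhdsWithin] with y hy h0
        exact absurd (inv_eq_zero.1 h0) (sub_ne_zero.2 hy)
    have hlim := Complex.tendsto_limUnder_of_differentiable_on_punctured_nhds_of_isLittleO hd ho
    have hev : ∀ᶠ y in 𝓝[≠] z, (if y ∈ S then limUnder (𝓝[≠] y) Q else Q y) = Q y := by
      have : ∀ᶠ y in 𝓝[≠] z, y ∉ S \ {z} :=
        nhdsWithin_le_nhds ((hS.subset Set.sdiff_subset).isClosed.isOpen_compl.mem_nhds (by simp))
      filter_upwards [this, self_mem_nhdsWithin] with y hy hyz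
      exact if_neg fun h => hy ⟨h, hyz⟩
    refine Complex.analyticAt_of_differentiable_on_punctured_nhds_of_continuousAt ?_ ?_
    · filter_upwards [hd, eventually_eventually_nhdsWithin.2 hev, self_mem_nhdsWithin]
        with y hy1 hy2 hy3
      refine hy1.congr_of_eventuallyEq ?_
      rwa [isOpen_compl_singleton.nhdsWithin_eq hy3] at hy2
    · rw [continuousAt_iff_punctured_nhds]
      simp only [if_pos hzS]
      exact hlim.congr' (hev.mono fun y hy => hy.symm)
  · refine (h1 z hz hzS).congr ?_
    filter_upwards [hS.isClosed.isOpen_compl.mem_nhds hzS] with y hy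
    exact (if_neg hy).symm

section
variable {p : ℝ}

/-- The points ±1 are negligible; for real parameters they are the only points of the unit circle
where the weight can be singular. -/
lemma circleAverage_congr_of_im_ne_zero {f g : ℂ → ℂ}
    (h : ∀ z : ℂ, ‖z‖ = 1 → z.im ≠ 0 → f z = g z) :
    Real.circleAverage f 0 1 = Real.circleAverage g 0 1 := by
  simp only [Real.circleAverage_def]
  congr 1
  refine intervalIntegral.integral_congr_ae ?_
  have hfin : ({Real.pi, 2 * Real.pi} : Set ℝ).Finite := by simp
  filter_upwards [hfin.countable.ae_notMem volume] with θ hθ hI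
  rw [Set.uIoc_of_le Real.two_pi_pos.le] at hI
  refine h _ (by simp [circleMap]) ?_
  simp only [circleMap_zero, Complex.ofReal_one, one_mul, Complex.exp_ofReal_mul_I_im]
  intro h0
  rw [Real.sin_eq_zero_iff] at h0
  obtain ⟨n, hn⟩ := h0
  have hpi := Real.pi_pos
  have h1 : (0 : ℝ) < n := by
    by_contra! hc
    nlinarith [hI.1]
  have h2 : (n : ℝ) ≤ 2 := by
    by_contra! hc
    nlinarith [hI.2]
  have h1' : 0 < n := by exact_mod_cast h1
  have h2' : n ≤ 2 := by exact_mod_cast h2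
  obtain rfl | rfl : n = 1 ∨ n = 2 := by omega
  · exact hθ (by left; rw [← hn]; simp)
  · exact hθ (by right; push_cast at hn; exact hn.symm)

lemma circleAverage_div_sub_of_lt {l : ℂ} (hl : ‖l‖ < 1) :
    Real.circleAverage (fun z => z / (z - l)) 0 1 = 1 := by
  have := circleAverage_sub_sub_inv_smul_of_differentiable_on_off_countable (c := 0) (R := 1)
    (w := l) (f := fun _ => (1 : ℂ)) Set.countable_empty continuousOn_const
    (fun _ _ => differentiableAt_const _) (by simpa using hl)
  simpa using this

lemma circleAverage_div_sub_of_gt {l : ℂ} (hl : 1 < ‖l‖) :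
    Real.circleAverage (fun z : ℂ => z / (z - l)) 0 1 = 0 := by
  have hd : ∀ z : ℂ, ‖z‖ ≤ 1 → DifferentiableAt ℂ (fun z => z / (z - l)) z := fun z hz => by
    have : z - l ≠ 0 := fun h => by
      rw [sub_eq_zero.1 h] at hz
      linarith
    fun_prop (disch := assumption)
  have := circleAverage_sub_sub_inv_smul_of_differentiable_on_off_countable (c := 0) (R := 1)
    (w := 0) (f := fun z : ℂ => z / (z - l)) Set.countable_empty
    (fun z hz => (hd z (by simpa using hz)).continuousAt.continuousWithinAt)
    (fun z hz => hd z (by simpa using (le_of_lt (by simpa using hz.1)))) (by simp)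
  simp only [sub_zero, zero_div] at this
  refine Eq.trans (Real.circleAverage_congr_sphere fun z hz => ?_) this
  have : z ≠ 0 := by
    rintro rfl
    simp at hz
  simp [this]

lemma circleIntegrable_div_sub {l : ℂ} (hl : ‖l‖ ≠ 1) :
    CircleIntegrable (fun z => z / (z - l)) 0 1 := by
  refine ContinuousOn.circleIntegrable zero_le_one fun z hz => ?_
  have : z - l ≠ 0 := fun h => hl (by
    rw [← sub_eq_zero.1 h]
    simpa using hz)
  exact ContinuousAt.continuousWithinAt (by fun_prop (disch := assumption))

/-- The terms with poles pv and (pv)⁻¹, which may lie on the unit circle, occur in both kernels and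
cancel. For 1 < |v| ≤ p⁻¹ the remaining poles are strictly outside (v and (p²v)⁻¹) or strictly
inside (p²v and v⁻¹), so no principal values are needed and the average is 0 + 0 - 1 - 1. -/
lemma poleKernel_sub (hp0 : 0 < p) {v : ℂ} (z : ℂ) :
    poleKernel p v z - poleKernel p v (z / p) =
      z / (z - v) + z / (z - (p ^ 2 * v)⁻¹) - z / (z - p ^ 2 * v) - z / (z - v⁻¹) := by
  have hp : (p : ℂ) ≠ 0 := by exact_mod_cast hp0.ne'
  have key : ∀ l m : ℂ, p * l = m → z / p / (z / p - l) = z / (z - m) := fun l m h => by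
    rw [← h, show z / p - l = (z - p * l) / p by field_simp, div_div_div_cancel_right₀ hp]
  rw [poleKernel, poleKernel, key v _ rfl, key (p * v) (p ^ 2 * v) (by ring),
    key (p * v)⁻¹ v⁻¹ (by field_simp), key (p ^ 2 * v)⁻¹ (p * v)⁻¹ (by field_simp)]
  ring

lemma circleAverage_poleKernel_sub (hp0 : 0 < p) (hp1 : p < 1) {v : ℝ} (hv1 : 1 < |v|)
    (hv2 : |v| ≤ p⁻¹) :
    CircleIntegrable (fun z => poleKernel p v z - poleKernel p v (z / p)) 0 1 ∧
    Real.circleAverage (fun z => poleKernel p v z - poleKernel p v (z / p)) 0 1 = -2 := by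
  have n1 : 1 < ‖(v : ℂ)‖ := by simpa using hv1
  have hle : p * |v| ≤ 1 := by
    have := mul_le_mul_of_nonneg_left hv2 hp0.le
    rwa [mul_inv_cancel₀ hp0.ne'] at this
  have n2 : ‖(p : ℂ) ^ 2 * v‖ < 1 := by
    rw [norm_mul, norm_pow, Complex.norm_real, Complex.norm_real, Real.norm_of_nonneg hp0.le,
      Real.norm_eq_abs]
    nlinarith
  have hv0 : (v : ℂ) ≠ 0 := norm_pos_iff.1 (by linarith)
  have hp : (p : ℂ) ≠ 0 := by exact_mod_cast hp0.ne'
  have n3 : 1 < ‖((p : ℂ) ^ 2 * v)⁻¹‖ := by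
    rw [norm_inv]
    exact (one_lt_inv₀ (norm_pos_iff.2 (by positivity))).2 n2
  have n4 : ‖(v : ℂ)⁻¹‖ < 1 := by
    rw [norm_inv]
    exact inv_lt_one_of_one_lt₀ n1
  simp only [poleKernel_sub hp0]
  have i1 := circleIntegrable_div_sub n1.ne'
  have i2 := circleIntegrable_div_sub n3.ne'
  have i3 := circleIntegrable_div_sub n2.ne
  have i4 := circleIntegrable_div_sub n4.ne
  refine ⟨((i1.add i2).sub i3).sub i4, ?_⟩
  rw [show (fun z : ℂ => z / (z - v) + z / (z - (p ^ 2 * v : ℂ)⁻¹) - z / (z - p ^ 2 * v) -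
      z / (z - (v : ℂ)⁻¹)) = ((((fun z : ℂ => z / (z - v)) + fun z => z / (z - (p ^ 2 * v : ℂ)⁻¹)) -
      fun z : ℂ => z / (z - p ^ 2 * v)) - fun z : ℂ => z / (z - (v : ℂ)⁻¹)) from rfl,
    Real.circleAverage_sub ((i1.add i2).sub i3) i4, Real.circleAverage_sub (i1.add i2) i3,
    Real.circleAverage_add i1 i2, circleAverage_div_sub_of_gt n1, circleAverage_div_sub_of_gt n3,
    circleAverage_div_sub_of_lt n2, circleAverage_div_sub_of_lt n4]
  norm_num

/-- The left side is the average over the circle of radius p⁻¹; Cauchy's theorem in the annulus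
compares the two circles. -/
lemma circleAverage_div_eq (hp0 : 0 < p) (hp1 : p < 1) {R : ℂ → ℂ}
    (hR : AnalyticOnNhd ℂ R (outerAnnulus p)) :
    Real.circleAverage (fun z => R (z / p)) 0 1 = Real.circleAverage R 0 1 := by
  have hle : 1 ≤ p⁻¹ := (one_le_inv₀ hp0).2 hp1.le
  have h1 : Real.circleAverage (fun z => R (z / p)) 0 1 = Real.circleAverage R 0 p⁻¹ := by
    simp only [Real.circleAverage_def, circleMap_zero]
    congr 2
    ext θ
    congr 1
    push_cast
    field_simp
  rw [h1, Real.circleAverage_eq_circleIntegral one_ne_zero,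
    Real.circleAverage_eq_circleIntegral (by positivity),
    Complex.circleIntegral_sub_center_inv_smul_eq_of_differentiable_on_annulus_off_countable
      zero_lt_one hle Set.countable_empty]
  · intro z hz
    refine (hR z ⟨?_, ?_⟩).continuousAt.continuousWithinAt
    · simpa using hz.2
    · simpa using hz.1
  · intro z hz
    refine (hR z ⟨?_, ?_⟩).differentiableAt
    · have := hz.1.2
      simp at this
      exact this.le
    · have := hz.1.1
      simp at this
      exact this.le

lemma circleIntegrable_of_analyticOnNhd (hp0 : 0 < p) (hp1 : p < 1) {R : ℂ → ℂ}
    (hR : AnalyticOnNhd ℂ R (outerAnnulus p)) :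
    CircleIntegrable R 0 1 ∧ CircleIntegrable (fun z => R (z / p)) 0 1 := by
  have hle : 1 ≤ p⁻¹ := (one_le_inv₀ hp0).2 hp1.le
  constructor
  · refine ContinuousOn.circleIntegrable zero_le_one fun z hz => ?_
    have : ‖z‖ = 1 := by simpa using hz
    exact (hR z ⟨this.ge, this.trans_le hle⟩).continuousAt.continuousWithinAt
  · refine ContinuousOn.circleIntegrable zero_le_one fun z hz => ?_
    have h1 : ‖z‖ = 1 := by simpa using hz
    have : ‖z / p‖ = p⁻¹ := by
      rw [norm_div, h1, Complex.norm_real, Real.norm_of_nonneg hp0.le, one_div]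
    exact (ContinuousAt.comp (g := R) (f := fun z : ℂ => z / p)
      (hR _ ⟨this.symm ▸ hle, this.le⟩).continuousAt
      (continuousAt_id.div_const _)).continuousWithinAt

/-- The reflection is biholomorphic near v, so for an odd function the absence of a pole at v passes
to (pv)⁻¹. Only the poles at v and w then need computation. -/
lemma tendsto_sub_mul_reflect (hp0 : 0 < p) {h : ℂ → ℂ} {v : ℂ} (hv : v ≠ 0)
    (hh : ∀ᶠ z in 𝓝[≠] v, h (p * z)⁻¹ = -h z)
    (ht : Tendsto (fun z => (z - v) * h z) (𝓝[≠] v) (𝓝 0)) :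
    Tendsto (fun z => (z - (p * v)⁻¹) * h z) (𝓝[≠] (p * v)⁻¹) (𝓝 0) := by
  have hp : (p : ℂ) ≠ 0 := by exact_mod_cast hp0.ne'
  have hpv : (p : ℂ) * v ≠ 0 := mul_ne_zero hp hv
  have h1 : Tendsto (fun z : ℂ => (p * z)⁻¹) (𝓝[≠] (p * v)⁻¹) (𝓝[≠] v) := by
    rw [tendsto_nhdsWithin_iff]
    constructor
    · have hc : ContinuousAt (fun z : ℂ => (p * z)⁻¹) (p * v)⁻¹ :=
        (continuousAt_const.mul continuousAt_id).inv₀ (mul_ne_zero hp (inv_ne_zero hpv))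
      have := hc.tendsto.mono_left (nhdsWithin_le_nhds (s := {((p : ℂ) * v)⁻¹}ᶜ))
      rwa [show ((p : ℂ) * (p * v)⁻¹)⁻¹ = v by field_simp] at this
    · filter_upwards [self_mem_nhdsWithin] with z hz h0
      rw [Set.mem_singleton_iff] at h0
      exact hz (by rw [Set.mem_singleton_iff, ← h0]; field_simp)
  have h2 : Tendsto (fun z : ℂ => (z - v) * h z * (p * z * v)⁻¹) (𝓝[≠] v) (𝓝 0) := by
    have hc : ContinuousAt (fun z : ℂ => (p * z * v)⁻¹) v :=
      ((continuousAt_const.mul continuousAt_id).mul continuousAt_const).inv₀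
        (mul_ne_zero hpv hv)
    simpa using ht.mul (hc.tendsto.mono_left (nhdsWithin_le_nhds (s := {v}ᶜ)))
  refine (h2.comp h1).congr' ?_
  filter_upwards [h1.eventually hh, nhdsWithin_le_nhds (isOpen_ne.mem_nhds (inv_ne_zero hpv))]
    with z hz hz0
  have hz0' : z ≠ 0 := hz0
  have h3 : ((p : ℂ) * (p * z)⁻¹)⁻¹ = z := by field_simp
  rw [h3] at hz
  simp only [Function.comp]
  rw [show h (p * z)⁻¹ = -h z by rw [hz, neg_neg]]
  field_simp
  ring

lemma eventually_ne_nhdsNE (v l : ℂ) : ∀ᶠ z in 𝓝[≠] v, z ≠ l := by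
  rcases eq_or_ne v l with rfl | h
  · exact self_mem_nhdsWithin
  · exact nhdsWithin_le_nhds (isOpen_ne.mem_nhds h)

end

/-! ### The contour shift -/

section
variable {p : ℝ}

/-- `ellWeight p v w` with its poles in the annulus `1 ≤ |z| ≤ p⁻¹` removed. -/
noncomputable def regularWeight (p v w : ℝ) (z : ℂ) : ℂ :=
  ellWeight p v w z - ellResidue p v w * poleKernel p v z - ellResidue p w v * poleKernel p w z

lemma regularWeight_comm (v w : ℝ) : regularWeight p v w = regularWeight p w v := by
  ext z
  rw [regularWeight, regularWeight, ellWeight_comm]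
  ring

lemma regularWeight_reflect (hp0 : 0 < p) (hp1 : p < 1) {v w : ℝ} (hv : v ≠ 0) (hw : w ≠ 0)
    (s : ℂ) :
    ∀ᶠ z in 𝓝[≠] s, regularWeight p v w (p * z)⁻¹ = -regularWeight p v w z := by
  have hv' : (v : ℂ) ≠ 0 := by exact_mod_cast hv
  have hw' : (w : ℂ) ≠ 0 := by exact_mod_cast hw
  have hp : (p : ℂ) ≠ 0 := by exact_mod_cast hp0.ne'
  filter_upwards [eventually_ne_nhdsNE s 0, eventually_ne_nhdsNE s v,
    eventually_ne_nhdsNE s (p * v), eventually_ne_nhdsNE s ((p : ℂ) * v)⁻¹,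
    eventually_ne_nhdsNE s ((p : ℂ) ^ 2 * v)⁻¹, eventually_ne_nhdsNE s w,
    eventually_ne_nhdsNE s (p * w), eventually_ne_nhdsNE s ((p : ℂ) * w)⁻¹,
    eventually_ne_nhdsNE s ((p : ℂ) ^ 2 * w)⁻¹] with z h0 h1 h2 h3 h4 h5 h6 h7 h8
  rw [regularWeight, regularWeight, poleKernel_reflect hp0 hv' h0 h1 h2 h3 h4,
    poleKernel_reflect hp0 hw' h0 h5 h6 h7 h8, ellWeight_inv hp0 hp1 (mul_ne_zero hp h0),
    ellWeight_mul hp0 hp1 hv' hw' h0]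
  ring

/-- The poles of `ellWeight p v w` in the annulus `1 ≤ |z| ≤ p⁻¹`. -/
def annulusPoles (p v w : ℝ) : Set ℂ := {(v : ℂ), ((p : ℂ) * v)⁻¹, (w : ℂ), ((p : ℂ) * w)⁻¹}

lemma im_eq_zero_of_mem_annulusPoles {v w : ℝ} {z : ℂ} (hz : z ∈ annulusPoles p v w) :
    z.im = 0 := by
  have key : ∀ x : ℝ, (((p : ℂ) * x)⁻¹).im = 0 := fun x => by
    rw [← Complex.ofReal_mul, ← Complex.ofReal_inv, Complex.ofReal_im]
  rcases hz with rfl | rfl | rfl | rfl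
  · exact Complex.ofReal_im _
  · exact key _
  · exact Complex.ofReal_im _
  · exact key _

lemma finite_annulusPoles (p v w : ℝ) : (annulusPoles p v w).Finite := by
  simp [annulusPoles]

/-- Every point on the right is a nonnegative multiple of w, while v has the opposite sign: the two
chains never meet. -/
lemma ne_poles_of_mul_neg (hp0 : 0 < p) {v w : ℝ} (hvw : v * w < 0) :
    (v : ℂ) ≠ w ∧ (v : ℂ) ≠ p * w ∧ (v : ℂ) ≠ ((p : ℂ) * w)⁻¹ ∧ (v : ℂ) ≠ ((p : ℂ) ^ 2 * w)⁻¹ := by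
  have key : ∀ c : ℝ, 0 ≤ c → v ≠ c * w := fun c hc h => by
    rw [h] at hvw
    nlinarith [mul_nonneg hc (mul_self_nonneg w)]
  have hw : w ≠ 0 := fun h => by simp [h] at hvw
  refine ⟨?_, ?_, ?_, ?_⟩
  · have := key 1 zero_le_one
    rw [one_mul] at this
    exact_mod_cast this
  · exact_mod_cast key p hp0.le
  · have := key (p * w ^ 2)⁻¹ (by positivity)
    rw [show (p * w ^ 2)⁻¹ * w = (p * w)⁻¹ by field_simp] at this
    exact_mod_cast this
  · have := key (p ^ 2 * w ^ 2)⁻¹ (by positivity)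
    rw [show (p ^ 2 * w ^ 2)⁻¹ * w = (p ^ 2 * w)⁻¹ by field_simp] at this
    exact_mod_cast this

/-- The standing assumptions on a pair of representatives of the chains of poles. -/
structure IsPolePair (p v w : ℝ) : Prop where
  left_gt : 1 < |v|
  left_le : |v| ≤ p⁻¹
  right_gt : 1 < |w|
  right_le : |w| ≤ p⁻¹
  mul_neg : v * w < 0

lemma IsPolePair.symm {v w : ℝ} (h : IsPolePair p v w) : IsPolePair p w v :=
  ⟨h.right_gt, h.right_le, h.left_gt, h.left_le, by rw [mul_comm]; exact h.mul_neg⟩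

lemma IsPolePair.left_ne {v w : ℝ} (h : IsPolePair p v w) : v ≠ 0 :=
  abs_pos.1 (zero_lt_one.trans h.left_gt)

lemma IsPolePair.right_ne {v w : ℝ} (h : IsPolePair p v w) : w ≠ 0 := h.symm.left_ne

lemma ne_of_notMem_annulusPoles {v w : ℝ} {z : ℂ} (hzS : z ∉ annulusPoles p v w) :
    (z ≠ v ∧ z ≠ ((p : ℂ) * v)⁻¹) ∧ (z ≠ w ∧ z ≠ ((p : ℂ) * w)⁻¹) := by
  simp only [annulusPoles, Set.mem_insert_iff, Set.mem_singleton_iff, not_or] at hzS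
  exact ⟨⟨hzS.1, hzS.2.1⟩, hzS.2.2.1, hzS.2.2.2⟩

lemma IsPolePair.analyticAt_poleKernel (hp0 : 0 < p) {v w : ℝ} (h : IsPolePair p v w)
    {z : ℂ} (hz : z ∈ outerAnnulus p) (hzS : z ∉ annulusPoles p v w) :
    AnalyticAt ℂ (poleKernel p v) z ∧ AnalyticAt ℂ (poleKernel p w) z := by
  obtain ⟨⟨h1, h2⟩, h3, h4⟩ := ne_of_notMem_annulusPoles hzS
  obtain ⟨h5, h6⟩ := ne_poleKernel_poles hp0 h.left_gt h.left_le hz h1 h2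
  obtain ⟨h7, h8⟩ := ne_poleKernel_poles hp0 h.right_gt h.right_le hz h3 h4
  exact ⟨AskeyWilson.analyticAt_poleKernel h1 h5 h2 h6,
    AskeyWilson.analyticAt_poleKernel h3 h7 h4 h8⟩

lemma IsPolePair.analyticAt_ellWeight (hp0 : 0 < p) (hp1 : p < 1) {v w : ℝ} (h : IsPolePair p v w)
    {z : ℂ} (hz : z ∈ outerAnnulus p) (hzS : z ∉ annulusPoles p v w) :
    AnalyticAt ℂ (ellWeight p v w) z := by
  obtain ⟨⟨h1, h2⟩, h3, h4⟩ := ne_of_notMem_annulusPoles hzS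
  exact AskeyWilson.analyticAt_ellWeight hp0 hp1 (by exact_mod_cast h.left_ne)
    (by exact_mod_cast h.right_ne) (ne_zero_of_mem_outerAnnulus hz)
    (theta_mul_ne_zero_of_mem hp0 hp1 h.left_gt h.left_le hz h1 h2)
    (theta_div_ne_zero_of_mem hp0 hp1 h.left_gt h.left_le hz h1 h2)
    (theta_mul_ne_zero_of_mem hp0 hp1 h.right_gt h.right_le hz h3 h4)
    (theta_div_ne_zero_of_mem hp0 hp1 h.right_gt h.right_le hz h3 h4)

lemma IsPolePair.analyticAt_regularWeight (hp0 : 0 < p) (hp1 : p < 1) {v w : ℝ}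
    (h : IsPolePair p v w) {z : ℂ} (hz : z ∈ outerAnnulus p) (hzS : z ∉ annulusPoles p v w) :
    AnalyticAt ℂ (regularWeight p v w) z := by
  obtain ⟨h1, h2⟩ := h.analyticAt_poleKernel hp0 hz hzS
  exact ((h.analyticAt_ellWeight hp0 hp1 hz hzS).sub (analyticAt_const.mul h1)).sub
    (analyticAt_const.mul h2)

lemma IsPolePair.tendsto_left (hp0 : 0 < p) (hp1 : p < 1) {v w : ℝ} (h : IsPolePair p v w) :
    Tendsto (fun z => (z - v) * regularWeight p v w z) (𝓝[≠] (v : ℂ)) (𝓝 0) := by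
  obtain ⟨n1, n2, n3, n4⟩ := ne_poles_of_mul_neg hp0 h.mul_neg
  have := (tendsto_sub_mul_ellWeight_sub hp0 hp1 h.left_gt h.left_le h.mul_neg).sub
    ((tendsto_sub_mul_poleKernel_of_ne n1 n2 n3 n4).const_mul (ellResidue p w v))
  rw [mul_zero, sub_zero] at this
  refine this.congr fun z => ?_
  rw [regularWeight]
  ring

lemma IsPolePair.tendsto_regularWeight (hp0 : 0 < p) (hp1 : p < 1) {v w : ℝ}
    (h : IsPolePair p v w) {s : ℂ} (hs : s ∈ annulusPoles p v w) :
    Tendsto (fun z => (z - s) * regularWeight p v w z) (𝓝[≠] s) (𝓝 0) := by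
  have hv0 : (v : ℂ) ≠ 0 := by exact_mod_cast h.left_ne
  have hw0 : (w : ℂ) ≠ 0 := by exact_mod_cast h.right_ne
  have hw := h.symm.tendsto_left hp0 hp1
  rw [regularWeight_comm] at hw
  rcases hs with rfl | rfl | rfl | rfl
  · exact h.tendsto_left hp0 hp1
  · exact tendsto_sub_mul_reflect hp0 hv0
      (regularWeight_reflect hp0 hp1 h.left_ne h.right_ne _) (h.tendsto_left hp0 hp1)
  · exact hw
  · exact tendsto_sub_mul_reflect hp0 hw0
      (regularWeight_reflect hp0 hp1 h.left_ne h.right_ne _) hw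

/-- Subtracting the value at the pole removes the poles of the pole kernel in the annulus. -/
lemma IsPolePair.tendsto_poleKernel_mul_sub (hp0 : 0 < p) {v w : ℝ}
    (h : IsPolePair p v w) {J : ℂ → ℂ} (hv : J ((p : ℂ) * v)⁻¹ = J v) {s : ℂ}
    (hs : s ∈ annulusPoles p v w) (hsK : s ∈ outerAnnulus p) (hJ : ContinuousAt J s) :
    Tendsto (fun z => (z - s) * (poleKernel p v z * (J z - J v))) (𝓝[≠] s) (𝓝 0) := by
  obtain ⟨c, hc⟩ := exists_tendsto_sub_mul_poleKernel (p := p) v s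
  have hJs : Tendsto (fun z => J z - J v) (𝓝[≠] s) (𝓝 (J s - J v)) :=
    (hJ.tendsto.mono_left nhdsWithin_le_nhds).sub tendsto_const_nhds
  by_cases hs' : s = v ∨ s = ((p : ℂ) * v)⁻¹
  · have h0 : J s - J v = 0 := by
      rcases hs' with rfl | rfl
      · exact sub_self _
      · rw [hv, sub_self]
    rw [h0] at hJs
    have := hc.mul hJs
    rw [mul_zero] at this
    exact this.congr fun z => by ring
  · push Not at hs'
    obtain ⟨h3, h4⟩ := ne_poleKernel_poles hp0 h.left_gt h.left_le hsK hs'.1 hs'.2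
    have := (tendsto_sub_mul_poleKernel_of_ne hs'.1 h3 hs'.2 h4).mul hJs
    rw [zero_mul] at this
    exact this.congr fun z => by ring

/-- The contour integral of `ellWeight` against the difference of an analytic function. -/
theorem IsPolePair.circleAverage_ellWeight (hp0 : 0 < p) (hp1 : p < 1) {v w : ℝ}
    (h : IsPolePair p v w) {J : ℂ → ℂ} (hJ : AnalyticOnNhd ℂ J (outerAnnulus p))
    (hv : J ((p : ℂ) * v)⁻¹ = J v) (hw : J ((p : ℂ) * w)⁻¹ = J w) :
    Real.circleAverage (fun z => ellWeight p v w z * (J z - J (z / p))) 0 1 =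
      -2 * (ellResidue p v w * J v + ellResidue p w v * J w) := by
  have hv0 : (v : ℂ) ≠ 0 := by exact_mod_cast h.left_ne
  have hw0 : (w : ℂ) ≠ 0 := by exact_mod_cast h.right_ne
  set r := ellResidue p v w with hr
  set r' := ellResidue p w v with hr'
  -- The weight times J, minus its polar part. A constant multiple of each kernel suffices because J
  -- agrees at v and (pv)⁻¹, and at w and (pw)⁻¹; `hQ'` regroups the terms so that each simple pole
  -- meets a vanishing factor.
  set Q : ℂ → ℂ := fun z => ellWeight p v w z * J z - r * J v * poleKernel p v z -
    r' * J w * poleKernel p w z with hQ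
  have hQ' : ∀ z, Q z = regularWeight p v w z * J z + r * (poleKernel p v z * (J z - J v)) +
      r' * (poleKernel p w z * (J z - J w)) := fun z => by
    simp only [hQ, regularWeight, ← hr, ← hr']
    ring
  obtain ⟨R, hR, hRQ⟩ := exists_analyticOnNhd_eq (Q := Q) (K := outerAnnulus p)
    (finite_annulusPoles p v w)
    (fun z hz hzS => by
      obtain ⟨h1, h2⟩ := h.analyticAt_poleKernel hp0 hz hzS
      exact (((h.analyticAt_ellWeight hp0 hp1 hz hzS).mul (hJ z hz)).sub
        (analyticAt_const.mul h1)).sub (analyticAt_const.mul h2))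
    (fun s hs hsK => by
      have hs0 := ne_zero_of_mem_outerAnnulus hsK
      refine ⟨(((meromorphicAt_ellWeight hp0 hp1 hv0 hw0 hs0).mul (hJ s hsK).meromorphicAt).sub
        ((MeromorphicAt.const _ s).mul (meromorphicAt_poleKernel _ s))).sub
        ((MeromorphicAt.const _ s).mul (meromorphicAt_poleKernel _ s)), ?_⟩
      have hJc := (hJ s hsK).continuousAt
      have t1 := (h.tendsto_regularWeight hp0 hp1 hs).mul
        (hJc.tendsto.mono_left (nhdsWithin_le_nhds (s := {s}ᶜ)))
      have t2 := (h.tendsto_poleKernel_mul_sub hp0 hv hs hsK hJc).const_mul r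
      have hs' : s ∈ annulusPoles p w v := by
        simp only [annulusPoles, Set.mem_insert_iff, Set.mem_singleton_iff] at hs ⊢
        tauto
      have t3 := (h.symm.tendsto_poleKernel_mul_sub hp0 hw hs' hsK hJc).const_mul r'
      have := (t1.add t2).add t3
      simp only [zero_mul, mul_zero, add_zero] at this
      refine this.congr fun z => ?_
      rw [hQ']
      ring)
  obtain ⟨iR1, iR2⟩ := circleIntegrable_of_analyticOnNhd hp0 hp1 hR
  obtain ⟨iv, av⟩ := circleAverage_poleKernel_sub hp0 hp1 h.left_gt h.left_le
  obtain ⟨iw, aw⟩ := circleAverage_poleKernel_sub hp0 hp1 h.right_gt h.right_le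
  have hcongr : ∀ z : ℂ, ‖z‖ = 1 → z.im ≠ 0 → ellWeight p v w z * (J z - J (z / p)) =
      (((R - fun z => R (z / p)) + (r * J v) • fun z => poleKernel p v z - poleKernel p v (z / p)) +
        (r' * J w) • fun z => poleKernel p w z - poleKernel p w (z / p)) z := fun z hz hzi => by
    have hz0 : z ≠ 0 := norm_pos_iff.1 (by rw [hz]; exact one_pos)
    have e1 := hRQ z fun hS => hzi (im_eq_zero_of_mem_annulusPoles hS)
    have e2 := hRQ (z / p) fun hS => hzi (by
      have := im_eq_zero_of_mem_annulusPoles hS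
      rw [Complex.div_ofReal_im] at this
      simpa [hp0.ne'] using this)
    simp only [Pi.add_apply, Pi.sub_apply, Pi.smul_apply, smul_eq_mul, e1, e2, hQ,
      ellWeight_div hp0 hp1 hv0 hw0 hz0]
    ring
  rw [circleAverage_congr_of_im_ne_zero hcongr,
    Real.circleAverage_add ((iR1.sub iR2).add (iv.const_smul)) (iw.const_smul),
    Real.circleAverage_add (iR1.sub iR2) (iv.const_smul), Real.circleAverage_sub iR1 iR2,
    Real.circleAverage_smul, Real.circleAverage_smul, av, aw, circleAverage_div_eq hp0 hp1 hR]
  simp only [smul_eq_mul]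
  ring

/-- Under a ↦ pa both sides of the formula are multiplied by a². -/
lemma circleAverage_ellWeight_mul_iff (hp0 : 0 < p) (hp1 : p < 1) {a d : ℂ} (ha : a ≠ 0)
    (hd : d ≠ 0) (D : ℂ → ℂ) (A B : ℂ) :
    Real.circleAverage (fun z => ellWeight p (p * a) d z * D z) 0 1 =
        -2 * (ellResidue p (p * a) d * A + ellResidue p d (p * a) * B) ↔
      Real.circleAverage (fun z => ellWeight p a d z * D z) 0 1 =
        -2 * (ellResidue p a d * A + ellResidue p d a * B) := by
  have h1 : Real.circleAverage (fun z => ellWeight p (p * a) d z * D z) 0 1 =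
      a ^ 2 * Real.circleAverage (fun z => ellWeight p a d z * D z) 0 1 := by
    refine Eq.trans (Real.circleAverage_congr_sphere fun z hz => ?_)
      (Real.circleAverage_fun_smul (a := a ^ 2) (f := fun z => ellWeight p a d z * D z))
    have hz0 : z ≠ 0 := by
      rintro rfl
      simp at hz
    simp only [smul_eq_mul]
    rw [ellWeight_mul_left hp0 hp1 ha hz0, mul_assoc]
  rw [h1, ellResidue_mul_left hp0 hp1 ha hd, ellResidue_mul_right hp0 hp1 hd ha]
  have h2 : a ^ 2 ≠ 0 := pow_ne_zero 2 ha
  rw [show -2 * (a ^ 2 * ellResidue p a d * A + a ^ 2 * ellResidue p d a * B) =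
    a ^ 2 * (-2 * (ellResidue p a d * A + ellResidue p d a * B)) by ring, mul_right_inj' h2]

lemma circleAverage_ellWeight_pow_iff (hp0 : 0 < p) (hp1 : p < 1) {a d : ℂ} (ha : a ≠ 0)
    (hd : d ≠ 0) (D : ℂ → ℂ) (A B : ℂ) (n : ℕ) :
    Real.circleAverage (fun z => ellWeight p (a * p ^ n / p) d z * D z) 0 1 =
        -2 * (ellResidue p (a * p ^ n / p) d * A + ellResidue p d (a * p ^ n / p) * B) ↔
      Real.circleAverage (fun z => ellWeight p a d z * D z) 0 1 =
        -2 * (ellResidue p a d * A + ellResidue p d a * B) := by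
  have hp : (p : ℂ) ≠ 0 := by exact_mod_cast hp0.ne'
  induction n with
  | zero =>
    -- The actual exponent is n - 1, so the base case already compares a with a/p.
    have := circleAverage_ellWeight_mul_iff hp0 hp1 (div_ne_zero ha hp) hd D A B
    rw [mul_div_cancel₀ _ hp] at this
    rw [pow_zero, mul_one, this]
  | succ n ih =>
    refine Iff.trans ?_ ih
    rw [show a * (p : ℂ) ^ (n + 1) / p = p * (a * p ^ n / p) by field_simp; ring,
      circleAverage_ellWeight_mul_iff hp0 hp1 (by positivity) hd D A B]

/-- The contour integral of `ellWeight p a d` with the poles represented by `a p^(m-1)` and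
`d p^(n-1)`. -/
theorem circleAverage_ellWeight (hp0 : 0 < p) (hp1 : p < 1) {a d : ℝ} (ha : a ≠ 0) (hd : d ≠ 0)
    {m n : ℕ} (h : IsPolePair p (a * p ^ m / p) (d * p ^ n / p)) {J : ℂ → ℂ}
    (hJ : AnalyticOnNhd ℂ J (outerAnnulus p))
    (hv : J ((p : ℂ) * (a * p ^ m / p : ℝ))⁻¹ = J (a * p ^ m / p : ℝ))
    (hw : J ((p : ℂ) * (d * p ^ n / p : ℝ))⁻¹ = J (d * p ^ n / p : ℝ)) :
    Real.circleAverage (fun z => ellWeight p a d z * (J z - J (z / p))) 0 1 =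
      -2 * (ellResidue p a d * J (a * p ^ m / p : ℝ) +
        ellResidue p d a * J (d * p ^ n / p : ℝ)) := by
  have ha' : (a : ℂ) ≠ 0 := by exact_mod_cast ha
  have hd' : (d : ℂ) ≠ 0 := by exact_mod_cast hd
  have hw0 : ((d * p ^ n / p : ℝ) : ℂ) ≠ 0 := by exact_mod_cast h.right_ne
  have key := h.circleAverage_ellWeight hp0 hp1 hJ hv hw
  rw [show ((a * p ^ m / p : ℝ) : ℂ) = (a : ℂ) * p ^ m / p by push_cast; rfl] at key ⊢
  rw [circleAverage_ellWeight_pow_iff hp0 hp1 ha' hw0] at key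
  rw [show ((d * p ^ n / p : ℝ) : ℂ) = (d : ℂ) * p ^ n / p by push_cast; rfl] at key ⊢
  simp only [ellWeight_comm (p := p) (a : ℂ)] at key ⊢
  rw [add_comm (ellResidue p a (d * p ^ n / p) * _),
    circleAverage_ellWeight_pow_iff hp0 hp1 hd' ha'] at key
  rw [key, add_comm]

end

/-! ### Weight and masses in terms of theta functions -/

section
variable {p : ℝ}

/-- The infinite `q`-shifted factorial `(x; p)_∞` of one real argument. -/
noncomputable def realShiftedFactorial (p x : ℝ) : ℝ := ∏' i : ℕ, (1 - x * p ^ i)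

/-- The theta function `(x, p / x; p)_∞` of a real argument. -/
noncomputable def realTheta (p x : ℝ) : ℝ :=
  realShiftedFactorial p x * realShiftedFactorial p (p / x)

/-- The real version of `ellResidue`. -/
noncomputable def realResidue (p a d : ℝ) : ℝ :=
  1 / (a * realShiftedFactorial p p ^ 2 * (realTheta p (a * d) * realTheta p (d / a)))

lemma ofReal_realShiftedFactorial (hp0 : 0 < p) (hp1 : p < 1) (x : ℝ) :
    (realShiftedFactorial p x : ℂ) = shiftedFactorial p x := ofReal_tprod hp0 hp1 x

lemma ofReal_realTheta (hp0 : 0 < p) (hp1 : p < 1) (x : ℝ) :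
    (realTheta p x : ℂ) = theta p x := by
  simp [realTheta, theta, ofReal_realShiftedFactorial hp0 hp1]

lemma ofReal_realResidue (hp0 : 0 < p) (hp1 : p < 1) (a d : ℝ) :
    (realResidue p a d : ℂ) = ellResidue p a d := by
  simp [realResidue, ellResidue, ofReal_realShiftedFactorial hp0 hp1, ofReal_realTheta hp0 hp1]

lemma realShiftedFactorial_pos (hp0 : 0 < p) (hp1 : p < 1) {x : ℝ} (hx : x < 1) :
    0 < realShiftedFactorial p x := tprod_one_sub_mul_pow_pos hp0 hp1 hx

lemma realTheta_pos (hp0 : 0 < p) (hp1 : p < 1) {x : ℝ} (hx : x < 0) : 0 < realTheta p x :=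
  mul_pos (realShiftedFactorial_pos hp0 hp1 (by linarith))
    (realShiftedFactorial_pos hp0 hp1 ((div_neg_of_pos_of_neg hp0 hx).trans zero_lt_one))

lemma realShiftedFactorial_eq_mul (hp0 : 0 < p) (hp1 : p < 1) (x : ℝ) :
    realShiftedFactorial p x = (1 - x) * realShiftedFactorial p (p * x) := by
  have := shiftedFactorial_eq_mul hp0 hp1 (x : ℂ)
  rw [← Complex.ofReal_mul, ← ofReal_realShiftedFactorial hp0 hp1,
    ← ofReal_realShiftedFactorial hp0 hp1] at this
  exact_mod_cast this

lemma realTheta_mul (hp0 : 0 < p) (hp1 : p < 1) {x : ℝ} (hx : x ≠ 0) :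
    realTheta p (p * x) = -x⁻¹ * realTheta p x := by
  have := theta_mul hp0 hp1 (x := (x : ℂ)) (by exact_mod_cast hx)
  rw [← Complex.ofReal_mul, ← ofReal_realTheta hp0 hp1, ← ofReal_realTheta hp0 hp1] at this
  exact_mod_cast this

lemma div_neg_of_mul_neg {a d : ℝ} (h : a * d < 0) : d / a < 0 := by
  have ha : a ≠ 0 := fun h0 => by simp [h0] at h
  rw [show d / a = a * d / a ^ 2 by field_simp]
  exact div_neg_of_neg_of_pos h (by positivity)

/-- Masses enter the measures through `ENNReal.ofReal`, which would truncate negative values. Since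
a and d have opposite signs both theta values are positive, so the residue has the sign of a, and so
does ay - (ay)⁻¹. -/
lemma realResidue_mul_nonneg (hp0 : 0 < p) (hp1 : p < 1) {a d : ℝ} (had : a * d < 0) {y : ℝ}
    (hy : 0 < y) (hay : 1 < |a * y|) : 0 ≤ realResidue p a d * (a * y - (a * y)⁻¹) := by
  have ha : a ≠ 0 := fun h0 => by simp [h0] at had
  have h1 := realTheta_pos hp0 hp1 had
  have h2 := realTheta_pos hp0 hp1 (div_neg_of_mul_neg had)
  have h3 := realShiftedFactorial_pos hp0 hp1 hp1
  have h4 : 1 < (a * y) ^ 2 := by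
    rw [← sq_abs]
    nlinarith
  have h5 : realResidue p a d * (a * y - (a * y)⁻¹) =
      ((a * y) ^ 2 - 1) / (a ^ 2 * y *
        (realShiftedFactorial p p ^ 2 * (realTheta p (a * d) * realTheta p (d / a)))) := by
    rw [realResidue]
    field_simp
  rw [h5]
  exact div_nonneg (by linarith) (by positivity)

lemma qPochInf_eq (l : List ℝ) : qPochInf l p = (l.map (realShiftedFactorial p)).prod := rfl

lemma qPochInf_ofReal_eq (l : List ℂ) : qPochInf l (p : ℂ) = (l.map (shiftedFactorial p)).prod :=
  rfl

lemma awMass_swap (a b c d q : ℝ) (k : ℕ) : awMass a b c d q k = awMass a d c b q k := by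
  simp only [awMass, qPochInf, qPoch, List.map_cons, List.map_nil, List.prod_cons, List.prod_nil]
  rw [show a * b * c * d = a * d * c * b by ring]
  congr 2
  · congr 2
    ring
  · congr 1
    · ring
    · ring

/-- For these parameters the finite factorials in numerator and denominator have the same entries
a², p, ad, ap/d and cancel, the infinite ones combine into theta values, and p/(abcd) = p⁻¹. The
condition 1 < |a pᵏ| keeps every factor 1 - a²pⁱ nonzero, so the cancellation is never 0/0. -/
lemma awMass_eq (hp0 : 0 < p) (hp1 : p < 1) {a d : ℝ} (had : a * d < 0) {k : ℕ}
    (hk : 1 < |a * p ^ k|) :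
    awMass a (p / a) (p / d) d p k = realResidue p a d * (a * p ^ k - (a * p ^ k)⁻¹) := by
  have ha : a ≠ 0 := fun h0 => by simp [h0] at had
  have hd : d ≠ 0 := fun h0 => by simp [h0] at had
  have hda := div_neg_of_mul_neg had
  have hsq : ∀ i ≤ k, 1 < a ^ 2 * p ^ i := fun i hi => by
    have h1 : 1 < (a * p ^ k) ^ 2 := by
      rw [← sq_abs]
      nlinarith
    have h2 : (p ^ k) ^ 2 ≤ p ^ i := by
      rw [← pow_mul]
      exact pow_le_pow_of_le_one hp0.le hp1.le (by omega)
    nlinarith [sq_nonneg a]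
  have ha2 : 1 < a ^ 2 := by simpa using hsq 0 (Nat.zero_le k)
  have f1 : ∏ i ∈ Finset.range k, (1 - a ^ 2 * p ^ i) ≠ 0 :=
    Finset.prod_ne_zero_iff.2 fun i hi => by
      have := hsq i (Finset.mem_range.1 hi).le
      linarith
  have fneg : ∀ x < 1, ∏ i ∈ Finset.range k, (1 - x * p ^ i) ≠ 0 := fun x hx =>
    Finset.prod_ne_zero_iff.2 fun i hi => by
      have h1 : p ^ i ≤ 1 := pow_le_one₀ hp0.le hp1.le
      have h2 : 0 < p ^ i := pow_pos hp0 i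
      rcases le_or_gt x 0 with h | h <;> nlinarith
  have f2 := fneg p hp1
  have f3 := fneg (a * d) (by linarith)
  have f4 := fneg (a * p / d) (by
    have : a / d < 0 := div_neg_of_mul_neg (by linarith)
    rw [mul_comm, mul_div_assoc]
    nlinarith)
  have hratio : qPoch [a ^ 2, a * (p / a), a * (p / d), a * d] p k /
      qPoch [p, a * p / (p / a), a * p / (p / d), a * p / d] p k = 1 := by
    rw [show a * (p / a) = p by field_simp, show a * (p / d) = a * p / d by ring,
      show a * p / (p / a) = a ^ 2 by field_simp, show a * p / (p / d) = a * d by field_simp]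
    simp only [qPoch, List.map_cons, List.map_nil, List.prod_cons, List.prod_nil]
    rw [div_eq_one_iff_eq (by positivity)]
    ring
  have g1 := realShiftedFactorial_pos hp0 hp1 hp1
  have g2 := realTheta_pos hp0 hp1 had
  have g3 := realTheta_pos hp0 hp1 hda
  have g4 : 0 < realShiftedFactorial p (p / a / a) := realShiftedFactorial_pos hp0 hp1 (by
    rw [div_div, div_lt_one (by nlinarith)]
    nlinarith)
  have hinf : qPochInf [(a ^ 2)⁻¹] p / qPochInf [p, a * (p / a), p / a / a, a * (p / d), p / d / a,
      a * d, d / a] p = (1 - (a ^ 2)⁻¹) / (realShiftedFactorial p p ^ 2 *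
        (realTheta p (a * d) * realTheta p (d / a))) := by
    have e1 : realTheta p (a * d) =
        realShiftedFactorial p (a * d) * realShiftedFactorial p (p / d / a) := by
      rw [realTheta, show p / (a * d) = p / d / a by field_simp]
    have e2 : realTheta p (d / a) =
        realShiftedFactorial p (d / a) * realShiftedFactorial p (a * (p / d)) := by
      rw [realTheta, show p / (d / a) = a * (p / d) by field_simp]
    rw [e1] at g2
    rw [e2] at g3
    rw [show a * (p / a) = p by field_simp, e1, e2]
    simp only [qPochInf_eq, List.map_cons, List.map_nil, List.prod_cons, List.prod_nil]
    rw [realShiftedFactorial_eq_mul hp0 hp1 (a ^ 2)⁻¹,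
      show p * (a ^ 2)⁻¹ = p / a / a by field_simp]
    have := left_ne_zero_of_mul g2.ne'
    have := right_ne_zero_of_mul g2.ne'
    have := left_ne_zero_of_mul g3.ne'
    have := right_ne_zero_of_mul g3.ne'
    generalize realShiftedFactorial p (p / a / a) = x1 at *
    generalize realShiftedFactorial p (a * d) = x2 at *
    generalize realShiftedFactorial p (p / d / a) = x3 at *
    generalize realShiftedFactorial p (d / a) = x4 at *
    generalize realShiftedFactorial p (a * (p / d)) = x5 at *
    field_simp
  have ha3 : 1 - a ^ 2 ≠ 0 := by linarith
  rw [awMass, hratio, hinf, realResidue, show a * (p / a) * (p / d) * d = p * p by field_simp,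
    show p / (p * p) = p⁻¹ by field_simp, inv_pow]
  have hpk : p ^ k ≠ 0 := by positivity
  rw [pow_mul p 2 k, ← pow_mul, mul_comm 2 k, pow_mul p k 2]
  field_simp
  ring

lemma realTheta_pair (hp0 : 0 < p) (hp1 : p < 1) {a x : ℝ} (ha : a ≠ 0) (hx : x ≠ 0) :
    realTheta p (a * (x / p)) * realTheta p (a / (x / p)) =
      x ^ 2 / p * (realTheta p (a * x) * realTheta p (a / x)) := by
  have h1 := realTheta_mul hp0 hp1 (x := a * (x / p)) (by positivity)
  have h2 := realTheta_mul hp0 hp1 (x := a / x) (by positivity)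
  rw [show p * (a * (x / p)) = a * x by field_simp] at h1
  rw [show a / (x / p) = p * (a / x) by field_simp, h1, h2]
  field_simp

/-- Each step x ↦ x/p contributes x²/p; multiplied over x = d, d/p, …, d/p^(k-1), this is the source
of the Gaussian factor in `nuMass`. -/
lemma realTheta_pair_pow (hp0 : 0 < p) (hp1 : p < 1) {a d : ℝ} (ha : a ≠ 0) (hd : d ≠ 0) (k : ℕ) :
    realTheta p (a * (d / p ^ k)) * realTheta p (a / (d / p ^ k)) =
      d ^ (2 * k) / p ^ (k * k) * (realTheta p (a * d) * realTheta p (a / d)) := by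
  induction k with
  | zero => simp
  | succ k ih =>
    have h := realTheta_pair hp0 hp1 ha (x := d / p ^ k) (by positivity)
    rw [div_div, ← pow_succ] at h
    rw [h, ih]
    field_simp
    ring

lemma nuMass_eq (hp0 : 0 < p) (hp1 : p < 1) {a d : ℝ} (had : a * d < 0) (j : ℕ) :
    nuMass a (p / a) d p (j + 1) =
      realResidue p d a * (d * (p ^ (j + 1))⁻¹ - (d * (p ^ (j + 1))⁻¹)⁻¹) := by
  have ha : a ≠ 0 := fun h0 => by simp [h0] at had
  have hd : d ≠ 0 := fun h0 => by simp [h0] at had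
  have hpair := realTheta_pair_pow hp0 hp1 ha hd (j + 1)
  have hden : qPochInf [p, p, a * d * p ^ (-((j + 1 : ℕ) : ℤ)),
      p / a * d * p ^ (-((j + 1 : ℕ) : ℤ)), a * p ^ (j + 1) / d, p / a * p ^ (j + 1) / d] p =
      realShiftedFactorial p p ^ 2 *
        (d ^ (2 * (j + 1)) / p ^ ((j + 1) * (j + 1)) *
          (realTheta p (a * d) * realTheta p (a / d))) := by
    rw [← hpair, realTheta, realTheta, zpow_neg, zpow_natCast]
    simp only [qPochInf_eq, List.map_cons, List.map_nil, List.prod_cons, List.prod_nil]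
    rw [show a * d * (p ^ (j + 1))⁻¹ = a * (d / p ^ (j + 1)) by ring,
      show p / a * d * (p ^ (j + 1))⁻¹ = p / (a / (d / p ^ (j + 1))) by field_simp,
      show a * p ^ (j + 1) / d = a / (d / p ^ (j + 1)) by field_simp,
      show p / a * p ^ (j + 1) / d = p / (a * (d / p ^ (j + 1))) by field_simp]
    ring
  have e1 : d ^ (2 * (((j + 1 : ℕ) : ℤ) - 1)) = d ^ (2 * j) := by
    rw [show 2 * (((j + 1 : ℕ) : ℤ) - 1) = ((2 * j : ℕ) : ℤ) by push_cast; ring, zpow_natCast]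
  have e2 : p ^ (-(((j + 1 : ℕ) : ℤ) * (((j + 1 : ℕ) : ℤ) - 1))) = (p ^ ((j + 1) * j))⁻¹ := by
    rw [show ((j + 1 : ℕ) : ℤ) * (((j + 1 : ℕ) : ℤ) - 1) = (((j + 1) * j : ℕ) : ℤ) by
      push_cast; ring, zpow_neg, zpow_natCast]
  have e3 : p ^ (-(2 * ((j + 1 : ℕ) : ℤ))) = (p ^ (2 * (j + 1)))⁻¹ := by
    rw [show 2 * ((j + 1 : ℕ) : ℤ) = ((2 * (j + 1) : ℕ) : ℤ) by push_cast; ring, zpow_neg,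
      zpow_natCast]
  have g1 := realShiftedFactorial_pos hp0 hp1 hp1
  have g2 := realTheta_pos hp0 hp1 had
  have g3 := realTheta_pos hp0 hp1 (div_neg_of_mul_neg (a := d) (d := a) (by linarith))
  rw [nuMass, hden, e1, e2, e3, realResidue, mul_comm d a]
  have hpj : p ^ j ≠ 0 := by positivity
  field_simp
  ring

/-- The parameter pairs (a, p/a) and (d, p/d) complete the denominator to four theta functions; in
the numerator, splitting 1 - z⁻² = (z - z⁻¹)/z off (z⁻²; p)_∞ leaves θ(z²). -/
lemma weight_eq (hp0 : 0 < p) (hp1 : p < 1) {a d : ℝ} (ha : a ≠ 0) (hd : d ≠ 0) {z : ℂ}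
    (hz : z ≠ 0) :
    weight a (p / a) (p / d) d p z = (z - z⁻¹) * ellWeight p a d z := by
  have ha' : (a : ℂ) ≠ 0 := by exact_mod_cast ha
  have hd' : (d : ℂ) ≠ 0 := by exact_mod_cast hd
  have hp : (p : ℂ) ≠ 0 := by exact_mod_cast hp0.ne'
  rw [weight, ellWeight]
  simp only [theta, qPochInf_ofReal_eq, List.map_cons, List.map_nil, List.prod_cons, List.prod_nil,
    Complex.ofReal_div]
  rw [shiftedFactorial_eq_mul hp0 hp1 (z ^ 2)⁻¹, ← div_eq_mul_inv,
    show (p : ℂ) / (a * z) = p / a / z by field_simp,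
    show (p : ℂ) / (a / z) = p / a * z by field_simp,
    show (p : ℂ) / (d * z) = p / d / z by field_simp,
    show (p : ℂ) / (d / z) = p / d * z by field_simp,
    show 1 - (z ^ 2)⁻¹ = (z - z⁻¹) / z by field_simp]
  simp only [div_eq_mul_inv, mul_inv, mul_one]
  ring

/-- On the unit circle z⁻¹ is the conjugate of z, so with real parameters all factors come in
conjugate pairs. -/
lemma weight_nonneg (hp0 : 0 < p) (hp1 : p < 1) (a b c d : ℝ) {z : ℂ} (hz : ‖z‖ = 1) :
    ∃ x : ℝ, 0 ≤ x ∧ weight a b c d p z = x := by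
  have hinv : z⁻¹ = conj z := by
    rw [Complex.inv_def, Complex.normSq_eq_norm_sq, hz]
    simp
  have key : ∀ y : ℂ, shiftedFactorial p y * shiftedFactorial p (conj y) =
      ((‖shiftedFactorial p y‖ ^ 2 : ℝ) : ℂ) := fun y => by
    rw [← conj_shiftedFactorial hp0 hp1, Complex.mul_conj, Complex.normSq_eq_norm_sq]
  have k1 : ∀ a : ℝ, shiftedFactorial p (a * z) * shiftedFactorial p (a / z) =
      ((‖shiftedFactorial p (a * z)‖ ^ 2 : ℝ) : ℂ) := fun a => by
    rw [← key, map_mul, Complex.conj_ofReal, ← hinv, div_eq_mul_inv]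
  have k2 : shiftedFactorial p (z ^ 2) * shiftedFactorial p (z ^ 2)⁻¹ =
      ((‖shiftedFactorial p (z ^ 2)‖ ^ 2 : ℝ) : ℂ) := by
    rw [← key, map_pow, ← hinv, inv_pow]
  refine ⟨‖shiftedFactorial p (z ^ 2)‖ ^ 2 / (‖shiftedFactorial p (a * z)‖ ^ 2 *
    (‖shiftedFactorial p (b * z)‖ ^ 2 * (‖shiftedFactorial p (c * z)‖ ^ 2 *
      ‖shiftedFactorial p (d * z)‖ ^ 2))), by positivity, ?_⟩
  rw [Complex.ofReal_div, Complex.ofReal_mul, Complex.ofReal_mul, Complex.ofReal_mul, ← k1, ← k1,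
    ← k1, ← k1, ← k2, weight]
  simp only [qPochInf_ofReal_eq, List.map_cons, List.map_nil, List.prod_cons, List.prod_nil]
  congr 1 <;> ring

lemma measurable_weight (hp0 : 0 < p) (hp1 : p < 1) (a b c d : ℝ) :
    Measurable fun θ : ℝ => weight a b c d p (Complex.exp (θ * Complex.I)) := by
  have hc := (differentiable_shiftedFactorial hp0 hp1).continuous.measurable
  have he : Measurable fun θ : ℝ => Complex.exp (θ * Complex.I) :=
    Continuous.measurable (by fun_prop)
  simp only [weight, qPochInf_ofReal_eq, List.map_cons, List.map_nil, List.prod_cons, List.prod_nil]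
  fun_prop

lemma h0_pos (hp0 : 0 < p) (hp1 : p < 1) {a d : ℝ} (had : a * d < 0) :
    0 < h0 a (p / a) (p / d) d p := by
  have ha : a ≠ 0 := fun h0 => by simp [h0] at had
  have hd : d ≠ 0 := fun h0 => by simp [h0] at had
  have hda := div_neg_of_mul_neg had
  have had' : a / d < 0 := div_neg_of_mul_neg (by linarith)
  have hP : ∀ x < 1, 0 < realShiftedFactorial p x := fun x hx => realShiftedFactorial_pos hp0 hp1 hx
  have n1 : p * p < 1 := by nlinarith
  have n2 : a * (p / d) < 1 := by rw [show a * (p / d) = p * (a / d) by ring]; nlinarith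
  have n3 : p / a * (p / d) < 1 := by
    rw [show p / a * (p / d) = p * p / (a * d) by field_simp]
    exact (div_neg_of_pos_of_neg (by positivity) had).trans one_pos
  have n4 : p / a * d < 1 := by rw [show p / a * d = p * (d / a) by ring]; nlinarith
  rw [h0, show a * (p / a) * (p / d) * d = p * p by field_simp, show a * (p / a) = p by field_simp,
    show p / d * d = p by field_simp]
  simp only [qPochInf_eq, List.map_cons, List.map_nil, List.prod_cons, List.prod_nil]
  have := hP _ n1
  have := hP _ n2
  have := hP _ n3
  have := hP _ n4
  have := hP _ hp1
  have := hP (a * d) (by linarith)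
  positivity

end

/-! ### Integration against `nu` -/

/-- Integration against a sum of point masses all but finitely many of which do not contribute. -/
lemma integral_sum_smul_dirac {c : ℕ → ENNReal} (hc : ∀ i, c i ≠ ⊤) {x : ℕ → ℝ} {h : ℝ → ℂ} {N : ℕ}
    (hN : ∀ j ≥ N, c j = 0 ∨ h (x j) = 0) :
    Integrable h (Measure.sum fun i => c i • Measure.dirac (x i)) ∧
      ∫ y, h y ∂(Measure.sum fun i => c i • Measure.dirac (x i)) =
        ∑ i ∈ Finset.range N, ((c i).toReal : ℂ) * h (x i) := by
  have hz : ∀ j, j ∉ Finset.range N → (c j).toReal • h (x j) = 0 := fun j hj => by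
    rcases hN j (by simpa using hj) with h | h <;> simp [h]
  have hs : Summable fun i => (c i).toReal * ‖h (x i)‖ := by
    refine summable_of_ne_finset_zero (s := Finset.range N) fun j hj => ?_
    have := congrArg norm (hz j hj)
    simpa [abs_of_nonneg ENNReal.toReal_nonneg] using this
  refine ⟨integrable_sum_dirac hc hs, ?_⟩
  rw [integral_sum_dirac hc, tsum_eq_sum hz]
  simp

section
variable {p : ℝ}

lemma integral_awContinuousPart (hp0 : 0 < p) (hp1 : p < 1) (a b c d : ℝ) {h : ℝ → ℂ}
    (hm : Measurable h)
    (hi : IntegrableOn (fun θ : ℝ => weight a b c d p (Complex.exp (θ * Complex.I)) *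
      h (Real.cos θ)) (Set.Icc 0 Real.pi)) :
    Integrable h (awContinuousPart a b c d p) ∧
      ∫ x, h x ∂(awContinuousPart a b c d p) = (1 / (2 * Real.pi) : ℝ) *
        ∫ θ in Set.Icc 0 Real.pi, weight a b c d p (Complex.exp (θ * Complex.I)) *
          h (Real.cos θ) := by
  set ρ : ℝ → ENNReal := fun θ => ENNReal.ofReal (weight a b c d p (Complex.exp (θ * Complex.I))).re
  have hρ : Measurable ρ :=
    ENNReal.measurable_ofReal.comp (Complex.measurable_re.comp (measurable_weight hp0 hp1 a b c d))
  have hw : ∀ θ : ℝ, (ρ θ).toReal • h (Real.cos θ) =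
      weight a b c d p (Complex.exp (θ * Complex.I)) * h (Real.cos θ) := fun θ => by
    obtain ⟨x, hx, hwx⟩ := weight_nonneg hp0 hp1 a b c d (Complex.norm_exp_ofReal_mul_I θ)
    simp only [ρ, hwx, Complex.ofReal_re, ENNReal.toReal_ofReal hx, Complex.real_smul]
  have hlt : ∀ᵐ θ ∂(volume.restrict (Set.Icc 0 Real.pi)), ρ θ < ⊤ :=
    ae_of_all _ fun θ => ENNReal.ofReal_lt_top
  have hcos : Measurable Real.cos := Real.measurable_cos
  have i1 : Integrable h (((volume.restrict (Set.Icc 0 Real.pi)).withDensity ρ).map Real.cos) := by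
    rw [integrable_map_measure hm.aestronglyMeasurable hcos.aemeasurable,
      integrable_withDensity_iff_integrable_smul' hρ hlt]
    simp only [Function.comp, hw]
    exact hi
  refine ⟨i1.smul_measure ENNReal.ofReal_ne_top, ?_⟩
  rw [awContinuousPart, integral_smul_measure, integral_map hcos.aemeasurable
    hm.aestronglyMeasurable, integral_withDensity_eq_integral_toReal_smul hρ hlt,
    ENNReal.toReal_ofReal (by positivity), Complex.real_smul]
  simp only [hw]

lemma awPointPart_eq_zero (hp0 : 0 < p) (hp1 : p < 1) {e : ℝ} (he : |e| ≤ 1) (b c d : ℝ) :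
    awPointPart e b c d p = 0 := by
  rw [awPointPart]
  have : ∀ k : ℕ, ¬ 1 < |e * p ^ k| := fun k => by
    rw [abs_mul, abs_of_pos (pow_pos hp0 k), not_lt]
    exact mul_le_one₀ he (pow_pos hp0 k).le (pow_le_one₀ hp0.le hp1.le)
  simp only [this, if_false]
  exact Measure.sum_zero

lemma integral_awPointPart (hp0 : 0 < p) (hp1 : p < 1) {a d : ℝ} (had : a * d < 0) {m : ℕ}
    (hm : ∀ k : ℕ, 1 < |a * p ^ k| ↔ k < m) (h : ℝ → ℂ) :
    Integrable h (awPointPart a (p / a) (p / d) d p) ∧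
      ∫ x, h x ∂(awPointPart a (p / a) (p / d) d p) =
        ∑ k ∈ Finset.range m, (realResidue p a d * (a * p ^ k - (a * p ^ k)⁻¹) : ℝ) *
          h (mu (a * p ^ k)) := by
  have e : awPointPart a (p / a) (p / d) d p = Measure.sum fun k : ℕ =>
      (if 1 < |a * p ^ k| then ENNReal.ofReal (awMass a (p / a) (p / d) d p k) else 0) •
        Measure.dirac (mu (a * p ^ k)) := by
    rw [awPointPart]
    congr 1
    ext1 k
    split_ifs <;> simp
  obtain ⟨h1, h2⟩ := integral_sum_smul_dirac (c := fun k : ℕ =>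
    if 1 < |a * p ^ k| then ENNReal.ofReal (awMass a (p / a) (p / d) d p k) else 0)
    (x := fun k => mu (a * p ^ k)) (h := h) (N := m)
    (fun k => by split_ifs <;> simp) (fun k hk => by left; rw [if_neg]; rw [hm]; omega)
  rw [e]
  refine ⟨h1, h2.trans (Finset.sum_congr rfl fun k hk => ?_)⟩
  have hk' := (hm k).2 (Finset.mem_range.1 hk)
  rw [if_pos hk', awMass_eq hp0 hp1 had hk', ENNReal.toReal_ofReal
    (realResidue_mul_nonneg hp0 hp1 had (pow_pos hp0 k) hk')]

lemma integral_nu_extra (hp0 : 0 < p) (hp1 : p < 1) {a d : ℝ} (had : a * d < 0)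
    (hd : p < |d|) {h : ℝ → ℂ} {N : ℕ} (hN : ∀ j ≥ N, h (mu (d * (p ^ (j + 1))⁻¹)) = 0) :
    Integrable h (Measure.sum fun j : ℕ => ENNReal.ofReal (nuMass a (p / a) d p (j + 1)) •
      Measure.dirac (mu (d * p ^ (-((j : ℤ) + 1))))) ∧
    ∫ x, h x ∂(Measure.sum fun j : ℕ => ENNReal.ofReal (nuMass a (p / a) d p (j + 1)) •
      Measure.dirac (mu (d * p ^ (-((j : ℤ) + 1))))) =
        ∑ j ∈ Finset.range N,
          (realResidue p d a * (d * (p ^ (j + 1))⁻¹ - (d * (p ^ (j + 1))⁻¹)⁻¹) : ℝ) *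
            h (mu (d * (p ^ (j + 1))⁻¹)) := by
  have e : ∀ j : ℕ, d * p ^ (-((j : ℤ) + 1)) = d * (p ^ (j + 1))⁻¹ := fun j => by
    rw [zpow_neg]
    norm_cast
  simp only [e]
  obtain ⟨h1, h2⟩ := integral_sum_smul_dirac
    (c := fun j : ℕ => ENNReal.ofReal (nuMass a (p / a) d p (j + 1)))
    (x := fun j => mu (d * (p ^ (j + 1))⁻¹)) (h := h) (N := N)
    (fun k => ENNReal.ofReal_ne_top) (fun k hk => Or.inr (hN k hk))
  refine ⟨h1, h2.trans (Finset.sum_congr rfl fun j hj => ?_)⟩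
  rw [nuMass_eq hp0 hp1 had, ENNReal.toReal_ofReal
    (realResidue_mul_nonneg hp0 hp1 (by linarith) (inv_pos.2 (pow_pos hp0 (j + 1))) ?_)]
  have h3 : p ^ (j + 1) ≤ p := pow_le_of_le_one hp0.le hp1.le (by omega)
  rw [abs_mul, abs_of_pos (inv_pos.2 (pow_pos hp0 (j + 1))), ← div_eq_mul_inv,
    one_lt_div (pow_pos hp0 _)]
  linarith

/-- Integration against `nu` of a function that vanishes far away. -/
theorem integral_nu (hp0 : 0 < p) (hp1 : p < 1) {a d : ℝ} (had : a * d < 0)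
    (hpa : |p / a| ≤ 1) (hpd : |p / d| < 1) {m n N : ℕ} (hm : ∀ k : ℕ, 1 < |a * p ^ k| ↔ k < m)
    (hn : ∀ k : ℕ, 1 < |d * p ^ k| ↔ k < n) {h : ℝ → ℂ} (hmeas : Measurable h)
    (hN : ∀ j ≥ N, h (mu (d * (p ^ (j + 1))⁻¹)) = 0) {Y : ℝ → ℂ}
    (hi : IntegrableOn Y (Set.Icc 0 Real.pi))
    (hY : ∀ θ ∈ Set.Ioo 0 Real.pi, weight a (p / a) (p / d) d p (Complex.exp (θ * Complex.I)) *
      h (Real.cos θ) = Y θ) :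
    Integrable h (nu a (p / a) d p) ∧
      ∫ x, h x ∂(nu a (p / a) d p) =
        (1 / (2 * Real.pi) : ℝ) * (∫ θ in Set.Icc 0 Real.pi, Y θ) +
        (∑ k ∈ Finset.range m, (realResidue p a d * (a * p ^ k - (a * p ^ k)⁻¹) : ℝ) *
          h (mu (a * p ^ k)) +
        ∑ k ∈ Finset.range n, (realResidue p d a * (d * p ^ k - (d * p ^ k)⁻¹) : ℝ) *
          h (mu (d * p ^ k))) +
        ∑ j ∈ Finset.range N,
          (realResidue p d a * (d * (p ^ (j + 1))⁻¹ - (d * (p ^ (j + 1))⁻¹)⁻¹) : ℝ) *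
            h (mu (d * (p ^ (j + 1))⁻¹)) := by
  have ha0 : a ≠ 0 := fun h0 => by simp [h0] at had
  have hd0 : d ≠ 0 := fun h0 => by simp [h0] at had
  -- The endpoints correspond to z = ±1, where the weight may be singular; they are null.
  have hae : ∀ᵐ θ : ℝ ∂(volume.restrict (Set.Icc 0 Real.pi)),
      weight a (p / a) (p / d) d p (Complex.exp (θ * Complex.I)) * h (Real.cos θ) = Y θ := by
    rw [← restrict_Ioo_eq_restrict_Icc]
    exact (ae_restrict_iff' measurableSet_Ioo).2 (ae_of_all _ hY)
  have hpd' : p < |d| := by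
    rw [abs_div, abs_of_pos hp0, div_lt_one (abs_pos.2 hd0)] at hpd
    exact hpd
  obtain ⟨c1, c2⟩ := integral_awContinuousPart hp0 hp1 a (p / a) (p / d) d hmeas
    (Integrable.congr hi (hae.mono fun θ hθ => hθ.symm))
  rw [integral_congr_ae hae] at c2
  obtain ⟨a1, a2⟩ := integral_awPointPart hp0 hp1 had hm h
  obtain ⟨d1, d2⟩ := integral_awPointPart hp0 hp1 (a := d) (d := a) (by linarith) hn h
  obtain ⟨e1, e2⟩ := integral_nu_extra hp0 hp1 had hpd' hN
  -- Only a and d can carry masses, as p/a and p/d lie in the closed unit disc.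
  have eb : awPointPart (p / a) a (p / d) d p = 0 := awPointPart_eq_zero hp0 hp1 hpa _ _ _
  have ec : awPointPart (p / d) a (p / a) d p = 0 := awPointPart_eq_zero hp0 hp1 hpd.le _ _ _
  have ed : awPointPart d a (p / a) (p / d) p = awPointPart d (p / d) (p / a) a p := by
    simp only [awPointPart, awMass_swap d a]
  have hh := h0_pos hp0 hp1 had
  have hnu : nu a (p / a) d p = (awContinuousPart a (p / a) (p / d) d p +
      (awPointPart a (p / a) (p / d) d p + awPointPart d (p / d) (p / a) a p)) +
      Measure.sum fun j : ℕ => ENNReal.ofReal (nuMass a (p / a) d p (j + 1)) •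
        Measure.dirac (mu (d * p ^ (-((j : ℤ) + 1)))) := by
    rw [nu, awMeasure, smul_smul, ← ENNReal.ofReal_mul hh.le, mul_one_div_cancel hh.ne',
      ENNReal.ofReal_one, one_smul, eb, ec, ed, add_zero, add_zero]
  rw [hnu]
  refine ⟨(c1.add_measure (a1.add_measure d1)).add_measure e1, ?_⟩
  rw [integral_add_measure (c1.add_measure (a1.add_measure d1)) e1,
    integral_add_measure c1 (a1.add_measure d1), integral_add_measure a1 d1, c2, a2, d2, e2]

end

/-! ### The operator as a first difference, and analytic continuation -/

/-- The function `(z - z⁻¹) ψ(z)`, without the removable singularities at `z = ±1`. -/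
noncomputable def shiftCoeff (q s t : ℝ) (z : ℂ) : ℂ :=
  -((1 - q * s * t * z) * (1 - q * s * z / t) * (1 - q * t * z / s) * (1 - q * z / (s * t))) /
    (z * (1 - q ^ 2 * z ^ 2))

section
variable {q s t : ℝ}

lemma sub_inv_mul_psi {z : ℂ} (hz : z ≠ 0) (hz1 : z ^ 2 ≠ 1) :
    (z - z⁻¹) * psi q s t z = shiftCoeff q s t z := by
  have h1 : 1 - z ^ 2 ≠ 0 := sub_ne_zero.2 (Ne.symm hz1)
  rw [psi, shiftCoeff, show z - z⁻¹ = -(1 - z ^ 2) / z by field_simp; ring]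
  generalize (1 : ℂ) - q ^ 2 * z ^ 2 = D
  rcases eq_or_ne D 0 with rfl | hD
  · simp
  · field_simp

/-- The reflection exchanges the numerator factors of qst and q/(st), and those of qs/t and qt/s, up
to the common factor (q⁴z⁴)⁻¹; the denominator acquires the same factor and a sign. -/
lemma shiftCoeff_reflect (hq0 : 0 < q) (hs : s ≠ 0) (ht : t ≠ 0) {z : ℂ} (hz : z ≠ 0) :
    shiftCoeff q s t ((q : ℂ) ^ 2 * z)⁻¹ = -shiftCoeff q s t z := by
  have hq : (q : ℂ) ≠ 0 := by exact_mod_cast hq0.ne'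
  have hs' : (s : ℂ) ≠ 0 := by exact_mod_cast hs
  have ht' : (t : ℂ) ≠ 0 := by exact_mod_cast ht
  have e1 : (((q : ℂ) ^ 2 * z)⁻¹ * (1 - q ^ 2 * ((q ^ 2 * z)⁻¹) ^ 2)) =
      -((z * (1 - q ^ 2 * z ^ 2)) / (q ^ 4 * z ^ 4)) := by
    field_simp
    ring
  have e2 : (1 - q * s * t * ((q : ℂ) ^ 2 * z)⁻¹) * (1 - q * s * (q ^ 2 * z)⁻¹ / t) *
      (1 - q * t * (q ^ 2 * z)⁻¹ / s) * (1 - q * (q ^ 2 * z)⁻¹ / (s * t)) =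
      ((1 - q * s * t * z) * (1 - q * s * z / t) * (1 - q * t * z / s) * (1 - q * z / (s * t))) /
        (q ^ 4 * z ^ 4) := by
    field_simp
    ring
  have h0 : (q : ℂ) ^ 4 * z ^ 4 ≠ 0 := by positivity
  rw [shiftCoeff, shiftCoeff, e1, e2, div_neg, neg_div, neg_neg, div_div_div_cancel_right₀ h0,
    neg_div, neg_neg]

lemma conj_shiftCoeff (z : ℂ) : conj (shiftCoeff q s t z) = shiftCoeff q s t (conj z) := by
  simp [shiftCoeff]

/-- By reflection the coefficient of the backward shift at z is that of the forward shift at z/q².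
This puts the operator into Sturm-Liouville form and is the source of its symmetry. -/
lemma sub_inv_mul_qDiffOp (hq0 : 0 < q) (hs : s ≠ 0) (ht : t ≠ 0) (Φ : ℂ → ℂ) {z : ℂ} (hz : z ≠ 0)
    (hz1 : z ^ 2 ≠ 1) :
    (z - z⁻¹) * qDiffOp q s t Φ z = shiftCoeff q s t z * (Φ (q ^ 2 * z) - Φ z) -
      shiftCoeff q s t (z / q ^ 2) * (Φ z - Φ (z / q ^ 2)) := by
  have hq : (q : ℂ) ≠ 0 := by exact_mod_cast hq0.ne'
  have h1 := shiftCoeff_reflect hq0 hs ht (z := z / q ^ 2) (by positivity)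
  rw [mul_div_cancel₀ z (pow_ne_zero 2 hq)] at h1
  have h2 := sub_inv_mul_psi (q := q) (s := s) (t := t) (inv_ne_zero hz)
    (by rw [inv_pow]; simpa using hz1)
  rw [h1, inv_inv] at h2
  rw [qDiffOp, mul_add, ← mul_assoc, sub_inv_mul_psi hz hz1, inv_mul_eq_div]
  linear_combination (Φ z - Φ (z / q ^ 2)) * h2

lemma analyticAt_shiftCoeff {z : ℂ} (hz : z ≠ 0) (h1 : (q : ℂ) ^ 2 * z ^ 2 ≠ 1) :
    AnalyticAt ℂ (shiftCoeff q s t) z := by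
  have h2 : z * (1 - q ^ 2 * z ^ 2) ≠ 0 := mul_ne_zero hz (sub_ne_zero.2 (Ne.symm h1))
  unfold shiftCoeff
  simp only [div_eq_mul_inv]
  refine AnalyticAt.mul (by fun_prop) (AnalyticAt.inv (by fun_prop) h2)

lemma meromorphicAt_shiftCoeff (z : ℂ) : MeromorphicAt (shiftCoeff q s t) z := by
  unfold shiftCoeff
  simp only [div_eq_mul_inv]
  exact AnalyticAt.meromorphicAt (by fun_prop) |>.mul (AnalyticAt.meromorphicAt (by fun_prop)).inv

lemma sq_mul_sq_eq_one_iff {z : ℂ} (hq0 : 0 < q) :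
    (q : ℂ) ^ 2 * z ^ 2 = 1 ↔ z ∈ ({(q : ℂ)⁻¹, -(q : ℂ)⁻¹} : Set ℂ) := by
  have hq : (q : ℂ) ≠ 0 := by exact_mod_cast hq0.ne'
  have h : (q : ℂ) ^ 2 * z ^ 2 = 1 ↔ (q : ℂ) * z = 1 ∨ (q : ℂ) * z = -1 := by
    rw [← mul_pow, sq_eq_one_iff]
  rw [h, Set.mem_insert_iff, Set.mem_singleton_iff, ← mul_right_inj' hq (b := z) (c := (q : ℂ)⁻¹),
    ← mul_right_inj' hq (b := z) (c := -(q : ℂ)⁻¹), mul_neg, mul_inv_cancel₀ hq]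

lemma mem_annulus_of_mem_outerAnnulus (hq0 : 0 < q) (hq1 : q < 1) {z : ℂ}
    (hz : z ∈ outerAnnulus (q ^ 2)) : z ∈ annulus q ∧ (q : ℂ) ^ 2 * z ∈ annulus q := by
  have h1 : q ^ 2 ≤ 1 := pow_le_one₀ hq0.le hq1.le
  have h0 : 0 < q ^ 2 := by positivity
  have h2 : 1 ≤ (q ^ 2)⁻¹ := (one_le_inv₀ h0).2 h1
  have h3 : ‖(q : ℂ) ^ 2 * z‖ = q ^ 2 * ‖z‖ := by
    rw [norm_mul, norm_pow, Complex.norm_real, Real.norm_of_nonneg hq0.le]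
  have h4 : q ^ 2 * (q ^ 2)⁻¹ = 1 := mul_inv_cancel₀ h0.ne'
  refine ⟨⟨h1.trans hz.1, hz.2⟩, ?_, ?_⟩
  · rw [h3]
    nlinarith [hz.1]
  · rw [h3]
    nlinarith [hz.2]

lemma inv_mem_annulus (hq0 : 0 < q) {z : ℂ} (hz : z ∈ annulus q) : z⁻¹ ∈ annulus q := by
  have h0 : 0 < q ^ 2 := by positivity
  have hz0 : 0 < ‖z‖ := h0.trans_le hz.1
  refine ⟨?_, ?_⟩
  · rw [norm_inv, le_inv_comm₀ h0 hz0]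
    exact hz.2
  · rw [norm_inv, inv_le_inv₀ hz0 h0]
    exact hz.1

lemma isPreconnected_annulus (hq0 : 0 < q) : IsPreconnected (annulus q) := by
  have h0 : 0 < q ^ 2 := by positivity
  have h : annulus q =
      Complex.exp '' {w : ℂ | w.re ∈ Set.Icc (Real.log (q ^ 2)) (Real.log (q ^ 2)⁻¹)} := by
    ext z
    constructor
    · intro hz
      have hz0 : z ≠ 0 := norm_pos_iff.1 (h0.trans_le hz.1)
      refine ⟨Complex.log z, ?_, Complex.exp_log hz0⟩
      rw [Set.mem_ofPred_eq, Complex.log_re]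
      exact ⟨Real.log_le_log h0 hz.1, Real.log_le_log (norm_pos_iff.2 hz0) hz.2⟩
    · rintro ⟨w, hw, rfl⟩
      simp only [annulus, Set.mem_ofPred_eq, Complex.norm_exp]
      exact ⟨(Real.log_le_iff_le_exp h0).1 hw.1, (Real.le_log_iff_exp_le (inv_pos.2 h0)).1 hw.2⟩
  rw [h]
  refine IsPreconnected.image ?_ _ Complex.continuous_exp.continuousOn
  have : Convex ℝ (Complex.reLm ⁻¹' Set.Icc (Real.log (q ^ 2)) (Real.log (q ^ 2)⁻¹)) :=
    (convex_Icc _ _).linear_preimage Complex.reLm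
  exact this.isPreconnected

lemma ofReal_mu (x : ℝ) : mu (x : ℂ) = ((mu x : ℝ) : ℂ) := by
  simp [mu]

lemma mu_inv {K : Type*} [Field K] (z : K) : mu z⁻¹ = mu z := by
  rw [mu, mu, inv_inv, add_comm]

/-- What is used about a function `f` on the line, the continuation `F` of `f ∘ μ`, the
continuation `X` of `(z - z⁻¹) ψ(z) (F (q² z) - F z)` and the image `Lf` of `f`. -/
structure RadialData (q s t : ℝ) (f : ℝ → ℂ) (F X : ℂ → ℂ) (Lf : ℝ → ℂ) : Prop where
  analytic : AnalyticOnNhd ℂ F (annulus q)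
  inv : ∀ z ∈ annulus q, F z⁻¹ = F z
  eq_mu : ∀ z ∈ annulus q, ∀ x : ℝ, mu z = x → F z = f x
  analytic_diff : AnalyticOnNhd ℂ X (outerAnnulus (q ^ 2))
  diff_eq : ∀ z, z ∉ ({(q : ℂ)⁻¹, -(q : ℂ)⁻¹} : Set ℂ) →
    X z = shiftCoeff q s t z * (F (q ^ 2 * z) - F z)
  circle : ∀ θ ∈ Set.Ioo 0 Real.pi,
    (Complex.exp (θ * Complex.I) - (Complex.exp (θ * Complex.I))⁻¹) * Lf (Real.cos θ) =
      X (Complex.exp (θ * Complex.I)) - X (Complex.exp (θ * Complex.I) / (q ^ 2 : ℝ))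
  real : ∀ z : ℝ, 1 < |z| → |z| ≠ q⁻¹ → ((z : ℂ) - (z : ℂ)⁻¹) * Lf (mu z) =
    shiftCoeff q s t z * (f (mu (q ^ 2 * z)) - f (mu z)) -
      shiftCoeff q s t (z / q ^ 2) * (f (mu z) - f (mu (z / q ^ 2)))
  real_special : ∀ z : ℝ, |z| = q⁻¹ → ((z : ℂ) - (z : ℂ)⁻¹) * Lf (mu z) =
    X z - shiftCoeff q s t (z / q ^ 2) * (f (mu z) - f (mu (z / q ^ 2)))

/-- Invariance of F under inversion is not assumed. It holds at real points near 1, where both sides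
are values of f at the same point, and spreads over the connected annulus by the identity theorem.
-/
lemma IsAnalyticContinuation.basic (hq0 : 0 < q) (hq1 : q < 1) {f : ℝ → ℂ} {F : ℂ → ℂ}
    (hF : IsAnalyticContinuation q f F) :
    AnalyticOnNhd ℂ F (annulus q) ∧ (∀ z ∈ annulus q, F z⁻¹ = F z) ∧
      ∀ z ∈ annulus q, ∀ x : ℝ, mu z = x → F z = f x := by
  obtain ⟨U, hU, hUa, hFa, hFf⟩ := hF
  have h0 : 0 < q ^ 2 := by positivity
  have hne : ∀ z ∈ annulus q, z ≠ 0 := fun z hz => norm_pos_iff.1 (h0.trans_le hz.1)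
  have h3 : ∀ z ∈ annulus q, ∀ x : ℝ, mu z = x → F z = f x := fun z hz x hx =>
    hFf z (hUa hz) (hne z hz) x hx
  have h1 : AnalyticOnNhd ℂ F (annulus q) := hFa.mono hUa
  refine ⟨h1, ?_, h3⟩
  have h2 : AnalyticOnNhd ℂ (fun z => F z⁻¹) (annulus q) := fun z hz =>
    (h1 _ (inv_mem_annulus hq0 hz)).fun_comp (analyticAt_inv (hne z hz))
  have hle : q ^ 2 < 1 := pow_lt_one₀ hq0.le hq1 two_ne_zero
  have hle' : 1 < (q ^ 2)⁻¹ := (one_lt_inv₀ h0).2 hle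
  have hone : (1 : ℂ) ∈ annulus q := by
    simp only [annulus, Set.mem_ofPred_eq, norm_one]
    exact ⟨hle.le, hle'.le⟩
  have hfr : ∃ᶠ z in 𝓝[≠] (1 : ℂ), F z⁻¹ = F z := by
    have hreal : ∀ᶠ x : ℝ in 𝓝[≠] 1, F ((x : ℂ))⁻¹ = F x := by
      have : Set.Ioo (q ^ 2) (q ^ 2)⁻¹ ∈ 𝓝 (1 : ℝ) := Ioo_mem_nhds hle hle'
      filter_upwards [nhdsWithin_le_nhds this] with x hx
      have hx0 : 0 < x := h0.trans hx.1
      have hxa : (x : ℂ) ∈ annulus q := by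
        simp only [annulus, Set.mem_ofPred_eq, Complex.norm_real, Real.norm_of_nonneg hx0.le]
        exact ⟨hx.1.le, hx.2.le⟩
      rw [h3 x hxa (mu x) (ofReal_mu x),
        h3 _ (inv_mem_annulus hq0 hxa) (mu x) (by rw [mu_inv]; exact ofReal_mu x)]
    have ht : Tendsto (fun x : ℝ => (x : ℂ)) (𝓝[≠] 1) (𝓝[≠] 1) := by
      rw [tendsto_nhdsWithin_iff]
      refine ⟨(Complex.continuous_ofReal.tendsto' 1 1 (by simp)).mono_left nhdsWithin_le_nhds, ?_⟩
      filter_upwards [self_mem_nhdsWithin] with x hx h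
      exact hx (by simpa using h)
    exact ht.frequently hreal.frequently
  exact fun z hz => h2.eqOn_of_preconnected_of_frequently_eq h1 (isPreconnected_annulus hq0)
    hone hfr hz

/-- At the poles ±q⁻¹ of the coefficient q²z = z⁻¹, so F(q²z) - F(z) vanishes there by inversion
symmetry and removes the simple pole. -/
lemma exists_diff_continuation (hq0 : 0 < q) (hq1 : q < 1) {f : ℝ → ℂ} {F : ℂ → ℂ}
    (hF : IsAnalyticContinuation q f F) :
    ∃ X : ℂ → ℂ, AnalyticOnNhd ℂ X (outerAnnulus (q ^ 2)) ∧
      ∀ z, z ∉ ({(q : ℂ)⁻¹, -(q : ℂ)⁻¹} : Set ℂ) →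
        X z = shiftCoeff q s t z * (F (q ^ 2 * z) - F z) := by
  obtain ⟨h1, h2, h3⟩ := hF.basic hq0 hq1
  have hq : (q : ℂ) ≠ 0 := by exact_mod_cast hq0.ne'
  have han : ∀ z ∈ outerAnnulus (q ^ 2), AnalyticAt ℂ (fun z => F (q ^ 2 * z) - F z) z :=
    fun z hz => ((h1 _ (mem_annulus_of_mem_outerAnnulus hq0 hq1 hz).2).fun_comp
      (by fun_prop)).sub (h1 _ (mem_annulus_of_mem_outerAnnulus hq0 hq1 hz).1)
  refine exists_analyticOnNhd_eq (Set.toFinite _) (fun z hz hzS => ?_) fun z hzS hz => ⟨?_, ?_⟩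
  · exact (analyticAt_shiftCoeff (ne_zero_of_mem_outerAnnulus hz)
      (fun h => hzS ((sq_mul_sq_eq_one_iff hq0).1 h))).mul (han z hz)
  · exact (meromorphicAt_shiftCoeff z).mul (han z hz).meromorphicAt
  · have hz0 := ne_zero_of_mem_outerAnnulus hz
    have hqz := (sq_mul_sq_eq_one_iff hq0).2 hzS
    have hd0 : F (q ^ 2 * z) - F z = 0 := by
      have : (q : ℂ) ^ 2 * z = z⁻¹ := by
        rw [← mul_eq_one_iff_eq_inv₀ hz0]
        linear_combination hqz
      rw [this, h2 z (mem_annulus_of_mem_outerAnnulus hq0 hq1 hz).1, sub_self]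
    -- Since q²z² = 1, the denominator factor is 1 - q²y² = -q²(y - z)(y + z); this is the product
    -- with y - z cancelled.
    have hlim : ContinuousAt (fun y : ℂ => ((q : ℂ) ^ 2)⁻¹ *
        ((1 - q * s * t * y) * (1 - q * s * y / t) * (1 - q * t * y / s) * (1 - q * y / (s * t))) *
        (y * (y + z))⁻¹ *
        (F (q ^ 2 * y) - F y)) z := by
      refine ContinuousAt.mul (ContinuousAt.mul (by fun_prop) (ContinuousAt.inv₀ (by fun_prop) ?_))
        (han z hz).continuousAt
      rw [← two_mul]
      exact mul_ne_zero hz0 (mul_ne_zero two_ne_zero hz0)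
    have hlim' := hlim.tendsto.mono_left (nhdsWithin_le_nhds (s := {z}ᶜ))
    rw [hd0, mul_zero] at hlim'
    refine hlim'.congr' ?_
    filter_upwards [self_mem_nhdsWithin] with y hy
    have hyz : y - z ≠ 0 := sub_ne_zero.2 hy
    have e : 1 - (q : ℂ) ^ 2 * y ^ 2 = -(q ^ 2) * ((y - z) * (y + z)) := by
      linear_combination -hqz
    have hinv := mul_inv_cancel₀ hyz
    rw [shiftCoeff, e]
    simp only [div_eq_mul_inv, mul_inv, inv_neg]
    generalize (q : ℂ) * s * y * (t : ℂ)⁻¹ = n1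
    generalize F (q ^ 2 * y) - F y = n2
    linear_combination (-(((q : ℂ) ^ 2)⁻¹ * ((1 - q * s * t * y) * (1 - n1) *
      (1 - q * t * y * (s : ℂ)⁻¹) * (1 - q * y * ((s : ℂ)⁻¹ * (t : ℂ)⁻¹))) *
      (y⁻¹ * (y + z)⁻¹) * n2)) * hinv

end

/-! ### Inverting `mu`, and the values of `radialCasimir` -/

/-- The real `z` with `|z| ≥ 1` and `μ(z) = x`, for real `x` with `|x| ≥ 1`. -/
noncomputable def realMuInv (x : ℝ) : ℝ := if 0 < x then x + √(x ^ 2 - 1) else x - √(x ^ 2 - 1)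

lemma muInv_eq_ofReal {x : ℝ} (hx : 1 < |x|) : muInv x = (realMuInv x : ℂ) := by
  rw [muInv, if_neg hx.not_ge, realMuInv]
  split_ifs <;> rfl

lemma sqrt_mu_sq_sub_one {z : ℝ} (hz : z ≠ 0) : √(mu z ^ 2 - 1) = |z - z⁻¹| / 2 := by
  rw [show mu z ^ 2 - 1 = ((z - z⁻¹) / 2) ^ 2 by rw [mu]; field_simp; ring, Real.sqrt_sq_eq_abs,
    abs_div, abs_two]

lemma mu_neg {K : Type*} [Field K] (z : K) : mu (-z) = -mu z := by
  rw [mu, mu, inv_neg]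
  ring

lemma abs_mu (z : ℝ) : |mu z| = mu |z| := by
  rcases le_total 0 z with h | h
  · rw [abs_of_nonneg h, abs_of_nonneg]
    rw [mu]
    positivity
  · have h0 : 0 ≤ -z := neg_nonneg.2 h
    rw [abs_of_nonpos h, mu_neg, abs_of_nonpos]
    rw [← neg_nonneg, ← mu_neg, mu]
    positivity

lemma one_lt_mu {z : ℝ} (hz : 1 < z) : 1 < mu z := by
  have h0 : 0 < z := one_pos.trans hz
  rw [mu, lt_div_iff₀ two_pos, ← sub_pos]
  have : z + z⁻¹ - 1 * 2 = (z - 1) ^ 2 / z := by field_simp; ring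
  rw [this]
  have : 0 < z - 1 := sub_pos.2 hz
  positivity

lemma one_lt_abs_mu {z : ℝ} (hz : 1 < |z|) : 1 < |mu z| := by
  rw [abs_mu]
  exact one_lt_mu hz

lemma mu_strictMono {u v : ℝ} (hu : 1 ≤ u) (huv : u < v) : mu u < mu v := by
  have h0 : 0 < u := one_pos.trans_le hu
  have h1 : 0 < v := h0.trans huv
  rw [mu, mu, ← sub_pos]
  have : (v + v⁻¹) / 2 - (u + u⁻¹) / 2 = (v - u) * (u * v - 1) / (2 * u * v) := by
    field_simp
    ring
  rw [this]
  have h2 : 0 < v - u := sub_pos.2 huv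
  have h3 : 0 < u * v - 1 := by nlinarith
  positivity

lemma mu_pos_iff {z : ℝ} : 0 < mu z ↔ 0 < z := by
  constructor
  · intro h
    by_contra hz
    push Not at hz
    have : z⁻¹ ≤ 0 := inv_nonpos.2 hz
    rw [mu] at h
    linarith
  · intro h
    rw [mu]
    positivity

lemma realMuInv_mu {z : ℝ} (hz : 1 < |z|) : realMuInv (mu z) = z := by
  have hz0 : z ≠ 0 := by
    rintro rfl
    norm_num at hz
  rw [realMuInv, sqrt_mu_sq_sub_one hz0]
  rcases hz0.lt_or_gt with h | h
  · rw [if_neg (by rw [mu_pos_iff]; exact h.not_gt)]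
    rw [abs_of_neg h] at hz
    have h1 : (-z)⁻¹ ≤ 1 := inv_le_one_of_one_le₀ hz.le
    rw [inv_neg] at h1
    rw [abs_of_nonpos (by linarith), mu]
    ring
  · rw [if_pos (mu_pos_iff.2 h)]
    rw [abs_of_pos h] at hz
    have h1 : z⁻¹ ≤ 1 := inv_le_one_of_one_le₀ hz.le
    rw [abs_of_nonneg (by linarith), mu]
    ring

lemma mu_realMuInv {x : ℝ} (hx : 1 < |x|) : mu (realMuInv x) = x := by
  have h1 : 0 < x ^ 2 - 1 := by
    rw [← sq_abs]
    nlinarith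
  have h2 := Real.sq_sqrt h1.le
  rw [realMuInv]
  split_ifs
  · rw [mu, inv_eq_of_mul_eq_one_right (b := x - √(x ^ 2 - 1)) (by linear_combination -h2)]
    ring
  · rw [mu, inv_eq_of_mul_eq_one_right (b := x + √(x ^ 2 - 1)) (by linear_combination -h2)]
    ring

lemma continuousAt_realMuInv {x : ℝ} (hx : x ≠ 0) : ContinuousAt realMuInv x := by
  rcases hx.lt_or_gt with h | h
  · refine ContinuousAt.congr (f := fun x => x - √(x ^ 2 - 1)) (by fun_prop) ?_
    filter_upwards [Iio_mem_nhds h] with y hy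
    rw [realMuInv, if_neg (not_lt.2 (le_of_lt hy))]
  · refine ContinuousAt.congr (f := fun x => x + √(x ^ 2 - 1)) (by fun_prop) ?_
    filter_upwards [Ioi_mem_nhds h] with y hy
    rw [realMuInv, if_pos (Set.mem_Ioi.1 hy)]

lemma muInv_cos {θ : ℝ} (h : θ ∈ Set.Ioo 0 Real.pi) :
    muInv (Real.cos θ) = Complex.exp (θ * Complex.I) := by
  rw [muInv, if_pos (Real.abs_cos_le_one θ), Complex.exp_mul_I, ← Real.sin_sq,
    Real.sqrt_sq (Real.sin_pos_of_mem_Ioo h).le, Complex.ofReal_cos, Complex.ofReal_sin]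

lemma measurable_muInv : Measurable muInv := by
  have h1 : MeasurableSet {x : ℝ | |x| ≤ 1} := measurableSet_le (by fun_prop) (by fun_prop)
  have h2 : MeasurableSet {x : ℝ | 0 < x} := measurableSet_lt (by fun_prop) (by fun_prop)
  unfold muInv
  exact Measurable.ite h1 (by fun_prop) (Measurable.ite h2 (by fun_prop) (by fun_prop))

section
variable {q s t : ℝ} {f : ℝ → ℂ} {F X : ℂ → ℂ} {Lf : ℝ → ℂ}

lemma abs_mu_ne_of_abs_ne (hq0 : 0 < q) (hq1 : q < 1) {z : ℝ} (hz : 1 < |z|) (hzq : |z| ≠ q⁻¹) :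
    |mu z| ≠ mu q := by
  have h1 : 1 < q⁻¹ := (one_lt_inv₀ hq0).2 hq1
  rw [abs_mu, ← mu_inv q]
  rcases hzq.lt_or_gt with h | h
  · exact (mu_strictMono hz.le h).ne
  · exact (mu_strictMono h1.le h).ne'

lemma pullback_ofReal (hF : ∀ z ∈ annulus q, ∀ x : ℝ, mu z = x → F z = f x) (y : ℝ) :
    pullback q f F y = f (mu y) := by
  rw [pullback]
  split_ifs with h
  · exact hF _ h _ (ofReal_mu y)
  · rw [ofReal_mu, Complex.ofReal_re]

lemma measurableSet_annulus (q : ℝ) : MeasurableSet (annulus q) :=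
  (measurableSet_le measurable_const measurable_norm).inter
    (measurableSet_le measurable_norm measurable_const)

lemma measurable_mu : Measurable (mu : ℂ → ℂ) := by
  unfold mu
  fun_prop

lemma measurable_pullback (hf : Continuous f) (hF : ContinuousOn F (annulus q)) :
    Measurable (pullback q f F) := by
  classical
  have h1 : Measurable ((annulus q).indicator F) := by
    rw [← Set.piecewise_eq_indicator]
    exact hF.measurable_piecewise continuousOn_const (measurableSet_annulus q)
  have h2 : Measurable fun z : ℂ => f (mu z).re :=
    hf.measurable.comp (Complex.measurable_re.comp measurable_mu)
  have : pullback q f F = fun z =>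
      if z ∈ annulus q then (annulus q).indicator F z else f (mu z).re := by
    funext z
    rw [pullback]
    split_ifs with h
    · rw [Set.indicator_of_mem h]
    · rfl
  rw [this]
  exact Measurable.ite (measurableSet_annulus q) h1 h2

lemma measurable_psi : Measurable (psi q s t) := by
  unfold psi
  fun_prop

lemma measurable_qDiffOp {Φ : ℂ → ℂ} (hΦ : Measurable Φ) : Measurable (qDiffOp q s t Φ) := by
  unfold qDiffOp
  have := measurable_psi (q := q) (s := s) (t := t)
  fun_prop

/-- The limits modify a measurable function in at most four points. -/
lemma measurable_radialCasimir (hf : Continuous f) (hF : ContinuousOn F (annulus q)) :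
    Measurable (radialCasimir q s t f F) := by
  have h1 : Measurable fun x => qDiffOp q s t (pullback q f F) (muInv x) :=
    (measurable_qDiffOp (measurable_pullback hf hF)).comp measurable_muInv
  refine h1.measurable_of_countable_ne (Set.Countable.mono (s₂ := {1, -1, mu q, -mu q}) ?_
    (Set.toFinite _).countable)
  intro x hx
  by_contra h
  simp only [Set.mem_insert_iff, Set.mem_singleton_iff, not_or] at h
  refine hx ?_
  rw [radialCasimir, if_neg]
  rintro (h' | h')
  · rcases abs_eq zero_le_one |>.1 h' with h' | h'
    exacts [h.1 h', h.2.1 h']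
  · rcases abs_choice x with h'' | h'' <;> rw [h''] at h'
    exacts [h.2.2.1 h', h.2.2.2 (by rw [← h', neg_neg])]

lemma sub_inv_mul_qDiffOp_pullback (hq0 : 0 < q) (hs : s ≠ 0) (ht : t ≠ 0)
    (hF : ∀ z ∈ annulus q, ∀ x : ℝ, mu z = x → F z = f x) {z : ℝ} (hz : 1 < |z|) :
    ((z : ℂ) - (z : ℂ)⁻¹) * qDiffOp q s t (pullback q f F) z =
      shiftCoeff q s t z * (f (mu (q ^ 2 * z)) - f (mu z)) -
        shiftCoeff q s t (z / q ^ 2) * (f (mu z) - f (mu (z / q ^ 2))) := by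
  have hz0 : z ≠ 0 := by
    rintro rfl
    norm_num at hz
  have hz1 : (z : ℂ) ^ 2 ≠ 1 := by
    intro h
    have h' : z ^ 2 = 1 := by exact_mod_cast h
    rw [← sq_abs] at h'
    nlinarith
  rw [sub_inv_mul_qDiffOp hq0 hs ht _ (by exact_mod_cast hz0) hz1, ← pullback_ofReal hF,
    ← pullback_ofReal hF, ← pullback_ofReal hF]
  push_cast
  rfl

lemma diff_eq_ofReal (hq0 : 0 < q) (hq1 : q < 1)
    (hF : ∀ z ∈ annulus q, ∀ x : ℝ, mu z = x → F z = f x)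
    (hX : ∀ z, z ∉ ({(q : ℂ)⁻¹, -(q : ℂ)⁻¹} : Set ℂ) →
      X z = shiftCoeff q s t z * (F (q ^ 2 * z) - F z))
    {z : ℝ} (hz : (z : ℂ) ∈ outerAnnulus (q ^ 2)) (hzq : |z| ≠ q⁻¹) :
    X z = shiftCoeff q s t z * (f (mu (q ^ 2 * z)) - f (mu z)) := by
  obtain ⟨h1, h2⟩ := mem_annulus_of_mem_outerAnnulus hq0 hq1 hz
  rw [hX, hF _ h1 _ (ofReal_mu z), hF _ h2 (mu (q ^ 2 * z)) (by rw [← ofReal_mu]; push_cast; rfl)]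
  rintro (h | h)
  · have : z = q⁻¹ := by exact_mod_cast h
    exact hzq (by rw [this, abs_of_pos (inv_pos.2 hq0)])
  · have : z = -q⁻¹ := by
      rw [Set.mem_singleton_iff] at h
      exact_mod_cast h
    exact hzq (by rw [this, abs_neg, abs_of_pos (inv_pos.2 hq0)])

lemma continuousAt_mu {z : ℝ} (hz : z ≠ 0) : ContinuousAt (mu : ℝ → ℝ) z := by
  unfold mu
  fun_prop (disch := assumption)

/-- Near this point, but off it, the first-difference formula holds with X in place of the singular
product; since X is analytic through the point, the formula is continuous there and gives the limit.
-/
lemma radialCasimir_special (hq0 : 0 < q) (hq1 : q < 1) (hs : s ≠ 0) (ht : t ≠ 0)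
    (hf : Continuous f)
    (hF : ∀ z ∈ annulus q, ∀ x : ℝ, mu z = x → F z = f x)
    (hXa : AnalyticOnNhd ℂ X (outerAnnulus (q ^ 2)))
    (hX : ∀ z, z ∉ ({(q : ℂ)⁻¹, -(q : ℂ)⁻¹} : Set ℂ) →
      X z = shiftCoeff q s t z * (F (q ^ 2 * z) - F z)) {z : ℝ} (hz : |z| = q⁻¹) :
    radialCasimir q s t f F (mu z) =
      (X z - shiftCoeff q s t (z / q ^ 2) * (f (mu z) - f (mu (z / q ^ 2)))) /
        ((z : ℂ) - (z : ℂ)⁻¹) := by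
  have hqi : 1 < q⁻¹ := (one_lt_inv₀ hq0).2 hq1
  have hqq : q⁻¹ < (q ^ 2)⁻¹ := by
    rw [inv_lt_inv₀ hq0 (by positivity)]
    nlinarith
  have hz1 : 1 < |z| := hz ▸ hqi
  have hz0 : z ≠ 0 := by
    rintro rfl
    norm_num at hz1
  have hm1 := one_lt_abs_mu hz1
  have hm0 : mu z ≠ 0 := by
    intro h
    rw [h] at hm1
    norm_num at hm1
  rw [radialCasimir, if_pos (Or.inr (by rw [abs_mu, hz, mu_inv]))]
  refine Tendsto.limUnder_eq ?_
  have hq : (q : ℂ) ≠ 0 := by exact_mod_cast hq0.ne'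
  have hzc : (z : ℂ) ≠ 0 := by exact_mod_cast hz0
  have hc1 : ContinuousAt (fun r : ℝ => shiftCoeff q s t (r / q ^ 2)) z := by
    refine ContinuousAt.comp (g := shiftCoeff q s t) (f := fun r : ℝ => (r : ℂ) / q ^ 2) ?_
      (by fun_prop)
    refine (analyticAt_shiftCoeff (div_ne_zero hzc (pow_ne_zero 2 hq)) ?_).continuousAt
    intro h
    have h2 : z ^ 2 = q ^ 2 := by
      have : (z : ℂ) ^ 2 = q ^ 2 := by
        field_simp at h
        exact h
      exact_mod_cast this
    rw [sq_eq_sq_iff_abs_eq_abs, hz, abs_of_pos hq0] at h2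
    rw [h2] at hqi
    exact absurd hqi hq1.not_gt
  have hc2 : ContinuousAt (fun r : ℝ => f (mu r)) z := hf.continuousAt.comp (continuousAt_mu hz0)
  have hc3 : ContinuousAt (fun r : ℝ => f (mu (r / q ^ 2))) z := by
    refine hf.continuousAt.comp (ContinuousAt.comp (g := mu) (f := fun r : ℝ => r / q ^ 2)
      (continuousAt_mu (by positivity)) (by fun_prop))
  have hc4 : ContinuousAt (fun r : ℝ => X r) z := by
    refine ContinuousAt.comp (g := X) (hXa _ ?_).continuousAt Complex.continuous_ofReal.continuousAt
    simp only [outerAnnulus, Set.mem_ofPred_eq, Complex.norm_real, Real.norm_eq_abs, hz]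
    exact ⟨hqi.le, hqq.le⟩
  have hden : (z : ℂ) - (z : ℂ)⁻¹ ≠ 0 := by
    intro h
    have h2 : z - z⁻¹ = 0 := by exact_mod_cast h
    have : z ^ 2 = 1 := by
      field_simp at h2
      linarith
    rw [← sq_abs] at this
    nlinarith
  have hc5 : ContinuousAt (fun r : ℝ => (X r - shiftCoeff q s t (r / q ^ 2) *
      (f (mu r) - f (mu (r / q ^ 2)))) / ((r : ℂ) - (r : ℂ)⁻¹)) z :=
    (hc4.sub (hc1.mul (hc2.sub hc3))).div
      (Complex.continuous_ofReal.continuousAt.sub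
        (Complex.continuous_ofReal.continuousAt.inv₀ hzc)) hden
  have hr := continuousAt_realMuInv hm0
  have hrz := realMuInv_mu hz1
  have hc6 := (ContinuousAt.comp (x := mu z) (f := realMuInv) (by rw [hrz]; exact hc5) hr).tendsto
  simp only [Function.comp_def, hrz] at hc6
  refine (hc6.mono_left nhdsWithin_le_nhds).congr' ?_
  have hn1 : ∀ᶠ y in 𝓝 (mu z), 1 < |y| := continuous_abs.continuousAt.eventually (lt_mem_nhds hm1)
  have hn2 : ∀ᶠ y in 𝓝 (mu z), 1 < |realMuInv y| ∧ |realMuInv y| < (q ^ 2)⁻¹ := by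
    have hc := (continuous_abs.continuousAt.comp hr).tendsto
    simp only [Function.comp_def, hrz] at hc
    rw [hz] at hc
    exact hc.eventually (Ioo_mem_nhds hqi hqq)
  -- The other point with |z| = q⁻¹ is -z; excluding it too lets `hne` be stated with absolute
  -- values.
  have hn3 : ∀ᶠ y in 𝓝 (mu z), y ≠ -mu z := by
    refine eventually_ne_nhds ?_
    intro h
    exact hm0 (by linarith)
  filter_upwards [self_mem_nhdsWithin, nhdsWithin_le_nhds hn1, nhdsWithin_le_nhds hn2,
    nhdsWithin_le_nhds hn3] with y hy hy1 hy2 hy3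
  have hne : |realMuInv y| ≠ q⁻¹ := by
    intro h
    rw [← hz] at h
    rcases abs_eq_abs.1 h with h | h
    · exact hy (by rw [Set.mem_singleton_iff, ← h, mu_realMuInv hy1])
    · exact hy3 (by rw [← mu_neg, ← h, mu_realMuInv hy1])
  have hmem : (realMuInv y : ℂ) ∈ outerAnnulus (q ^ 2) := by
    simp only [outerAnnulus, Set.mem_ofPred_eq, Complex.norm_real, Real.norm_eq_abs]
    exact ⟨hy2.1.le, hy2.2.le⟩
  have hden' : (realMuInv y : ℂ) - (realMuInv y : ℂ)⁻¹ ≠ 0 := by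
    intro h
    have h2 : realMuInv y - (realMuInv y)⁻¹ = 0 := by exact_mod_cast h
    have h3 : realMuInv y ≠ 0 := by
      intro h
      rw [h] at hy2
      norm_num at hy2
    have : (realMuInv y) ^ 2 = 1 := by
      field_simp at h2
      linarith
    rw [← sq_abs] at this
    nlinarith
  rw [diff_eq_ofReal hq0 hq1 hF hX hmem hne, ← sub_inv_mul_qDiffOp_pullback hq0 hs ht hF hy2.1,
    mul_div_cancel_left₀ _ hden', muInv_eq_ofReal hy1]

lemma exp_mul_I_inv_ne {θ : ℝ} (hθ : θ ∈ Set.Ioo 0 Real.pi) :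
    Complex.exp (θ * Complex.I) ^ 2 ≠ 1 := by
  intro h
  have him : (Complex.exp (θ * Complex.I)).im = Real.sin θ := Complex.exp_ofReal_mul_I_im θ
  have hs := (Real.sin_pos_of_mem_Ioo hθ).ne'
  rcases sq_eq_one_iff.1 h with h | h <;> rw [h] at him <;> simp at him <;> exact hs him.symm

theorem exists_radialData (hq0 : 0 < q) (hq1 : q < 1) (hs : s ≠ 0) (ht : t ≠ 0)
    (hf : Continuous f) (hF : IsAnalyticContinuation q f F) :
    ∃ X, RadialData q s t f F X (radialCasimir q s t f F) := by
  obtain ⟨h1, h2, h3⟩ := hF.basic hq0 hq1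
  obtain ⟨X, hXa, hX⟩ := exists_diff_continuation (s := s) (t := t) hq0 hq1 hF
  have hq : (q : ℂ) ≠ 0 := by exact_mod_cast hq0.ne'
  have hqi : 1 < q⁻¹ := (one_lt_inv₀ hq0).2 hq1
  have hqq : q⁻¹ < (q ^ 2)⁻¹ := by
    rw [inv_lt_inv₀ hq0 (by positivity)]
    nlinarith
  refine ⟨X, h1, h2, h3, hXa, hX, ?_, ?_, ?_⟩
  · intro θ hθ
    set z := Complex.exp (θ * Complex.I) with hzdef
    have hz0 : z ≠ 0 := Complex.exp_ne_zero _
    have hzn : ‖z‖ = 1 := Complex.norm_exp_ofReal_mul_I θ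
    have hz1 : z ^ 2 ≠ 1 := exp_mul_I_inv_ne hθ
    have hcos : |Real.cos θ| < 1 := by
      rw [← sq_lt_one_iff_abs_lt_one]
      nlinarith [Real.sin_pos_of_mem_Ioo hθ, Real.sin_sq_add_cos_sq θ]
    have hmq : 1 < mu q := by
      rw [← mu_inv]
      exact one_lt_mu hqi
    have hna : z ∈ outerAnnulus (q ^ 2) := by
      simp only [outerAnnulus, Set.mem_ofPred_eq, hzn, le_refl, true_and]
      exact (hqi.trans hqq).le
    have hnp : ‖z / (q : ℂ) ^ 2‖ = (q ^ 2)⁻¹ := by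
      rw [norm_div, hzn, norm_pow, Complex.norm_real, Real.norm_of_nonneg hq0.le, one_div]
    have hnb : z / (q : ℂ) ^ 2 ∈ outerAnnulus (q ^ 2) := by
      simp only [outerAnnulus, Set.mem_ofPred_eq, hnp, le_refl, and_true]
      exact (hqi.trans hqq).le
    have hS : ∀ w ∈ ({(q : ℂ)⁻¹, -(q : ℂ)⁻¹} : Set ℂ), ‖w‖ = q⁻¹ := by
      rintro w (rfl | rfl) <;> simp [abs_of_pos hq0]
    rw [radialCasimir, if_neg (by rintro (h | h) <;> linarith), muInv_cos hθ, ← hzdef,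
      sub_inv_mul_qDiffOp hq0 hs ht _ hz0 hz1, Complex.ofReal_pow, hX z, hX (z / q ^ 2),
      mul_div_cancel₀ z (pow_ne_zero 2 hq)]
    -- For |z| = 1 the shifted points q²z and z/q² lie on the boundary of the closed annulus, so
    -- `pullback` reads F at all three points.
    · have e1 := (mem_annulus_of_mem_outerAnnulus hq0 hq1 hna)
      have e2 := (mem_annulus_of_mem_outerAnnulus hq0 hq1 hnb)
      simp only [pullback, if_pos e1.1, if_pos e1.2, if_pos e2.1]
    · intro h
      exact absurd (hnp.symm.trans (hS _ h)) hqq.ne'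
    · intro h
      exact absurd (hzn.symm.trans (hS _ h)) hqi.ne
  · intro z hz hzq
    have h1' := one_lt_abs_mu hz
    rw [radialCasimir, if_neg, muInv_eq_ofReal h1', realMuInv_mu hz,
      sub_inv_mul_qDiffOp_pullback hq0 hs ht h3 hz]
    rintro (h | h)
    · exact h1'.ne' h
    · exact abs_mu_ne_of_abs_ne hq0 hq1 hz hzq h
  · intro z hz
    rw [radialCasimir_special hq0 hq1 hs ht hf h3 hXa hX hz, mul_div_cancel₀]
    intro h
    have h2 : z - z⁻¹ = 0 := by exact_mod_cast h
    have h0 : z ≠ 0 := by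
      rintro rfl
      rw [abs_zero] at hz
      exact (inv_pos.2 hq0).ne hz
    have h4 : z ^ 2 = 1 := by
      field_simp at h2
      linarith
    rw [← sq_abs, hz] at h4
    nlinarith

/-- Both the coefficient and the difference F(q²z) - F(z) change sign; ±q⁻¹ are fixed points of the
reflection. -/
lemma RadialData.reflect (hq0 : 0 < q) (hq1 : q < 1) (hs : s ≠ 0) (ht : t ≠ 0)
    (h : RadialData q s t f F X Lf) {z : ℂ} (hz : z ∈ outerAnnulus (q ^ 2)) :
    X ((q : ℂ) ^ 2 * z)⁻¹ = X z := by
  have hq : (q : ℂ) ≠ 0 := by exact_mod_cast hq0.ne'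
  have hz0 := ne_zero_of_mem_outerAnnulus hz
  obtain ⟨h1, h2⟩ := mem_annulus_of_mem_outerAnnulus hq0 hq1 hz
  by_cases hzS : z ∈ ({(q : ℂ)⁻¹, -(q : ℂ)⁻¹} : Set ℂ)
  · congr 1
    rw [inv_eq_iff_eq_inv, ← mul_eq_one_iff_eq_inv₀ hz0]
    linear_combination (sq_mul_sq_eq_one_iff hq0).2 hzS
  · have hzS' : ((q : ℂ) ^ 2 * z)⁻¹ ∉ ({(q : ℂ)⁻¹, -(q : ℂ)⁻¹} : Set ℂ) := by
      rw [← sq_mul_sq_eq_one_iff hq0] at hzS ⊢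
      intro h
      apply hzS
      field_simp at h
      linear_combination -h
    rw [h.diff_eq _ hzS', h.diff_eq _ hzS, shiftCoeff_reflect hq0 hs ht hz0, h.inv _ h2,
      mul_inv, mul_inv_cancel_left₀ (pow_ne_zero 2 hq), h.inv _ h1]
    ring

lemma analyticAt_conj_conj {Φ : ℂ → ℂ} {z : ℂ} (h : AnalyticAt ℂ Φ (conj z)) :
    AnalyticAt ℂ (fun z => conj (Φ (conj z))) z := by
  rw [Complex.analyticAt_iff_eventually_differentiableAt] at h ⊢
  have := (Complex.continuous_conj.tendsto z).eventually h
  filter_upwards [this] with w hw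
  have := hw.conj_conj
  rwa [Complex.conj_conj] at this

/-- This reduces the sesquilinear identity to a bilinear one. The coefficient has real parameters,
so it commutes with conjugation. On the circle conjugation is inversion, and `RadialData.reflect`
then exchanges X(z) with X(z/q²), which matches the sign change of z - z⁻¹. -/
lemma RadialData.conj (hq0 : 0 < q) (hq1 : q < 1) (hs : s ≠ 0) (ht : t ≠ 0)
    (h : RadialData q s t f F X Lf) :
    RadialData q s t (fun x => conj (f x)) (fun z => conj (F (conj z)))
      (fun z => conj (X (conj z))) (fun x => conj (Lf x)) := by
  have hann : ∀ z ∈ annulus q, conj z ∈ annulus q := fun z hz => by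
    simpa only [annulus, Set.mem_ofPred_eq, RCLike.norm_conj] using hz
  have hann' : ∀ z ∈ outerAnnulus (q ^ 2), conj z ∈ outerAnnulus (q ^ 2) := fun z hz => by
    simpa only [outerAnnulus, Set.mem_ofPred_eq, RCLike.norm_conj] using hz
  have hp0 : 0 < q ^ 2 := by positivity
  have hp1 : q ^ 2 ≤ 1 := pow_le_one₀ hq0.le hq1.le
  refine ⟨fun z hz => analyticAt_conj_conj (h.analytic _ (hann z hz)), ?_, ?_,
    fun z hz => analyticAt_conj_conj (h.analytic_diff _ (hann' z hz)), ?_, ?_, ?_, ?_⟩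
  · intro z hz
    rw [map_inv₀, h.inv _ (hann z hz)]
  · intro z hz x hx
    rw [h.eq_mu _ (hann z hz) x]
    rw [← Complex.conj_ofReal x, ← hx, mu, mu, map_div₀, map_add, map_inv₀, map_ofNat]
  · intro z hz
    rw [h.diff_eq]
    · rw [map_mul, conj_shiftCoeff, Complex.conj_conj]
      simp
    · intro h'
      apply hz
      simp only [Set.mem_insert_iff, Set.mem_singleton_iff] at h' ⊢
      refine h'.imp (fun h => ?_) fun h => ?_ <;>
      · rw [← Complex.conj_conj z, h]
        simp
  · intro θ hθ
    have h1 := congrArg (starRingEnd ℂ) (h.circle θ hθ)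
    set z := Complex.exp (θ * Complex.I) with hzdef
    have hzn : ‖z‖ = 1 := Complex.norm_exp_ofReal_mul_I θ
    have hzc : conj z = z⁻¹ := (Complex.inv_eq_conj hzn).symm
    have hna : z ∈ outerAnnulus (q ^ 2) := by
      simp only [outerAnnulus, Set.mem_ofPred_eq, hzn, le_refl, true_and]
      exact (one_le_inv₀ hp0).2 hp1
    have hnb : z / (q : ℂ) ^ 2 ∈ outerAnnulus (q ^ 2) := by
      simp only [outerAnnulus, Set.mem_ofPred_eq, norm_div, hzn, norm_pow, Complex.norm_real,
        Real.norm_of_nonneg hq0.le, one_div, le_refl, and_true]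
      exact (one_le_inv₀ hp0).2 hp1
    have e1 := h.reflect hq0 hq1 hs ht hna
    have e2 := h.reflect hq0 hq1 hs ht hnb
    have hq : (q : ℂ) ≠ 0 := by exact_mod_cast hq0.ne'
    rw [mul_div_cancel₀ z (pow_ne_zero 2 hq)] at e2
    rw [map_mul, map_sub, map_sub, map_inv₀, hzc, inv_inv] at h1
    simp only [map_div₀, Complex.conj_ofReal, hzc]
    rw [e2, show z⁻¹ / ((q ^ 2 : ℝ) : ℂ) = ((q : ℂ) ^ 2 * z)⁻¹ by push_cast; field_simp, e1,
      ← Complex.ofReal_pow]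
    linear_combination -h1
  · intro z hz hzq
    have h1 := congrArg (starRingEnd ℂ) (h.real z hz hzq)
    simp only [map_mul, map_sub, map_inv₀, Complex.conj_ofReal, conj_shiftCoeff, map_div₀,
      map_pow] at h1
    exact h1
  · intro z hz
    have h1 := congrArg (starRingEnd ℂ) (h.real_special z hz)
    simp only [map_mul, map_sub, map_inv₀, Complex.conj_ofReal, conj_shiftCoeff, map_div₀,
      map_pow] at h1
    simpa only [Complex.conj_ofReal] using h1

end

/-! ### Chain lengths and the integrand on the unit circle -/

section
variable {p : ℝ}

/-- Here n counts the chain points outside the closed unit disc. It may be 0, so the representative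
is a pⁿ/p rather than a power with exponent n - 1; the hypothesis p < |a| puts a/p outside the unit
disc in that case. -/
lemma exists_chain_length (hp0 : 0 < p) (hp1 : p < 1) {a : ℝ} (ha : p < |a|) :
    ∃ n : ℕ, (∀ k, 1 < |a * p ^ k| ↔ k < n) ∧ 1 < |a * p ^ n / p| ∧ |a * p ^ n / p| ≤ p⁻¹ := by
  have habs : ∀ k : ℕ, |a * p ^ k| = |a| * p ^ k := fun k => by
    rw [abs_mul, abs_of_pos (pow_pos hp0 k)]
  have ha0 : 0 < |a| := hp0.trans ha
  have hex : ∃ n : ℕ, |a| * p ^ n ≤ 1 := by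
    obtain ⟨n, hn⟩ := exists_pow_lt_of_lt_one (inv_pos.2 ha0) hp1
    refine ⟨n, ?_⟩
    have := mul_le_mul_of_nonneg_left hn.le ha0.le
    rwa [mul_inv_cancel₀ ha0.ne'] at this
  classical
  have hspec := Nat.find_spec hex
  have hmin : ∀ k, k < Nat.find hex → 1 < |a| * p ^ k := fun k hk =>
    not_le.1 (Nat.find_min hex hk)
  generalize Nat.find hex = n at hspec hmin
  have hdiv : |a * p ^ n / p| = |a| * p ^ n / p := by rw [abs_div, habs, abs_of_pos hp0]
  refine ⟨n, fun k => ⟨fun h => ?_, fun h => (habs k).symm ▸ hmin k h⟩, ?_, ?_⟩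
  · by_contra hk
    rw [habs] at h
    have := pow_le_pow_of_le_one hp0.le hp1.le (not_lt.1 hk)
    have := mul_le_mul_of_nonneg_left this ha0.le
    linarith
  · rw [hdiv, lt_div_iff₀ hp0, one_mul]
    rcases n with _ | n
    · simpa using ha
    · have := mul_lt_mul_of_pos_right (hmin n (Nat.lt_succ_self n)) hp0
      rw [pow_succ, ← mul_assoc]
      linarith
  · rw [hdiv, inv_eq_one_div]
    gcongr

lemma exists_ellWeight_pow_eq (hp0 : 0 < p) (hp1 : p < 1) {a : ℂ} (ha : a ≠ 0) (d : ℂ) (n : ℕ) :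
    ∃ C : ℂ, ∀ z ≠ 0, ellWeight p a d z = C * ellWeight p (a * p ^ n / p) d z := by
  have hp : (p : ℂ) ≠ 0 := by exact_mod_cast hp0.ne'
  induction n with
  | zero =>
    refine ⟨(a / p) ^ 2, fun z hz => ?_⟩
    rw [pow_zero, mul_one, ← ellWeight_mul_left hp0 hp1 (div_ne_zero ha hp) hz,
      mul_div_cancel₀ _ hp]
  | succ n ih =>
    obtain ⟨C, hC⟩ := ih
    have h0 : a * (p : ℂ) ^ n / p ≠ 0 := by positivity
    refine ⟨C * ((a * (p : ℂ) ^ n / p) ^ 2)⁻¹, fun z hz => ?_⟩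
    rw [hC z hz, show a * (p : ℂ) ^ (n + 1) / p = p * (a * p ^ n / p) by field_simp; ring,
      ellWeight_mul_left hp0 hp1 h0 hz, mul_assoc, inv_mul_cancel_left₀ (pow_ne_zero 2 h0)]

lemma IsPolePair.exists_tendsto_sub_mul (hp0 : 0 < p) (hp1 : p < 1) {v w : ℝ}
    (h : IsPolePair p v w) {s : ℂ} (hs : s ∈ outerAnnulus p) :
    ∃ c, Tendsto (fun z => (z - s) * ellWeight p v w z) (𝓝[≠] s) (𝓝 c) := by
  obtain ⟨c1, h1⟩ := exists_tendsto_sub_mul_poleKernel (p := p) v s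
  obtain ⟨c2, h2⟩ := exists_tendsto_sub_mul_poleKernel (p := p) w s
  have h3 : Tendsto (fun z => (z - s) * regularWeight p v w z) (𝓝[≠] s) (𝓝 0) := by
    by_cases hsS : s ∈ annulusPoles p v w
    · exact h.tendsto_regularWeight hp0 hp1 hsS
    · have hc : ContinuousAt (fun z => (z - s) * regularWeight p v w z) s :=
        ContinuousAt.mul (by fun_prop) (h.analyticAt_regularWeight hp0 hp1 hs hsS).continuousAt
      have := hc.tendsto.mono_left (nhdsWithin_le_nhds (s := {s}ᶜ))
      rwa [sub_self, zero_mul] at this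
  refine ⟨_, ((h3.add (h1.const_mul (ellResidue p v w))).add
    (h2.const_mul (ellResidue p w v))).congr fun z => ?_⟩
  rw [regularWeight]
  ring

lemma analyticAt_ellWeight_of_im_ne_zero (hp0 : 0 < p) (hp1 : p < 1) {a d : ℝ} (ha : a ≠ 0)
    (hd : d ≠ 0) {z : ℂ} (hz : z.im ≠ 0) : AnalyticAt ℂ (ellWeight p a d) z := by
  have hz0 : z ≠ 0 := by
    rintro rfl
    exact hz Complex.zero_im
  have key : ∀ x : ℂ, x.im ≠ 0 → theta p x ≠ 0 := fun x hx => by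
    refine theta_ne_zero hp0 hp1 (fun h => hx (by rw [h, Complex.zero_im])) fun n h => hx ?_
    rw [h, ← Complex.ofReal_zpow, Complex.ofReal_im]
  have k1 : ∀ b : ℝ, b ≠ 0 → theta p (b * z) ≠ 0 := fun b hb => key _ (by
    rw [Complex.im_ofReal_mul]
    exact mul_ne_zero hb hz)
  have k2 : ∀ b : ℝ, b ≠ 0 → theta p (b / z) ≠ 0 := fun b hb => key _ (by
    rw [div_eq_mul_inv, Complex.im_ofReal_mul, Complex.inv_im]
    exact mul_ne_zero hb (div_ne_zero (neg_ne_zero.2 hz) (Complex.normSq_pos.2 hz0).ne'))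
  exact analyticAt_ellWeight hp0 hp1 (by exact_mod_cast ha) (by exact_mod_cast hd) hz0 (k1 a ha)
    (k2 a ha) (k1 d hd) (k2 d hd)

lemma mem_outerAnnulus_of_norm_eq_one (hp0 : 0 < p) (hp1 : p < 1) {z : ℂ} (hz : ‖z‖ = 1) :
    z ∈ outerAnnulus p ∧ z / p ∈ outerAnnulus p := by
  have h : 1 ≤ p⁻¹ := (one_le_inv₀ hp0).2 hp1.le
  have h2 : ‖z / p‖ = p⁻¹ := by
    rw [norm_div, hz, Complex.norm_real, Real.norm_of_nonneg hp0.le, one_div]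
  refine ⟨⟨hz.ge, hz.le.trans h⟩, ?_, h2.le⟩
  rw [h2]
  exact h

lemma eq_one_or_eq_neg_one_of_im_eq_zero {z : ℂ} (hz : ‖z‖ = 1) (hi : z.im = 0) :
    z = 1 ∨ z = -1 := by
  obtain ⟨x, rfl⟩ : ∃ x : ℝ, z = x := ⟨z.re, Complex.ext rfl (by simpa using hi)⟩
  rw [Complex.norm_real, Real.norm_eq_abs] at hz
  rcases (abs_eq zero_le_one).1 hz with h | h <;> simp [h]

/-- On the circle the weight has at most simple poles, at ±1, where X(z) - X(z/p) vanishes. This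
gives integrability of Lf·g and f·Lg separately, not only of their difference. -/
lemma exists_analyticOnNhd_ellWeight_mul (hp0 : 0 < p) (hp1 : p < 1) {a d : ℝ} (ha : a ≠ 0)
    (hd : d ≠ 0) {m n : ℕ} (h : IsPolePair p (a * p ^ m / p) (d * p ^ n / p)) {X : ℂ → ℂ}
    (hX : AnalyticOnNhd ℂ X (outerAnnulus p)) (h1 : X (1 / p) = X 1) (h2 : X (-1 / p) = X (-1)) :
    ∃ R : ℂ → ℂ, AnalyticOnNhd ℂ R (Metric.sphere 0 1) ∧
      ∀ z ∉ ({1, -1} : Set ℂ), R z = ellWeight p a d z * (X z - X (z / p)) := by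
  have ha' : (a : ℂ) ≠ 0 := by exact_mod_cast ha
  have hd' : (d : ℂ) ≠ 0 := by exact_mod_cast hd
  have hp : (p : ℂ) ≠ 0 := by exact_mod_cast hp0.ne'
  have hXa : ∀ z : ℂ, ‖z‖ = 1 → AnalyticAt ℂ (fun z => X z - X (z / p)) z := fun z hz => by
    obtain ⟨e1, e2⟩ := mem_outerAnnulus_of_norm_eq_one hp0 hp1 hz
    exact (hX z e1).sub ((hX _ e2).fun_comp (f := fun z => z / (p : ℂ)) (by
      simp only [div_eq_mul_inv]
      fun_prop))
  obtain ⟨C1, hC1⟩ := exists_ellWeight_pow_eq hp0 hp1 ha' d m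
  obtain ⟨C2, hC2⟩ := exists_ellWeight_pow_eq hp0 hp1 hd' (a * p ^ m / p) n
  refine exists_analyticOnNhd_eq (Set.toFinite _) (fun z hz hzS => ?_) fun s hsS hs => ⟨?_, ?_⟩
  · have hz1 : ‖z‖ = 1 := by simpa using hz
    refine (analyticAt_ellWeight_of_im_ne_zero hp0 hp1 ha hd fun hi => hzS ?_).mul (hXa z hz1)
    exact eq_one_or_eq_neg_one_of_im_eq_zero hz1 hi
  · have hs1 : ‖s‖ = 1 := by simpa using hs
    have hs0 : s ≠ 0 := norm_pos_iff.1 (by rw [hs1]; exact one_pos)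
    exact (meromorphicAt_ellWeight hp0 hp1 ha' hd' hs0).mul (hXa s hs1).meromorphicAt
  · have hs1 : ‖s‖ = 1 := by simpa using hs
    have hs0 : s ≠ 0 := norm_pos_iff.1 (by rw [hs1]; exact one_pos)
    obtain ⟨c, hc⟩ := h.exists_tendsto_sub_mul hp0 hp1
      (mem_outerAnnulus_of_norm_eq_one hp0 hp1 hs1).1
    have ht := (hc.const_mul (C1 * C2)).mul
      ((hXa s hs1).continuousAt.tendsto.mono_left (nhdsWithin_le_nhds (s := {s}ᶜ)))
    have h0 : X s - X (s / p) = 0 := by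
      rcases hsS with rfl | rfl
      · rw [h1, sub_self]
      · rw [h2, sub_self]
    simp only [h0, mul_zero] at ht
    refine ht.congr' ?_
    filter_upwards [eventually_ne_nhdsNE s 0] with z hz
    rw [hC1 z hz, ellWeight_comm _ (d : ℂ), hC2 z hz, ellWeight_comm]
    push_cast
    ring

/-- The substitution θ ↦ 2π - θ folds the lower half circle onto the upper one. -/
lemma circleAverage_eq_integral_of_inv {D : ℂ → ℂ} (hD : CircleIntegrable D 0 1)
    (hinv : ∀ z : ℂ, ‖z‖ = 1 → z.im ≠ 0 → D z⁻¹ = D z) :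
    Real.circleAverage D 0 1 = 2 * ((1 / (2 * Real.pi) : ℝ) *
      ∫ θ in Set.Icc 0 Real.pi, D (Complex.exp (θ * Complex.I))) := by
  have hmap : ∀ θ : ℝ, circleMap 0 1 θ = Complex.exp (θ * Complex.I) := fun θ => by
    simp [circleMap]
  have hD' : IntervalIntegrable (fun θ => D (circleMap 0 1 θ)) volume 0 (2 * Real.pi) := hD
  have hpi := Real.pi_pos
  have i1 : IntervalIntegrable (fun θ => D (circleMap 0 1 θ)) volume 0 Real.pi :=
    hD'.mono_set (by
      rw [Set.uIcc_of_le hpi.le, Set.uIcc_of_le (by linarith)]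
      exact Set.Icc_subset_Icc_right (by linarith))
  have i2 : IntervalIntegrable (fun θ => D (circleMap 0 1 θ)) volume Real.pi (2 * Real.pi) :=
    hD'.mono_set (by
      rw [Set.uIcc_of_le (by linarith), Set.uIcc_of_le (by linarith)]
      exact Set.Icc_subset_Icc_left hpi.le)
  have h2 : ∫ θ in Real.pi..2 * Real.pi, D (circleMap 0 1 θ) =
      ∫ θ in 0..Real.pi, D (circleMap 0 1 θ) := by
    have := intervalIntegral.integral_comp_sub_left (a := 0) (b := Real.pi)
      (fun θ => D (circleMap 0 1 θ)) (2 * Real.pi)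
    rw [show 2 * Real.pi - Real.pi = Real.pi by ring, sub_zero] at this
    rw [← this, intervalIntegral.integral_of_le hpi.le, intervalIntegral.integral_of_le hpi.le,
      integral_Ioc_eq_integral_Ioo, integral_Ioc_eq_integral_Ioo]
    refine setIntegral_congr_fun measurableSet_Ioo fun θ hθ => ?_
    have e : circleMap 0 1 (2 * Real.pi - θ) = (circleMap 0 1 θ)⁻¹ := by
      rw [hmap, hmap, ← Complex.exp_neg]
      push_cast
      rw [sub_mul, Complex.exp_sub, Complex.exp_two_pi_mul_I, Complex.exp_neg, one_div]
    simp only [e]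
    refine hinv _ (by simp) ?_
    rw [hmap, Complex.exp_ofReal_mul_I_im]
    exact (Real.sin_pos_of_mem_Ioo hθ).ne'
  rw [Real.circleAverage_def, ← intervalIntegral.integral_add_adjacent_intervals i1 i2, h2,
    intervalIntegral.integral_of_le hpi.le, integral_Icc_eq_integral_Ioc]
  simp only [hmap, Complex.real_smul]
  push_cast
  ring

end

/-! ### Telescoping along the chains, and the bilinear Green formula -/

section
variable {q s t : ℝ} {f g : ℝ → ℂ} {F X G Z : ℂ → ℂ} {Lf Lg : ℝ → ℂ}

open Classical in
/-- The values of `X` on the real line outside the annulus are read through `f`. -/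
noncomputable def chainDiff (q s t : ℝ) (f : ℝ → ℂ) (X : ℂ → ℂ) (z : ℝ) : ℂ :=
  if |z| = q⁻¹ then X z else shiftCoeff q s t z * (f (mu (q ^ 2 * z)) - f (mu z))

/-- The Casoratian of `f` and `g` at `z`. -/
noncomputable def casoratian (q s t : ℝ) (f : ℝ → ℂ) (X : ℂ → ℂ) (g : ℝ → ℂ) (Z : ℂ → ℂ)
    (z : ℝ) : ℂ :=
  chainDiff q s t f X z * g (mu z) - f (mu z) * chainDiff q s t g Z z

lemma RadialData.chainDiff_eq (h : RadialData q s t f F X Lf) {z : ℝ} (hz : 1 < |z|) :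
    ((z : ℂ) - (z : ℂ)⁻¹) * Lf (mu z) = chainDiff q s t f X z -
      shiftCoeff q s t (z / q ^ 2) * (f (mu z) - f (mu (z / q ^ 2))) := by
  rw [chainDiff]
  split_ifs with hzq
  · exact h.real_special z hzq
  · exact h.real z hz hzq

lemma chainDiff_div (hq0 : 0 < q) (hq1 : q < 1) {z : ℝ} (hz : 1 < |z|) :
    chainDiff q s t f X (z / q ^ 2) =
      shiftCoeff q s t (z / q ^ 2) * (f (mu z) - f (mu (z / q ^ 2))) := by
  have hne : |z / q ^ 2| ≠ q⁻¹ := by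
    rw [abs_div, abs_of_pos (show 0 < q ^ 2 by positivity)]
    intro h
    have : |z| = q := by
      field_simp at h
      exact h
    linarith
  rw [chainDiff, if_neg hne, mul_div_cancel₀ z (pow_ne_zero 2 hq0.ne')]
  push_cast
  rfl

/-- The Green formula for the operator `L` on the real line. -/
lemma RadialData.sub_inv_mul (hq0 : 0 < q) (hq1 : q < 1) (hf : RadialData q s t f F X Lf)
    (hg : RadialData q s t g G Z Lg) {z : ℝ} (hz : 1 < |z|) :
    ((z - z⁻¹ : ℝ) : ℂ) * (Lf (mu z) * g (mu z) - f (mu z) * Lg (mu z)) =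
      casoratian q s t f X g Z z - casoratian q s t f X g Z (z / q ^ 2) := by
  rw [casoratian, casoratian, chainDiff_div hq0 hq1 hz, chainDiff_div hq0 hq1 hz]
  push_cast
  linear_combination g (mu z) * hf.chainDiff_eq hz - f (mu z) * hg.chainDiff_eq hz

lemma RadialData.chainDiff_eq_diff (hq0 : 0 < q) (hq1 : q < 1) (h : RadialData q s t f F X Lf)
    {z : ℝ} (hz : (z : ℂ) ∈ outerAnnulus (q ^ 2)) : chainDiff q s t f X z = X z := by
  rw [chainDiff]
  split_ifs with hzq
  · rfl
  · exact (diff_eq_ofReal hq0 hq1 h.eq_mu h.diff_eq hz hzq).symm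

/-- The Casoratian at the first point below the chain starting at `a = q s / t` vanishes, since
`1 / b` with `b = q t / s` is a zero of the coefficient. -/
lemma RadialData.chainDiff_start (hq0 : 0 < q) (hq1 : q < 1) (hs : s ≠ 0) (ht : t ≠ 0)
    (h : RadialData q s t f F X Lf) : chainDiff q s t f X (q * s / t / q ^ 2) = 0 := by
  have hq : (q : ℂ) ≠ 0 := by exact_mod_cast hq0.ne'
  have hs' : (s : ℂ) ≠ 0 := by exact_mod_cast hs
  have ht' : (t : ℂ) ≠ 0 := by exact_mod_cast ht
  set z := q * s / t / q ^ 2 with hz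
  have hzc : (z : ℂ) = s / (q * t) := by
    rw [hz]
    push_cast
    field_simp
  rw [chainDiff]
  split_ifs with hzq
  · have hmem : (z : ℂ) ∈ outerAnnulus (q ^ 2) := by
      simp only [outerAnnulus, Set.mem_ofPred_eq, Complex.norm_real, Real.norm_eq_abs, hzq]
      refine ⟨(one_le_inv₀ hq0).2 hq1.le, ?_⟩
      rw [inv_le_inv₀ hq0 (by positivity)]
      nlinarith
    -- In this degenerate case the factors 1 - qsy/t and 1 - qty/s coincide, giving a double zero of
    -- the numerator against a simple zero of 1 - q²y². So X still vanishes, by continuity.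
    have hst : (s : ℂ) ^ 2 = t ^ 2 := by
      have h1 : z ^ 2 = (q⁻¹) ^ 2 := by rw [← sq_abs, hzq]
      have h2 : s ^ 2 = t ^ 2 := by
        rw [hz] at h1
        field_simp at h1
        exact h1
      exact_mod_cast h2
    have hz0 : (z : ℂ) ≠ 0 := ne_zero_of_mem_outerAnnulus hmem
    have hzz : (q : ℂ) ^ 2 * z ^ 2 = 1 := by
      rw [hzc]
      field_simp
      exact hst
    obtain ⟨e1, e2⟩ := mem_annulus_of_mem_outerAnnulus hq0 hq1 hmem
    have hc : ContinuousAt (fun y : ℂ => (1 - q * s * t * y) * (1 - q * y / (s * t)) *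
        (1 - q * t * y / s) * (y * (1 + q * t * y / s))⁻¹ * (F (q ^ 2 * y) - F y)) z := by
      refine ContinuousAt.mul (ContinuousAt.mul (by fun_prop) (ContinuousAt.inv₀ (by fun_prop) ?_))
        (ContinuousAt.sub ?_ (h.analytic _ e1).continuousAt)
      · refine mul_ne_zero hz0 ?_
        rw [hzc, show (q : ℂ) * t * (s / (q * t)) / s = 1 by field_simp]
        norm_num
      · exact ((h.analytic _ e2).fun_comp (f := fun y => (q : ℂ) ^ 2 * y) (by
          fun_prop)).continuousAt
    have hfac : (1 : ℂ) - q * t * z / s = 0 := by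
      rw [hzc]
      field_simp
      ring
    have ht1 := hc.tendsto.mono_left (nhdsWithin_le_nhds (s := {(z : ℂ)}ᶜ))
    simp only [hfac] at ht1
    have ht2 := (h.analytic_diff _ hmem).continuousAt.tendsto.mono_left
      (nhdsWithin_le_nhds (s := {(z : ℂ)}ᶜ))
    have ht3 := ht1.neg
    rw [mul_zero, zero_mul, zero_mul, neg_zero] at ht3
    refine tendsto_nhds_unique ht2 (ht3.congr' ?_)
    filter_upwards [eventually_ne_nhdsNE (z : ℂ) (q : ℂ)⁻¹,
      eventually_ne_nhdsNE (z : ℂ) (-(q : ℂ)⁻¹), eventually_ne_nhdsNE (z : ℂ) 0] with y h1 h2 h3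
    have hyS : y ∉ ({(q : ℂ)⁻¹, -(q : ℂ)⁻¹} : Set ℂ) := by
      rintro (h | h)
      exacts [h1 h, h2 h]
    have hy := hyS
    rw [← sq_mul_sq_eq_one_iff hq0] at hy
    have e3 : (1 : ℂ) - q ^ 2 * y ^ 2 = (1 - q * t * y / s) * (1 + q * t * y / s) := by
      field_simp
      linear_combination -(q : ℂ) ^ 2 * y ^ 2 * hst
    have e4 : (1 : ℂ) - q * s * y / t = 1 - q * t * y / s := by
      field_simp
      linear_combination -q * y * hst
    have e5 : (1 : ℂ) - q ^ 2 * y ^ 2 ≠ 0 := sub_ne_zero.2 (Ne.symm hy)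
    rw [e3] at e5
    rw [h.diff_eq y hyS, shiftCoeff, e3, e4]
    generalize (1 : ℂ) - q * t * y / s = A at *
    generalize (1 : ℂ) + q * t * y / s = B at *
    have hA := left_ne_zero_of_mul e5
    have hB := right_ne_zero_of_mul e5
    field_simp
  · have : shiftCoeff q s t z = 0 := by
      rw [shiftCoeff, hzc, show (1 : ℂ) - q * t * (s / (q * t)) / s = 0 by field_simp; ring]
      ring
    rw [this, zero_mul]

lemma RadialData.casoratian_start (hq0 : 0 < q) (hq1 : q < 1) (hs : s ≠ 0) (ht : t ≠ 0)
    (hf : RadialData q s t f F X Lf) (hg : RadialData q s t g G Z Lg) :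
    casoratian q s t f X g Z (q * s / t / q ^ 2) = 0 := by
  rw [casoratian, hf.chainDiff_start hq0 hq1 hs ht, hg.chainDiff_start hq0 hq1 hs ht, zero_mul,
    mul_zero, sub_zero]

lemma RadialData.casoratian_eq (hq0 : 0 < q) (hq1 : q < 1)
    (hf : RadialData q s t f F X Lf) (hg : RadialData q s t g G Z Lg) {z : ℝ}
    (hz : (z : ℂ) ∈ outerAnnulus (q ^ 2)) :
    casoratian q s t f X g Z z = X z * G z - F z * Z z := by
  have hza := (mem_annulus_of_mem_outerAnnulus hq0 hq1 hz).1
  rw [casoratian, hf.chainDiff_eq_diff hq0 hq1 hz, hg.chainDiff_eq_diff hq0 hq1 hz,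
    hf.eq_mu _ hza _ (ofReal_mu z), hg.eq_mu _ hza _ (ofReal_mu z)]

/-- Telescoping of the inner part of a chain of mass points. -/
lemma RadialData.sum_chain (hq0 : 0 < q) (hq1 : q < 1)
    (hf : RadialData q s t f F X Lf) (hg : RadialData q s t g G Z Lg) {a : ℝ} (r : ℝ) {m : ℕ}
    (hm : ∀ k, 1 < |a * (q ^ 2) ^ k| ↔ k < m) :
    ∑ k ∈ Finset.range m, ((r * (a * (q ^ 2) ^ k - (a * (q ^ 2) ^ k)⁻¹) : ℝ) : ℂ) *
        (Lf (mu (a * (q ^ 2) ^ k)) * g (mu (a * (q ^ 2) ^ k)) -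
          f (mu (a * (q ^ 2) ^ k)) * Lg (mu (a * (q ^ 2) ^ k))) =
      r * (casoratian q s t f X g Z (a * (q ^ 2) ^ m / q ^ 2) -
        casoratian q s t f X g Z (a / q ^ 2)) := by
  have h := Finset.sum_range_sub (fun k => casoratian q s t f X g Z (a * (q ^ 2) ^ k / q ^ 2)) m
  rw [pow_zero, mul_one] at h
  rw [← h, Finset.mul_sum]
  refine Finset.sum_congr rfl fun k hk => ?_
  have hk' := (hm k).2 (Finset.mem_range.1 hk)
  have e : a * (q ^ 2) ^ (k + 1) / q ^ 2 = a * (q ^ 2) ^ k := by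
    field_simp
    ring
  rw [e, Complex.ofReal_mul, mul_assoc, hf.sub_inv_mul hq0 hq1 hg hk']

/-- Telescoping of the outer part of a chain of mass points. -/
lemma RadialData.sum_outer_chain (hq0 : 0 < q) (hq1 : q < 1)
    (hf : RadialData q s t f F X Lf) (hg : RadialData q s t g G Z Lg) {d : ℝ} (r : ℝ) {N : ℕ}
    (hd : q ^ 2 < |d|) (hfN : f (mu (d * ((q ^ 2) ^ (N + 1))⁻¹)) = 0)
    (hgN : g (mu (d * ((q ^ 2) ^ (N + 1))⁻¹)) = 0) :
    ∑ j ∈ Finset.range N,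
      ((r * (d * ((q ^ 2) ^ (j + 1))⁻¹ - (d * ((q ^ 2) ^ (j + 1))⁻¹)⁻¹) : ℝ) : ℂ) *
        (Lf (mu (d * ((q ^ 2) ^ (j + 1))⁻¹)) * g (mu (d * ((q ^ 2) ^ (j + 1))⁻¹)) -
          f (mu (d * ((q ^ 2) ^ (j + 1))⁻¹)) * Lg (mu (d * ((q ^ 2) ^ (j + 1))⁻¹))) =
      r * casoratian q s t f X g Z (d / q ^ 2) := by
  have h := Finset.sum_range_sub' (fun k => casoratian q s t f X g Z (d * ((q ^ 2) ^ (k + 1))⁻¹)) N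
  -- The first point beyond the sum: f and g vanish there, so the values of `chainDiff`, which also
  -- involve the preceding point, do not matter.
  have h0 : casoratian q s t f X g Z (d * ((q ^ 2) ^ (N + 1))⁻¹) = 0 := by
    rw [casoratian, hfN, hgN, mul_zero, zero_mul, sub_zero]
  rw [h0, sub_zero, zero_add, pow_one, ← div_eq_mul_inv] at h
  rw [← h, Finset.mul_sum]
  refine Finset.sum_congr rfl fun k _ => ?_
  have hk : 1 < |d * ((q ^ 2) ^ (k + 1))⁻¹| := by
    have h1 : (q ^ 2) ^ (k + 1) ≤ q ^ 2 := by
      rw [pow_succ]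
      exact mul_le_of_le_one_left (by positivity)
        (pow_le_one₀ (by positivity) (pow_le_one₀ hq0.le hq1.le))
    rw [abs_mul, abs_of_pos (a := ((q ^ 2) ^ (k + 1))⁻¹) (by positivity), ← div_eq_mul_inv,
      one_lt_div (by positivity)]
    linarith
  have e : d * ((q ^ 2) ^ (k + 1 + 1))⁻¹ = d * ((q ^ 2) ^ (k + 1))⁻¹ / q ^ 2 := by
    rw [pow_succ _ (k + 1)]
    field_simp
  rw [e, Complex.ofReal_mul, mul_assoc, hf.sub_inv_mul hq0 hq1 hg hk]

lemma nu_mul_neg_aux (hq0 : 0 < q) (hs : s ≠ 0) (ht : t ≠ 0) :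
    q * s / t * (-(q * s * t)) < 0 := by
  rw [show q * s / t * (-(q * s * t)) = -((q * s) ^ 2) by field_simp]
  have : q * s ≠ 0 := mul_ne_zero hq0.ne' hs
  exact neg_neg_of_pos (by positivity)

/-- The bilinear form of the claim, where the boundary terms of the three telescoping sums meet the
residues of the contour integral. The bound |t| ≤ |s| gives |qs/t| ≥ q > q², so the chain of this
parameter has a representative in the annulus and its partner q²/(qs/t) has no masses. -/
theorem RadialData.integral_nu_eq (hq0 : 0 < q) (hq1 : q < 1) (ht : 1 ≤ |t|) (hst : |t| ≤ |s|)
    (hf : RadialData q s t f F X Lf) (hg : RadialData q s t g G Z Lg)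
    (hfm : Measurable f) (hgm : Measurable g) (hLf : Measurable Lf) (hLg : Measurable Lg) {N : ℕ}
    (hfN : ∀ j ≥ N, f (mu (-(q * s * t) * ((q ^ 2) ^ (j + 1))⁻¹)) = 0)
    (hgN : ∀ j ≥ N, g (mu (-(q * s * t) * ((q ^ 2) ^ (j + 1))⁻¹)) = 0) :
    Integrable (fun x => Lf x * g x)
        (nu (q * s / t) (q ^ 2 / (q * s / t)) (-(q * s * t)) (q ^ 2)) ∧
      Integrable (fun x => f x * Lg x)
        (nu (q * s / t) (q ^ 2 / (q * s / t)) (-(q * s * t)) (q ^ 2)) ∧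
      ∫ x, Lf x * g x ∂(nu (q * s / t) (q ^ 2 / (q * s / t)) (-(q * s * t)) (q ^ 2)) =
        ∫ x, f x * Lg x ∂(nu (q * s / t) (q ^ 2 / (q * s / t)) (-(q * s * t)) (q ^ 2)) := by
  have hs : 1 ≤ |s| := ht.trans hst
  have ht0 : t ≠ 0 := abs_pos.1 (one_pos.trans_le ht)
  have hs0 : s ≠ 0 := abs_pos.1 (one_pos.trans_le hs)
  have hp0 : 0 < q ^ 2 := by positivity
  have hp1 : q ^ 2 < 1 := pow_lt_one₀ hq0.le hq1 two_ne_zero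
  have hqq : q ^ 2 < q := by nlinarith
  have hpc : ((q ^ 2 : ℝ) : ℂ) = (q : ℂ) ^ 2 := Complex.ofReal_pow q 2
  have had := nu_mul_neg_aux hq0 hs0 ht0
  have habs_a : |q * s / t| = q * (|s| / |t|) := by
    rw [abs_div, abs_mul, abs_of_pos hq0, mul_div_assoc]
  have habs_d : |-(q * s * t)| = q * (|s| * |t|) := by
    rw [abs_neg, abs_mul, abs_mul, abs_of_pos hq0, mul_assoc]
  have hqa : q ≤ |q * s / t| := by
    rw [habs_a]
    exact le_mul_of_one_le_right hq0.le ((one_le_div (abs_pos.2 ht0)).2 hst)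
  have hqd : q ≤ |-(q * s * t)| := by
    rw [habs_d]
    exact le_mul_of_one_le_right hq0.le (one_le_mul_of_one_le_of_one_le hs ht)
  have hstart := hf.casoratian_start hq0 hq1 hs0 ht0 hg
  have hf1 := hf.circle
  have hg1 := hg.circle
  generalize q * s / t = a at *
  generalize -(q * s * t) = d at *
  have ha0 : a ≠ 0 := left_ne_zero_of_mul had.ne
  have hd0 : d ≠ 0 := right_ne_zero_of_mul had.ne
  have hpa : |q ^ 2 / a| ≤ 1 := by
    rw [abs_div, abs_of_pos hp0, div_le_one (abs_pos.2 ha0)]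
    linarith
  have hpd : |q ^ 2 / d| < 1 := by
    rw [abs_div, abs_of_pos hp0, div_lt_one (abs_pos.2 hd0)]
    linarith
  obtain ⟨m, hm, hm1, hm2⟩ := exists_chain_length hp0 hp1 (hqq.trans_le hqa)
  obtain ⟨n, hn, hn1, hn2⟩ := exists_chain_length hp0 hp1 (hqq.trans_le hqd)
  have hpair : IsPolePair (q ^ 2) (a * (q ^ 2) ^ m / q ^ 2) (d * (q ^ 2) ^ n / q ^ 2) := by
    refine ⟨hm1, hm2, hn1, hn2, ?_⟩
    rw [show a * (q ^ 2) ^ m / q ^ 2 * (d * (q ^ 2) ^ n / q ^ 2) =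
      a * d * ((q ^ 2) ^ m / q ^ 2 * ((q ^ 2) ^ n / q ^ 2)) by ring]
    exact mul_neg_of_neg_of_pos had (by positivity)
  have hv : ((a * (q ^ 2) ^ m / q ^ 2 : ℝ) : ℂ) ∈ outerAnnulus (q ^ 2) := by
    simp only [outerAnnulus, Set.mem_ofPred_eq, Complex.norm_real, Real.norm_eq_abs]
    exact ⟨hm1.le, hm2⟩
  have hw : ((d * (q ^ 2) ^ n / q ^ 2 : ℝ) : ℂ) ∈ outerAnnulus (q ^ 2) := by
    simp only [outerAnnulus, Set.mem_ofPred_eq, Complex.norm_real, Real.norm_eq_abs]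
    exact ⟨hn1.le, hn2⟩
  have hone : ∀ {f : ℝ → ℂ} {F X : ℂ → ℂ} {Lf : ℝ → ℂ}, RadialData q s t f F X Lf →
      ∀ e : ℂ, e * e = 1 → X (e / (q ^ 2 : ℝ)) = X e := fun {f F X Lf} h e he => by
    have he1 : ‖e‖ = 1 := by
      have := congrArg norm he
      rw [norm_mul, norm_one] at this
      nlinarith [norm_nonneg e]
    have := h.reflect hq0 hq1 hs0 ht0 (mem_outerAnnulus_of_norm_eq_one hp0 hp1 he1).1
    rwa [mul_inv, ← eq_inv_of_mul_eq_one_left he, ← hpc, mul_comm, ← div_eq_mul_inv] at this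
  obtain ⟨Rf, hRf, hRf'⟩ := exists_analyticOnNhd_ellWeight_mul hp0 hp1 ha0 hd0 hpair
    hf.analytic_diff (hone hf 1 (by norm_num)) (hone hf (-1) (by norm_num))
  obtain ⟨Rg, hRg, hRg'⟩ := exists_analyticOnNhd_ellWeight_mul hp0 hp1 ha0 hd0 hpair
    hg.analytic_diff (hone hg 1 (by norm_num)) (hone hg (-1) (by norm_num))
  have hcircle : ∀ z : ℂ, ‖z‖ = 1 →
      z ∈ outerAnnulus (q ^ 2) ∧ z / (q ^ 2 : ℝ) ∈ outerAnnulus (q ^ 2) :=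
    fun z hz => mem_outerAnnulus_of_norm_eq_one hp0 hp1 hz
  have hexp : ∀ θ : ℝ, ‖Complex.exp (θ * Complex.I)‖ = 1 := Complex.norm_exp_ofReal_mul_I
  have hspec : ∀ z : ℂ, z.im ≠ 0 → z ∉ ({1, -1} : Set ℂ) := by
    rintro z hz (rfl | rfl) <;> simp at hz
  have hexpim : ∀ θ ∈ Set.Ioo 0 Real.pi, (Complex.exp (θ * Complex.I)).im ≠ 0 := fun θ hθ => by
    rw [Complex.exp_ofReal_mul_I_im]
    exact (Real.sin_pos_of_mem_Ioo hθ).ne'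
  have hmu : ∀ θ : ℝ, mu (Complex.exp (θ * Complex.I)) = (Real.cos θ : ℂ) := fun θ => by
    rw [mu, ← Complex.exp_neg, Complex.ofReal_cos, Complex.cos]
    ring_nf
  have hannc : ∀ z : ℂ, ‖z‖ = 1 → z ∈ annulus q := fun z hz =>
    (mem_annulus_of_mem_outerAnnulus hq0 hq1 (hcircle z hz).1).1
  have hFc : ∀ θ : ℝ, F (Complex.exp (θ * Complex.I)) = f (Real.cos θ) := fun θ =>
    hf.eq_mu _ (hannc _ (hexp θ)) _ (hmu θ)
  have hGc : ∀ θ : ℝ, G (Complex.exp (θ * Complex.I)) = g (Real.cos θ) := fun θ =>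
    hg.eq_mu _ (hannc _ (hexp θ)) _ (hmu θ)
  have hsph : ∀ z : ℂ, z ∈ Metric.sphere (0 : ℂ) 1 ↔ ‖z‖ = 1 := fun z => by simp
  have hD1 : ContinuousOn (fun z => Rf z * G z) (Metric.sphere 0 1) := fun z hz =>
    ((hRf z hz).continuousAt.mul
      (hg.analytic z (hannc z ((hsph z).1 hz))).continuousAt).continuousWithinAt
  have hD2 : ContinuousOn (fun z => F z * Rg z) (Metric.sphere 0 1) := fun z hz =>
    ((hf.analytic z (hannc z ((hsph z).1 hz))).continuousAt.mul
      (hRg z hz).continuousAt).continuousWithinAt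
  have hint : ∀ D : ℂ → ℂ, ContinuousOn D (Metric.sphere 0 1) →
      IntegrableOn (fun θ : ℝ => D (Complex.exp (θ * Complex.I))) (Set.Icc 0 Real.pi) := by
    intro D hD
    refine Continuous.integrableOn_Icc (hD.comp_continuous (by fun_prop) fun θ => ?_)
    rw [hsph]
    exact hexp θ
  obtain ⟨i1, e1⟩ := integral_nu hp0 hp1 had hpa hpd hm hn (h := fun x => Lf x * g x)
    (hLf.mul hgm) (N := N) (fun j hj => by rw [hgN j hj, mul_zero]) (hint _ hD1) (fun θ hθ => by
      rw [weight_eq hp0 hp1 ha0 hd0 (Complex.exp_ne_zero _), hRf' _ (hspec _ (hexpim θ hθ)), hGc]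
      linear_combination ellWeight (q ^ 2) a d (Complex.exp (θ * Complex.I)) * g (Real.cos θ) *
        hf1 θ hθ)
  obtain ⟨i2, e2⟩ := integral_nu hp0 hp1 had hpa hpd hm hn (h := fun x => f x * Lg x)
    (hfm.mul hLg) (N := N) (fun j hj => by rw [hfN j hj, zero_mul]) (hint _ hD2) (fun θ hθ => by
      rw [weight_eq hp0 hp1 ha0 hd0 (Complex.exp_ne_zero _), hRg' _ (hspec _ (hexpim θ hθ)), hFc]
      linear_combination ellWeight (q ^ 2) a d (Complex.exp (θ * Complex.I)) * f (Real.cos θ) *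
        hg1 θ hθ)
  refine ⟨i1, i2, ?_⟩
  set J : ℂ → ℂ := fun z => X z * G z - F z * Z z with hJdef
  have hJa : AnalyticOnNhd ℂ J (outerAnnulus (q ^ 2)) := fun z hz => by
    have hza := (mem_annulus_of_mem_outerAnnulus hq0 hq1 hz).1
    exact ((hf.analytic_diff z hz).mul (hg.analytic z hza)).sub
      ((hf.analytic z hza).mul (hg.analytic_diff z hz))
  have hJr : ∀ z ∈ outerAnnulus (q ^ 2), J ((q ^ 2 : ℝ) * z)⁻¹ = J z := fun z hz => by
    have hz0 := ne_zero_of_mem_outerAnnulus hz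
    have hzS : ∀ {f : ℝ → ℂ} {F X : ℂ → ℂ} {Lf : ℝ → ℂ}, RadialData q s t f F X Lf →
        F ((q ^ 2 : ℝ) * z)⁻¹ = F ((q : ℂ) ^ 2 * z) := fun {f F X Lf} h => by
      rw [h.inv _ (by rw [hpc]; exact (mem_annulus_of_mem_outerAnnulus hq0 hq1 hz).2), hpc]
    simp only [hJdef]
    rw [hzS hf, hzS hg, hpc, hf.reflect hq0 hq1 hs0 ht0 hz, hg.reflect hq0 hq1 hs0 ht0 hz]
    by_cases hzS : z ∈ ({(q : ℂ)⁻¹, -(q : ℂ)⁻¹} : Set ℂ)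
    · have : (q : ℂ) ^ 2 * z = z⁻¹ := by
        rw [← mul_eq_one_iff_eq_inv₀ hz0]
        linear_combination (sq_mul_sq_eq_one_iff hq0).2 hzS
      have hza := (mem_annulus_of_mem_outerAnnulus hq0 hq1 hz).1
      rw [this, hf.inv _ hza, hg.inv _ hza]
    · rw [hf.diff_eq z hzS, hg.diff_eq z hzS]
      ring
  -- Reading F and G at z instead of z/q² changes XG and FZ by the same amount, the coefficient
  -- times (F(z) - F(z/q²))(G(z) - G(z/q²)). The same cancellation underlies `hJr`.
  have hJd : ∀ z : ℂ, ‖z‖ = 1 → J (z / (q ^ 2 : ℝ)) =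
      X (z / (q ^ 2 : ℝ)) * G z - F z * Z (z / (q ^ 2 : ℝ)) := fun z hz => by
    have hzn : ‖z / ((q ^ 2 : ℝ) : ℂ)‖ = (q ^ 2)⁻¹ := by
      rw [norm_div, hz, Complex.norm_real, Real.norm_of_nonneg hp0.le, one_div]
    have hzS : z / ((q ^ 2 : ℝ) : ℂ) ∉ ({(q : ℂ)⁻¹, -(q : ℂ)⁻¹} : Set ℂ) := by
      intro h
      have : ‖z / ((q ^ 2 : ℝ) : ℂ)‖ = q⁻¹ := by
        rcases h with h | h <;> rw [h] <;> simp [abs_of_pos hq0]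
      rw [hzn, inv_inj] at this
      linarith
    simp only [hJdef]
    rw [hf.diff_eq _ hzS, hg.diff_eq _ hzS, hpc,
      mul_div_cancel₀ z (pow_ne_zero 2 (by exact_mod_cast hq0.ne'))]
    ring
  have hDJ : ∀ z : ℂ, ‖z‖ = 1 → z.im ≠ 0 → Rf z * G z - F z * Rg z =
      ellWeight (q ^ 2) a d z * (J z - J (z / (q ^ 2 : ℝ))) := fun z hz hzi => by
    rw [hRf' z (hspec z hzi), hRg' z (hspec z hzi), hJd z hz]
    simp only [hJdef]
    ring
  have hinv : ∀ z : ℂ, ‖z‖ = 1 → z.im ≠ 0 →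
      Rf z⁻¹ * G z⁻¹ - F z⁻¹ * Rg z⁻¹ = Rf z * G z - F z * Rg z := fun z hz hzi => by
    have hz0 : z ≠ 0 := norm_pos_iff.1 (by rw [hz]; exact one_pos)
    have hpc0 : ((q ^ 2 : ℝ) : ℂ) ≠ 0 := by exact_mod_cast hp0.ne'
    have k1 := hJr _ (hcircle z hz).1
    have k2 := hJr _ (hcircle z hz).2
    rw [mul_div_cancel₀ _ hpc0] at k2
    rw [hDJ z hz hzi, hDJ z⁻¹ (by rw [norm_inv, hz, inv_one]) (by
      rw [Complex.inv_im]
      exact div_ne_zero (neg_ne_zero.2 hzi) (Complex.normSq_pos.2 hz0).ne'),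
      ellWeight_inv hp0 hp1 hz0, k2, div_eq_mul_inv z⁻¹, ← mul_inv, mul_comm z, k1]
    ring
  have hci : CircleIntegrable (fun z => Rf z * G z - F z * Rg z) 0 1 :=
    ContinuousOn.circleIntegrable zero_le_one (hD1.sub hD2)
  have key := circleAverage_eq_integral_of_inv hci hinv
  rw [circleAverage_congr_of_im_ne_zero hDJ, circleAverage_ellWeight hp0 hp1 ha0 hd0 hpair hJa
    (hJr _ hv) (hJr _ hw), integral_sub (hint _ hD1) (hint _ hD2)] at key
  have c1 := hf.sum_chain hq0 hq1 hg (realResidue (q ^ 2) a d) hm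
  have c2 := hf.sum_chain hq0 hq1 hg (realResidue (q ^ 2) d a) hn
  have c3 := hf.sum_outer_chain hq0 hq1 hg (realResidue (q ^ 2) d a) (hqq.trans_le hqd)
    (hfN N le_rfl) (hgN N le_rfl)
  rw [hf.casoratian_eq hq0 hq1 hg hv, hstart, sub_zero] at c1
  rw [hf.casoratian_eq hq0 hq1 hg hw] at c2
  have hms : ∀ u v w : ℂ, u * (v - w) = u * v - u * w := mul_sub
  simp only [hms, Finset.sum_sub_distrib] at c1 c2 c3
  rw [ofReal_realResidue hp0 hp1] at c1 c2 c3
  rw [e1, e2]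
  simp only [hJdef] at key
  -- With v, w the representatives, r, r' the residues and C the Casoratian, the chains contribute r
  -- J(v), r'(J(w) - C(d/q²)) and r' C(d/q²), and the half circle contributes -(r J(v) + r' J(w)).
  linear_combination c1 + c2 + c3 - key / 2

end

/-! ### Exchanging s and t, compact support, and the conclusion -/

lemma h0_swap (a b c d q : ℝ) : h0 b a c d q = h0 a b c d q := by
  simp only [h0, qPochInf, List.map_cons, List.map_nil, List.prod_cons, List.prod_nil, mul_comm b a]
  ring

lemma weight_swap (a b c d q : ℝ) (z : ℂ) : weight b a c d q z = weight a b c d q z := by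
  simp only [weight, qPochInf, List.map_cons, List.map_nil, List.prod_cons, List.prod_nil]
  ring

lemma awMass_swap_left (a b c d q : ℝ) (k : ℕ) : awMass c b a d q k = awMass c a b d q k := by
  simp only [awMass, qPochInf, qPoch, List.map_cons, List.map_nil, List.prod_cons, List.prod_nil,
    mul_right_comm c b a]
  ring

lemma nuMass_swap (a b d q : ℝ) (k : ℕ) : nuMass b a d q k = nuMass a b d q k := by
  simp only [nuMass, qPochInf, List.map_cons, List.map_nil, List.prod_cons, List.prod_nil]
  ring

/-- Exchanging s and t exchanges qs/t with qt/s and fixes -qst and ψ, so this symmetry removes the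
assumption |t| ≤ |s|. -/
lemma nu_swap (a b d q : ℝ) : nu b a d q = nu a b d q := by
  have e1 : awContinuousPart b a (q / d) d q = awContinuousPart a b (q / d) d q := by
    simp only [awContinuousPart, weight_swap a b]
  have e2 : ∀ c e, awPointPart c b a e q = awPointPart c a b e q := fun c e => by
    simp only [awPointPart, awMass_swap_left a b]
  have e3 : awMeasure b a (q / d) d q = awMeasure a b (q / d) d q := by
    rw [awMeasure, awMeasure, h0_swap, e1, e2, e2, add_comm (awPointPart b a _ _ _)]
  simp only [nu, h0_swap a b, e3, nuMass_swap a b]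

lemma psi_swap (q s t : ℝ) (z : ℂ) : psi q t s z = psi q s t z := by
  simp only [psi, mul_comm (t : ℂ) s, mul_right_comm (q : ℂ) t s]
  ring

lemma radialCasimir_swap (q s t : ℝ) (f : ℝ → ℂ) (F : ℂ → ℂ) :
    radialCasimir q t s f F = radialCasimir q s t f F := by
  funext x
  simp only [radialCasimir, qDiffOp, psi_swap q s t]

lemma eventually_eq_zero_of_hasCompactSupport {p : ℝ} (hp0 : 0 < p) (hp1 : p < 1) {d : ℝ}
    (hd : d ≠ 0) {f : ℝ → ℂ} (hf : HasCompactSupport f) :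
    ∀ᶠ j : ℕ in atTop, f (mu (d * (p ^ (j + 1))⁻¹)) = 0 := by
  have h1 : Tendsto (fun j : ℕ => |mu (d * (p ^ (j + 1))⁻¹)|) atTop atTop := by
    have h2 : Tendsto (fun j : ℕ => |d| / 2 * (p⁻¹) ^ (j + 1)) atTop atTop :=
      ((tendsto_add_atTop_iff_nat 1).2
        (tendsto_pow_atTop_atTop_of_one_lt ((one_lt_inv₀ hp0).2 hp1))).const_mul_atTop
          (half_pos (abs_pos.2 hd))
    refine tendsto_atTop_mono (fun j => ?_) h2
    rw [abs_mu, mu, abs_mul, abs_of_pos (a := (p ^ (j + 1))⁻¹) (by positivity), inv_pow]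
    have : 0 ≤ (|d| * (p ^ (j + 1))⁻¹)⁻¹ := by positivity
    linarith
  have h3 : Tendsto (fun j : ℕ => mu (d * (p ^ (j + 1))⁻¹)) atTop (cocompact ℝ) := by
    rw [← Metric.cobounded_eq_cocompact, ← tendsto_norm_atTop_iff_cobounded]
    exact h1
  rw [hasCompactSupport_iff_eventuallyEq, coclosedCompact_eq_cocompact] at hf
  exact h3.eventually hf

theorem integral_radialCasimir_mul_conj {q s t : ℝ} (hq0 : 0 < q) (hq1 : q < 1) (ht : 1 ≤ |t|)
    (hst : |t| ≤ |s|) {f g : ℝ → ℂ} (hf : Continuous f) (hfc : HasCompactSupport f)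
    (hg : Continuous g) (hgc : HasCompactSupport g) {F G : ℂ → ℂ}
    (hF : IsAnalyticContinuation q f F) (hG : IsAnalyticContinuation q g G) :
    Integrable (fun x => radialCasimir q s t f F x * conj (g x))
        (nu (q * s / t) (q * t / s) (-(q * s * t)) (q ^ 2)) ∧
      Integrable (fun x => f x * conj (radialCasimir q s t g G x))
        (nu (q * s / t) (q * t / s) (-(q * s * t)) (q ^ 2)) ∧
      ∫ x, radialCasimir q s t f F x * conj (g x)
          ∂(nu (q * s / t) (q * t / s) (-(q * s * t)) (q ^ 2)) =
        ∫ x, f x * conj (radialCasimir q s t g G x)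
          ∂(nu (q * s / t) (q * t / s) (-(q * s * t)) (q ^ 2)) := by
  have ht0 : t ≠ 0 := abs_pos.1 (one_pos.trans_le ht)
  have hs0 : s ≠ 0 := abs_pos.1 (one_pos.trans_le (ht.trans hst))
  have hp0 : 0 < q ^ 2 := by positivity
  have hp1 : q ^ 2 < 1 := pow_lt_one₀ hq0.le hq1 two_ne_zero
  have hd0 : -(q * s * t) ≠ 0 := neg_ne_zero.2 (mul_ne_zero (mul_ne_zero hq0.ne' hs0) ht0)
  obtain ⟨X, hX⟩ := exists_radialData hq0 hq1 hs0 ht0 hf hF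
  obtain ⟨Z, hZ⟩ := exists_radialData hq0 hq1 hs0 ht0 hg hG
  obtain ⟨N, hN⟩ := eventually_atTop.1
    ((eventually_eq_zero_of_hasCompactSupport hp0 hp1 hd0 hfc).and
      (eventually_eq_zero_of_hasCompactSupport hp0 hp1 hd0 hgc))
  have hb : q * t / s = q ^ 2 / (q * s / t) := by
    field_simp
  have hmc : Measurable (starRingEnd ℂ) := Complex.continuous_conj.measurable
  rw [hb]
  exact hX.integral_nu_eq hq0 hq1 ht hst (hZ.conj hq0 hq1 hs0 ht0) hf.measurable
    (hmc.comp hg.measurable) (measurable_radialCasimir hf hX.analytic.continuousOn)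
    (hmc.comp (measurable_radialCasimir hg hZ.analytic.continuousOn)) (fun j hj => (hN j hj).1)
    fun j hj => by rw [(hN j hj).2, map_zero]

end AskeyWilson

theorem proposition6p8 (q s t : ℝ) (hq0 : 0 < q) (hq1 : q < 1) (hs : 1 ≤ |s|) (ht : 1 ≤ |t|)
    (f g : ℝ → ℂ) (hf : Continuous f) (hfc : HasCompactSupport f)
    (hg : Continuous g) (hgc : HasCompactSupport g)
    (F G : ℂ → ℂ) (hF : AskeyWilson.IsAnalyticContinuation q f F)
    (hG : AskeyWilson.IsAnalyticContinuation q g G) :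
    Integrable (fun x => AskeyWilson.radialCasimir q s t f F x * conj (g x))
        (AskeyWilson.nu (q * s / t) (q * t / s) (-(q * s * t)) (q ^ 2)) ∧
      Integrable (fun x => f x * conj (AskeyWilson.radialCasimir q s t g G x))
        (AskeyWilson.nu (q * s / t) (q * t / s) (-(q * s * t)) (q ^ 2)) ∧
      ∫ x, AskeyWilson.radialCasimir q s t f F x * conj (g x)
          ∂(AskeyWilson.nu (q * s / t) (q * t / s) (-(q * s * t)) (q ^ 2)) =
        ∫ x, f x * conj (AskeyWilson.radialCasimir q s t g G x)
          ∂(AskeyWilson.nu (q * s / t) (q * t / s) (-(q * s * t)) (q ^ 2)) := by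
  rcases le_total |t| |s| with h | h
  · exact AskeyWilson.integral_radialCasimir_mul_conj hq0 hq1 ht h hf hfc hg hgc hF hG
  · rw [AskeyWilson.nu_swap, mul_right_comm q s t]
    simp only [← AskeyWilson.radialCasimir_swap q s t]
    exact AskeyWilson.integral_radialCasimir_mul_conj hq0 hq1 hs h hf hfc hg hgc hF hG
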